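/- Let $\Gamma$ be a discrete group of Möbius transformations of the upper half-plane $\mathbb H$ (the image in $\mathrm{PSL}_2\mathbb R$ of a discrete subgroup of $\mathrm{SL}_2\mathbb R$) such that the hyperbolic orbifold $X=\Gamma\backslash\mathbb H$ has finite area. Let $\overline X$ be its compactification by the cusps $c_i$, and let $L=T\overline X(-\sum_i c_i)$ be the line bundle over $\overline X$ whose holomorphic sections are the holomorphic sections of $T\overline X$ vanishing at the cusps; thus $L|_X=TX$, and near a cusp with local coordinate $w$ the section $w\,\partial/\partial w$ is a frame of $L$. Let $h$ be a smooth Hermitian metric on $L$, let $r\colon L\to[0,\infty)$ be the length function of $h$, and let $\rho\colon[0,\infty)\to\mathbb R$ be smooth and compactly supported with $\rho\equiv 1$ near $0$. Let $\psi$ be a global angular form on $L$, that is, a $1$-form on the complement of the zero section of $L$ such that, in holomorphic local trivializations $U\times\mathbb C$ of $L$ (over orbifold charts), $$\psi=\frac1{2\pi}\,\frac{x\,dy-y\,dx}{x^2+y^2}+\pi^*\eta$$ for some smooth $1$-form $\eta$ on $U$, where $x+iy$ is the coordinate of $\mathbb C$ and $\pi$ is the bundle projection. Let $\Psi=d(\rho(r)\psi)$.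 (This form extends smoothly over the zero section to a compactly supported closed $2$-form on $L$, which represents the Thom class of $L$ up to sign.) Let $\mathcal C_X$ be the canonical measured foliation of $TX$: let $Q$ be the complex plane with the quadratic differential $q=\frac1{2z}dz^2$. The map $$\Phi\colon\mathbb H\times Q\to T\mathbb H,\qquad \Phi\bigl(z,(u+iv)^2\bigr)=\Bigl(z,(u+zv)^2\tfrac{\partial}{\partial z}\Bigr)\quad(u,v\in\mathbb R)$$ carries the foliation of $\mathbb H\times Q$ by the leaves $\mathbb H\times\{\ast\}$, with transverse measure $|q|=\frac{1}{2|z|}\,dx\,dy$ (where $z=x+iy$), to a $\Gamma$-invariant measured foliation of $T\mathbb H$, and $\mathcal C_X$ is the induced measured foliation of $TX=\Gamma\backslash T\mathbb H$. Then the integral of $\Psi$ over $\mathcal C_X$ (along the leaves, and then against the transverse measure) converges absolutely, and $$\int_{\mathcal C_X}\Psi=0 .$$ -/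

import Mathlib

open MeasureTheory Set
open scoped ContDiff MatrixGroups UpperHalfPlane

noncomputable section

namespace CanonicalFoliation

/-! ### Differential forms on open subsets of real normed spaces -/

/-- Real differential `k`-forms on `E`. -/
abbrev Form (E : Type*) [NormedAddCommGroup E] [NormedSpace ℝ E] (k : ℕ) : Type _ :=
  E → E [⋀^Fin k]→L[ℝ] ℝ

/-- The pull-back `f^* α`. -/
def pullback {E E' : Type*} [NormedAddCommGroup E] [NormedSpace ℝ E]
    [NormedAddCommGroup E'] [NormedSpace ℝ E'] {k : ℕ} (f : E → E') (α : Form E' k) : Form E k :=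
  fun p => (α (f p)).compContinuousLinearMap (fderiv ℝ f p)

/-! ### The orbifold `X = Γ \ ℍ` and its tangent bundle

`Γ` is a subgroup of `SL(2, ℝ)`; the orbifold `Γ \ ℍ` depends only on the image of `Γ` in
`PSL(2, ℝ)`, and every subgroup of `PSL(2, ℝ)` is such an image.  Points of `Tℍ` are written as
`(z, t) ∈ ℂ × ℂ`, `0 < Im z`, standing for the tangent vector `t ∂/∂z` at `z`.  Objects on the
orbifold `TX` are `Γ`-invariant objects on `Tℍ`. -/

/-- The upper half-plane as an open subset of `ℂ`. -/
def upper : Set ℂ := {z | 0 < z.im}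

/-- The action of `SL(2, ℝ)` on `Tℍ` by derivatives of Möbius transformations,
`(z, t) ↦ (A z, (A)'(z) t)` with `A' (z) = (c z + d)⁻²`. -/
def tangentAct (A : SL(2, ℝ)) (p : ℂ × ℂ) : ℂ × ℂ :=
  (((A 0 0 : ℂ) * p.1 + (A 0 1 : ℂ)) / ((A 1 0 : ℂ) * p.1 + (A 1 1 : ℂ)),
    p.2 / ((A 1 0 : ℂ) * p.1 + (A 1 1 : ℂ)) ^ 2)

/-- The image of `Γ` in the group of transformations of `ℍ`, that is, in `PSL(2, ℝ)`. -/
def transformations (Γ : Subgroup SL(2, ℝ)) : Subgroup (Equiv.Perm ℍ) :=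
  Γ.map (MulAction.toPermHom SL(2, ℝ) ℍ)

/-- `F` is a fundamental domain for `X = Γ \ ℍ`, up to null sets
(`volume` on `ℍ` is the hyperbolic area `dx dy / y²`). -/
def IsFundDomain (Γ : Subgroup SL(2, ℝ)) (F : Set ℍ) : Prop :=
  IsFundamentalDomain (transformations Γ) F (volume : Measure ℍ)

/-- `X = Γ \ ℍ` has finite hyperbolic area. -/
def FiniteVolume (Γ : Subgroup SL(2, ℝ)) : Prop :=
  ∃ F : Set ℍ, IsFundDomain Γ F ∧ volume F < ⊤

/-! ### The cusps, and the bundle `L = T X̄ (- ∑ cᵢ)`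

Over `X` the bundle `L` is `TX`.  Let `c = σ(i∞)` be a cusp, where `σ ∈ SL(2, ℝ)` is chosen so that
the stabilizer of `i∞` in `σ⁻¹ Γ σ` is generated by `z ↦ z + 2π`.  Then `w = e^{iz}` is a
holomorphic coordinate of `X̄` around `c`, with `w = 0` at `c`, and near `c` the bundle `L` has the
holomorphic frame `w ∂/∂w`, i.e. the coordinates `(w, s)` on `L` stand for `s w ∂/∂w` at `w`.
As `∂/∂z = i w ∂/∂w`, they are related to `(z, t)` by `w = e^{iz}`, `s = i t`. -/

/-- `σ` carries `i∞` to a cusp of `Γ` and normalizes its width to `2π`. -/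
def IsCuspUniformizer (Γ : Subgroup SL(2, ℝ)) (σ : SL(2, ℝ)) : Prop :=
  (∀ γ ∈ Γ, (σ⁻¹ * γ * σ) 1 0 = 0 →
      ∃ n : ℤ, ∀ z : ℍ, (σ⁻¹ * γ * σ) • z = (2 * Real.pi * n : ℝ) +ᵥ z) ∧
    ∃ γ ∈ Γ, ∀ z : ℍ, (σ⁻¹ * γ * σ) • z = (2 * Real.pi : ℝ) +ᵥ z

/-- The change of coordinates `(z, t) ↦ (w, s) = (e^{iz}, i t)`. -/
def cuspCoord (p : ℂ × ℂ) : ℂ × ℂ :=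
  (Complex.exp (Complex.I * p.1), Complex.I * p.2)

/-! ### Hermitian metrics on `L` -/

/-- In a holomorphic trivialization of a line bundle, a Hermitian metric is given by a positive
function `h` of the base point; the squared length of the vector `p.2` over `p.1` is
`h(p.1) |p.2|²`. -/
def normSq (h : ℂ → ℝ) (p : ℂ × ℂ) : ℝ := h p.1 * ‖p.2‖ ^ 2

/-- `h` is (the lift to `Tℍ` of) a smooth Hermitian metric on the line bundle `L` over `X̄`:
a smooth `Γ`-invariant Hermitian metric on `Tℍ` which at each cusp, in the coordinates `(w, s)`,
extends to a smooth Hermitian metric over a neighborhood of `w = 0`. -/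
structure IsHermitianMetric (Γ : Subgroup SL(2, ℝ)) (h : ℂ → ℝ) : Prop where
  smooth : ContDiffOn ℝ ∞ h upper
  pos : ∀ z ∈ upper, 0 < h z
  invariant : ∀ γ ∈ Γ, ∀ p : ℂ × ℂ, p.1 ∈ upper → normSq h (tangentAct γ p) = normSq h p
  cusp : ∀ σ : SL(2, ℝ), IsCuspUniformizer Γ σ → ∃ ε > 0, ∃ k : ℂ → ℝ,
    ContDiffOn ℝ ∞ k (Metric.ball 0 ε) ∧ (∀ w ∈ Metric.ball 0 ε, 0 < k w) ∧
      ∀ p : ℂ × ℂ, p.1 ∈ upper → (cuspCoord p).1 ∈ Metric.ball 0 ε →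
        normSq h (tangentAct σ p) = normSq k (cuspCoord p)

/-- The function `r` on `L`: the length of vectors. -/
def radius (h : ℂ → ℝ) (p : ℂ × ℂ) : ℝ := Real.sqrt (normSq h p)

/-- `ρ : [0, ∞) → ℝ` is smooth, compactly supported, and identically `1` near `0`. -/
structure IsBump (ρ : ℝ → ℝ) : Prop where
  smooth : ContDiffOn ℝ ∞ ρ (Ici 0)
  compact_support : ∃ K : ℝ, ∀ r, K ≤ r → ρ r = 0
  one_near_zero : ∃ δ > 0, ∀ r, 0 ≤ r → r < δ → ρ r = 1

/-! ### Global angular forms -/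

/-- The angular form `(1 / 2π) (x dy - y dx) / (x² + y²)` in the fiber coordinate `x + i y` of the
trivial bundle `ℂ × ℂ → ℂ`. -/
def dθ : Form (ℂ × ℂ) 1 := fun p =>
  ContinuousAlternatingMap.ofSubsingleton ℝ (ℂ × ℂ) ℝ (0 : Fin 1)
    ((1 / (2 * Real.pi) / (p.2.re ^ 2 + p.2.im ^ 2)) •
      (p.2.re • (Complex.imCLM ∘L ContinuousLinearMap.snd ℝ ℂ ℂ) -
        p.2.im • (Complex.reCLM ∘L ContinuousLinearMap.snd ℝ ℂ ℂ)))

/-- Off the zero section of the trivial bundle over `U`, `ψ = dθ + π^* η` for some smooth `1`-form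
`η` on `U`. -/
def IsAngularOver (U : Set ℂ) (ψ : Form (ℂ × ℂ) 1) : Prop :=
  ∃ η : Form ℂ 1, ContDiffOn ℝ ∞ η U ∧
    ∀ p : ℂ × ℂ, p.1 ∈ U → p.2 ≠ 0 → ψ p = dθ p + pullback Prod.fst η p

/-- `ψ` is (the lift to `Tℍ` of) a global angular form on `L`: a `1`-form on the complement of the
zero section of `L` which in the local trivializations of `L` (over the orbifold chart `ℍ` of `X`,
and in the coordinates `(w, s)` around each cusp) is `dθ + π^* η` with `η` smooth.
Changing the trivialization only changes `η`. -/
structure IsGlobalAngularForm (Γ : Subgroup SL(2, ℝ)) (ψ : Form (ℂ × ℂ) 1) : Prop where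
  invariant : ∀ γ ∈ Γ, ∀ p : ℂ × ℂ, p.1 ∈ upper → p.2 ≠ 0 → pullback (tangentAct γ) ψ p = ψ p
  angular : IsAngularOver upper ψ
  cusp : ∀ σ : SL(2, ℝ), IsCuspUniformizer Γ σ → ∃ ε > 0, ∃ ψc : Form (ℂ × ℂ) 1,
    IsAngularOver (Metric.ball 0 ε) ψc ∧
      ∀ p : ℂ × ℂ, p.1 ∈ upper → p.2 ≠ 0 → (cuspCoord p).1 ∈ Metric.ball 0 ε →
        pullback (tangentAct σ) ψ p = pullback cuspCoord ψc p

/-- `Ψ` is the form `d(ρ(r) ψ)`, which is defined off the zero section, where `ψ` is.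
(It extends smoothly over the zero section, since `d(ρ(r) ψ) = dψ = π^* dη` near it.
The values on the zero section, a null set for the foliation below, are left free.) -/
def IsThomForm (h : ℂ → ℝ) (ρ : ℝ → ℝ) (ψ : Form (ℂ × ℂ) 1) (Ψ : Form (ℂ × ℂ) 2) : Prop :=
  ∀ p : ℂ × ℂ, p.1 ∈ upper → p.2 ≠ 0 →
    Ψ p = extDeriv (fun p' => ρ (radius h p') • ψ p') p

/-! ### The canonical foliation -/

/-- The map `Φ : ℍ × Q → Tℍ`, `(z, (u + i v)²) ↦ (z, (u + z v)²)` for real `u`, `v`. -/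
def Phi (z q : ℂ) : ℂ × ℂ :=
  (z, (((q ^ (1 / 2 : ℂ)).re : ℂ) + z * ((q ^ (1 / 2 : ℂ)).im : ℂ)) ^ 2)

/-- The choice of the square root `u + i v` does not matter. -/
theorem Phi_sq (z : ℂ) (u v : ℝ) :
    Phi z (((u : ℂ) + Complex.I * v) ^ 2) = (z, ((u : ℂ) + z * v) ^ 2) := by
  set a : ℂ := (u : ℂ) + Complex.I * v with ha
  have hre : a.re = u := by simp [ha]
  have him : a.im = v := by simp [ha]
  have h : ((a ^ 2) ^ (1 / 2 : ℂ)) ^ 2 = a ^ 2 := by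
    rw [← Complex.cpow_nat_mul]; simp
  rcases sq_eq_sq_iff_eq_or_eq_neg.mp h with h | h
  · simp only [Phi, h, hre, him]
  · simp only [Phi, h, Complex.neg_re, Complex.neg_im, hre, him]
    congr 1; push_cast; ring

/-- The action `A ∘ q` of `SL(2, ℝ)` on `Q = ℂ` is the one for which squaring intertwines it with
`A · (x + i y) = (a x - b y) + i (- c x + d y)`. -/
theorem Phi_equivariant (A : SL(2, ℝ)) (z : ℂ) (hz : z ∈ upper) (x y : ℝ) :
    tangentAct A (Phi z (((x : ℂ) + Complex.I * y) ^ 2)) =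
      Phi (tangentAct A (z, 0)).1 ((((A 0 0 * x - A 0 1 * y : ℝ) : ℂ) +
        Complex.I * ((- A 1 0 * x + A 1 1 * y : ℝ) : ℂ)) ^ 2) := by
  have hdet : (A 0 0 : ℂ) * A 1 1 - A 0 1 * A 1 0 = 1 := by
    have := A.det_coe
    rw [Matrix.det_fin_two] at this
    exact_mod_cast this
  have hne : (A 1 0 : ℂ) * z + A 1 1 ≠ 0 := by
    intro h0
    have h1 := congrArg Complex.im h0
    have h2 := congrArg Complex.re h0
    have hz' : z.im ≠ 0 := ne_of_gt hz
    simp [hz'] at h1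
    simp [h1] at h2
    rw [h1, h2] at hdet
    simp at hdet
  rw [Phi_sq, Phi_sq]
  simp only [tangentAct]
  congr 1
  rw [← div_pow]
  congr 1
  rw [div_eq_iff hne]
  push_cast
  have key (P N D W : ℂ) (hD : D ≠ 0) : (P + N / D * W) * D = P * D + N * W := by
    field_simp
  rw [key _ _ _ _ hne]
  linear_combination (-(x : ℂ) - z * y) * hdet

/-- The measure `|q|` on `Q = ℂ` of the quadratic differential `q = (1 / 2z) dz²`, which is the
transverse measure of the horizontal foliation of `ℍ × Q`. -/
def transverseMeasure : Measure ℂ :=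
  volume.withDensity fun z => ENNReal.ofReal (1 / (2 * ‖z‖))

/-- The restriction of the `2`-form `Ψ` to the leaf `z ↦ Φ(z, q)`, evaluated on the oriented
hyperbolic-orthonormal frame `y ∂/∂x`, `y ∂/∂y`; that is, its density with respect to the leafwise
hyperbolic area. -/
def leafDensity (Ψ : Form (ℂ × ℂ) 2) (x : ℍ × ℂ) : ℝ :=
  pullback (fun z : ℂ => Phi z x.2) Ψ (x.1 : ℂ) ![(x.1.im : ℂ), (x.1.im : ℂ) * Complex.I]

/-- The integral of `Ψ` over the measured foliation `𝒞_X` of `TX` converges absolutely and equals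
`I`.  Via `Φ`, the foliation `𝒞_X` is the quotient by `Γ` of the horizontal foliation of `ℍ × Q`;
its integral is the integral of `Ψ` along the leaves, with respect to the transverse measure, over
a fundamental domain `F × Q` of `Γ` in `ℍ × Q`. -/
def HasFoliationIntegral (Γ : Subgroup SL(2, ℝ)) (Ψ : Form (ℂ × ℂ) 2) (I : ℝ) : Prop :=
  ∀ F : Set ℍ, IsFundDomain Γ F →
    Integrable (leafDensity Ψ) (((volume : Measure ℍ).restrict F).prod transverseMeasure) ∧
      ∫ x, leafDensity Ψ x ∂(((volume : Measure ℍ).restrict F).prod transverseMeasure) = I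

end CanonicalFoliation

end

/-! The form is integrated over the fibers of `TX` until only an exact form on `X` is left. Write `y
= Im z`, `c = √h`, and let `b` be the coefficient of `η`, so that `η = Re (b dz)`. On the leaf `z ↦
(z, W ^ 2)` with `W = u + z v`, put `p = W ^ 2`, `r = c |p|` and let `φ = conj p / |p|` be the
phase. Since `v = Im W / y`, the angular form restricts to the leaf with coefficient `β + φ /
(2πy)`, where `β = b - 1 / (2πy)` is `connection`. In the same way `d log r` has coefficient `-l +
iφ / y`, where `l` (`logGrad`) is the coefficient of `d log f` and `f = 1 / (y c)` is `invLength`.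
Hence the leafwise density of `Ψ` is `r ρ'(r) (A + Re (k φ)) + ρ(r) C` with `A`, `k`, `C` functions
of `z` alone (`im_sq_mul_curl_leaf`).

Squaring turns Lebesgue measure into `|q|` and turns `Φ(z, ·)` into a real linear map of determinant
`y`, so the transverse measure pushes forward to `1 / y` times the same measure on the fiber
(`map_Phi_transverseMeasure`). There the phase term is odd and integrates to zero, and an
integration by parts replaces `r ρ'` by `-ρ` (`integral_fiberDensity`). What remains is a constant
times `f (C - A)`, which is exactly the hyperbolic density of `d (f Re (β dz))`
(`im_sq_mul_curl_invLength_mul`).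

The correction `-1 / (2πy)` comes from the hyperbolic connection and makes `Re (β dz)` an honest
invariant form on `X` (`connection_mob`). The function `f` is invariant too and tends to zero at the
cusps, because the frame of `L` there is a constant multiple of `∂/∂z`. The forms `β`, `l` and `dβ`
are bounded in the hyperbolic metric: near a cusp because `y |e^{iz}| ≤ 1`, elsewhere by
compactness. Stokes' theorem with the cutoffs `cutoff (n f)` and dominated convergence on a space of
finite area then give zero (`integral_curl_eq_zero_of_bounded`).

The compactness used is Siegel's theorem `exists_compact_union_cusps`, obtained from a thick-thin
decomposition: commutators contract near the identity, the thick part is cocompact by an area count,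
and the thin part is covered by sublevel sets of finitely many displacement functions. -/

noncomputable section

open scoped Pointwise Topology

namespace CanonicalFoliation

/-! ### Displacement of Möbius transformations -/

lemma SL2_det (A : SL(2, ℝ)) : A 0 0 * A 1 1 - A 0 1 * A 1 0 = 1 := by
  have := A.det_coe
  rwa [Matrix.det_fin_two] at this

lemma SL2_coe_smul (A : SL(2, ℝ)) (z : ℍ) :
    ((A • z : ℍ) : ℂ) = ((A 0 0 : ℂ) * z + A 0 1) / ((A 1 0 : ℂ) * z + A 1 1) := by
  simpa using UpperHalfPlane.coe_specialLinearGroup_apply A z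

lemma SL2_denom_ne_zero (A : SL(2, ℝ)) {z : ℂ} (hz : z.im ≠ 0) :
    (A 1 0 : ℂ) * z + A 1 1 ≠ 0 := by
  intro h0
  have h1 := congrArg Complex.im h0
  have h2 := congrArg Complex.re h0
  simp [hz] at h1
  simp [h1] at h2
  have := SL2_det A
  rw [h1, h2] at this
  simp at this

lemma SL2_im_smul (A : SL(2, ℝ)) (z : ℍ) :
    (A • z : ℍ).im = z.im / Complex.normSq ((A 1 0 : ℂ) * z + A 1 1) := by
  rw [← UpperHalfPlane.coe_im, SL2_coe_smul, Complex.div_im, ← sub_div]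
  congr 1
  simp
  linear_combination z.im * SL2_det A

/-- `2 (cosh d(z, A z) - 1)`. -/
def displacement (A : SL(2, ℝ)) (z : ℍ) : ℝ := 2 * (Real.cosh (dist z (A • z)) - 1)

/-- The squared Frobenius distance from the identity of `A`, conjugated to the base point `z`. -/
def deviation (A : SL(2, ℝ)) (z : ℍ) : ℝ := displacement A z + 2 * (2 - A.1.trace)

/-- The quadratic polynomial whose roots are the fixed points of `A`. -/
def fixPoly (A : SL(2, ℝ)) (z : ℂ) : ℂ := A 1 0 * z ^ 2 + (A 1 1 - A 0 0) * z - A 0 1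

/-- The difference `z - A z` is `fixPoly A z` divided by the automorphy factor, and the same factor
in `Im (A z)` cancels it in the formula for `cosh`. -/
lemma displacement_eq (A : SL(2, ℝ)) (z : ℍ) :
    displacement A z = Complex.normSq (fixPoly A z) / z.im ^ 2 := by
  have hd := SL2_denom_ne_zero A (z := z) z.im_ne_zero
  have hd' : Complex.normSq ((A 1 0 : ℂ) * z + A 1 1) ≠ 0 := by simpa using hd
  have hz := z.im_ne_zero
  have h1 : (z : ℂ) - (A • z : ℍ) = fixPoly A z / ((A 1 0 : ℂ) * z + A 1 1) := by
    rw [SL2_coe_smul, fixPoly, eq_div_iff hd, sub_mul, div_mul_cancel₀ _ hd]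
    ring
  rw [displacement, UpperHalfPlane.cosh_dist, Complex.dist_eq, ← Complex.normSq_eq_norm_sq, h1,
    map_div₀, SL2_im_smul]
  field_simp
  ring

lemma displacement_nonneg (A : SL(2, ℝ)) (z : ℍ) : 0 ≤ displacement A z := by
  have := Real.one_le_cosh (dist z (A • z))
  unfold displacement; linarith

lemma displacement_conj (A g : SL(2, ℝ)) (z : ℍ) :
    displacement (g * A * g⁻¹) (g • z) = displacement A z := by
  simp [displacement, mul_smul]

lemma trace_conj (A g : SL(2, ℝ)) : (g * A * g⁻¹).1.trace = A.1.trace := by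
  have : (g * A * g⁻¹).1 = g.1 * A.1 * (g⁻¹).1 := rfl
  rw [this, Matrix.trace_mul_comm, ← Matrix.mul_assoc]
  have : (g⁻¹).1 * g.1 = 1 := by
    have := congrArg Subtype.val (inv_mul_cancel g)
    exact this
  rw [this, Matrix.one_mul]

lemma deviation_conj (A g : SL(2, ℝ)) (z : ℍ) :
    deviation (g * A * g⁻¹) (g • z) = deviation A z := by
  rw [deviation, displacement_conj, trace_conj, deviation]

lemma deviation_I (A : SL(2, ℝ)) : deviation A UpperHalfPlane.I =
    (A 0 0 - 1) ^ 2 + A 0 1 ^ 2 + A 1 0 ^ 2 + (A 1 1 - 1) ^ 2 := by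
  rw [deviation, displacement_eq, fixPoly, Matrix.trace_fin_two]
  simp [Complex.normSq_apply]
  linear_combination (-2) * SL2_det A

lemma continuous_displacement (A : SL(2, ℝ)) : Continuous (displacement A) := by
  unfold displacement
  have : Continuous fun z : ℍ => A • z := continuous_const_smul A
  fun_prop

/-! ### Frobenius norms of matrices conjugated to a base point -/

section Frobenius

attribute [local instance] Matrix.frobeniusNormedRing

lemma frobenius_sq (M : Matrix (Fin 2) (Fin 2) ℝ) :
    ‖M‖ ^ 2 = M 0 0 ^ 2 + M 0 1 ^ 2 + M 1 0 ^ 2 + M 1 1 ^ 2 := by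
  rw [Matrix.frobenius_norm_def, ← Real.rpow_natCast, ← Real.rpow_mul (by positivity)]
  simp [Fin.sum_univ_two]
  ring

/-- By conjugation invariance the formula is only needed at `i`, which `z.toSL2R` carries to `z`. -/
lemma deviation_eq_norm (A : SL(2, ℝ)) (z : ℍ) :
    deviation A z = ‖(z.toSL2R⁻¹ * A * z.toSL2R).1 - 1‖ ^ 2 := by
  have h := deviation_conj (z.toSL2R⁻¹ * A * z.toSL2R) z.toSL2R UpperHalfPlane.I
  rw [UpperHalfPlane.toSL2R_smul_I] at h
  rw [show z.toSL2R * (z.toSL2R⁻¹ * A * z.toSL2R) * z.toSL2R⁻¹ = A by group] at h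
  rw [h, deviation_I, frobenius_sq]
  simp

lemma norm_sq_eq_cosh (A : SL(2, ℝ)) (z : ℍ) :
    ‖(z.toSL2R⁻¹ * A * z.toSL2R).1‖ ^ 2 = 2 * Real.cosh (dist z (A • z)) := by
  set B := z.toSL2R⁻¹ * A * z.toSL2R
  have h := displacement_conj B z.toSL2R UpperHalfPlane.I
  rw [UpperHalfPlane.toSL2R_smul_I,
    show z.toSL2R * B * z.toSL2R⁻¹ = A by simp only [B]; group, displacement_eq B] at h
  simp [fixPoly, Complex.normSq_apply] at h
  rw [displacement] at h
  rw [frobenius_sq]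
  linear_combination -h + 2 * SL2_det B

lemma norm_inv_SL2 (A : SL(2, ℝ)) : ‖(A⁻¹).1‖ = ‖A.1‖ := by
  rw [← sq_eq_sq₀ (norm_nonneg _) (norm_nonneg _), frobenius_sq, frobenius_sq]
  simp [Matrix.SpecialLinearGroup.coe_inv, Matrix.adjugate_fin_two]
  ring

lemma norm_one_frobenius : ‖(1 : Matrix (Fin 2) (Fin 2) ℝ)‖ ≤ 3 / 2 := by
  have h := frobenius_sq 1
  simp at h
  nlinarith [norm_nonneg (1 : Matrix (Fin 2) (Fin 2) ℝ)]

lemma SL2_val_mul_inv (A : SL(2, ℝ)) : A.1 * (A⁻¹).1 = 1 := by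
  exact congrArg Subtype.val (mul_inv_cancel A)

lemma SL2_val_inv_mul (A : SL(2, ℝ)) : (A⁻¹).1 * A.1 = 1 := by
  exact congrArg Subtype.val (inv_mul_cancel A)

/-- The difference `B A - A B` is unchanged when `1` is subtracted from both matrices, so
commutators are quadratically close to the identity. -/
lemma norm_commutator_sub_one_le (A B : SL(2, ℝ)) :
    ‖(B * A * B⁻¹ * A⁻¹).1 - 1‖ ≤ 2 * ‖B.1 - 1‖ * ‖A.1 - 1‖ * ‖B.1‖ * ‖A.1‖ := by
  have h : (B * A * B⁻¹ * A⁻¹).1 - 1 =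
      ((B.1 - 1) * (A.1 - 1) - (A.1 - 1) * (B.1 - 1)) * (B⁻¹).1 * (A⁻¹).1 := by
    have e : (B.1 - 1) * (A.1 - 1) - (A.1 - 1) * (B.1 - 1) = B.1 * A.1 - A.1 * B.1 := by
      noncomm_ring
    rw [e]
    have : (B * A * B⁻¹ * A⁻¹).1 = B.1 * A.1 * (B⁻¹).1 * (A⁻¹).1 := rfl
    rw [this, sub_mul, sub_mul, Matrix.mul_assoc A.1 B.1, SL2_val_mul_inv, Matrix.mul_one,
      SL2_val_mul_inv]
  rw [h]
  calc _ ≤ ‖(B.1 - 1) * (A.1 - 1) - (A.1 - 1) * (B.1 - 1)‖ * ‖(B⁻¹).1‖ * ‖(A⁻¹).1‖ :=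
        (norm_mul_le _ _).trans (by gcongr; exact norm_mul_le _ _)
    _ ≤ (2 * ‖B.1 - 1‖ * ‖A.1 - 1‖) * ‖(B⁻¹).1‖ * ‖(A⁻¹).1‖ := by
        gcongr
        refine (norm_sub_le _ _).trans ?_
        have h1 := norm_mul_le (B.1 - 1) (A.1 - 1)
        have h2 := norm_mul_le (A.1 - 1) (B.1 - 1)
        linarith
    _ = _ := by rw [norm_inv_SL2, norm_inv_SL2]

lemma deviation_nonneg (A : SL(2, ℝ)) (z : ℍ) : 0 ≤ deviation A z := by
  rw [deviation_eq_norm]; positivity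

lemma deviation_eq_zero_iff {A : SL(2, ℝ)} {z : ℍ} : deviation A z = 0 ↔ A = 1 := by
  rw [deviation_eq_norm, sq_eq_zero_iff, norm_eq_zero, sub_eq_zero]
  constructor
  · intro h
    have h' : z.toSL2R⁻¹ * A * z.toSL2R = 1 := Subtype.ext h
    have : A = z.toSL2R * (z.toSL2R⁻¹ * A * z.toSL2R) * z.toSL2R⁻¹ := by group
    rw [this, h']; simp
  · rintro rfl; simp

lemma deviation_neg_one (z : ℍ) : deviation (-1) z = 8 := by
  have : displacement (-1) z = 0 := by rw [displacement_eq]; simp [fixPoly]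
  rw [deviation, this]
  simp
  norm_num

lemma deviation_commutator_lt {A B : SL(2, ℝ)} {z : ℍ} (hA1 : A ≠ 1)
    (hA : deviation A z ≤ (1 / 16) ^ 2) (hB : deviation B z ≤ (1 / 16) ^ 2) :
    deviation (B * A * B⁻¹ * A⁻¹) z < deviation A z := by
  have hA0 : 0 < deviation A z :=
    (deviation_nonneg A z).lt_of_ne' (mt deviation_eq_zero_iff.1 hA1)
  rw [deviation_eq_norm] at hA0 hA hB
  rw [deviation_eq_norm, deviation_eq_norm A]
  have hc : z.toSL2R⁻¹ * (B * A * B⁻¹ * A⁻¹) * z.toSL2R =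
      (z.toSL2R⁻¹ * B * z.toSL2R) * (z.toSL2R⁻¹ * A * z.toSL2R) *
        (z.toSL2R⁻¹ * B * z.toSL2R)⁻¹ * (z.toSL2R⁻¹ * A * z.toSL2R)⁻¹ := by group
  rw [hc]
  generalize z.toSL2R⁻¹ * A * z.toSL2R = A' at *
  generalize z.toSL2R⁻¹ * B * z.toSL2R = B' at *
  have hA' : ‖A'.1 - 1‖ ≤ 1 / 16 := by
    rwa [sq_le_sq₀ (norm_nonneg _) (by norm_num)] at hA
  have hB' : ‖B'.1 - 1‖ ≤ 1 / 16 := by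
    rwa [sq_le_sq₀ (norm_nonneg _) (by norm_num)] at hB
  have hpos : 0 < ‖A'.1 - 1‖ := by
    by_contra h
    have : ‖A'.1 - 1‖ = 0 := le_antisymm (not_lt.1 h) (norm_nonneg _)
    rw [this] at hA0; norm_num at hA0
  have nA : ‖A'.1‖ ≤ 2 := by
    have := norm_add_le (A'.1 - 1) 1
    rw [sub_add_cancel] at this
    linarith [norm_one_frobenius]
  have nB : ‖B'.1‖ ≤ 2 := by
    have := norm_add_le (B'.1 - 1) 1
    rw [sub_add_cancel] at this
    linarith [norm_one_frobenius]
  -- With threshold `1 / 16` both matrices have norm at most `2`, and the factor `2 * (1 / 16) * 2 *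
  -- 2 = 1 / 2` makes the commutator a contraction.
  rw [sq_lt_sq₀ (norm_nonneg _) (norm_nonneg _)]
  calc _ ≤ 2 * ‖B'.1 - 1‖ * ‖A'.1 - 1‖ * ‖B'.1‖ * ‖A'.1‖ := norm_commutator_sub_one_le _ _
    _ ≤ 2 * (1 / 16) * ‖A'.1 - 1‖ * 2 * 2 := by gcongr
    _ < ‖A'.1 - 1‖ := by linarith

/-- The number of elements of a subgroup that move `z` by at most a fixed amount is bounded
uniformly over the points `z` at which the subgroup has no small elements. -/
lemma exists_card_le (Γ : Subgroup SL(2, ℝ)) {ε : ℝ} (hε : 0 < ε) (R : ℝ) :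
    ∃ M : ℕ, ∀ z : ℍ, (∀ γ ∈ Γ, γ ≠ 1 → ε ^ 2 ≤ deviation γ z) →
      ∀ S : Finset SL(2, ℝ), (∀ γ ∈ S, γ ∈ Γ ∧ dist z (γ • z) ≤ R) → S.card ≤ M := by
  set C : ℝ := √(2 * Real.cosh R) with hC
  have hC0 : 0 < C := Real.sqrt_pos.2 (by have := Real.cosh_pos R; positivity)
  have : ProperSpace (Matrix (Fin 2) (Fin 2) ℝ) := by
    let : NormedSpace ℝ (Matrix (Fin 2) (Fin 2) ℝ) := Matrix.frobeniusNormedSpace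
    exact FiniteDimensional.proper ℝ _
  have hcpt : IsCompact (Metric.closedBall (0 : Matrix (Fin 2) (Fin 2) ℝ) C) :=
    isCompact_closedBall _ _
  -- Pigeonhole: two elements assigned to one center are less than `ε / C` apart, and multiplying
  -- their difference by an inverse of norm at most `C` puts `γ⁻¹ γ'` within `ε` of the identity,
  -- which is excluded.
  obtain ⟨t, htf, ht⟩ := Metric.totallyBounded_iff.1 hcpt.totallyBounded (ε / (2 * C))
    (by positivity)
  refine ⟨htf.toFinset.card, fun z hz S hS => ?_⟩
  have hn : ∀ γ ∈ S, ‖(z.toSL2R⁻¹ * γ * z.toSL2R).1‖ ≤ C := by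
    intro γ hγ
    rw [hC, Real.le_sqrt (norm_nonneg _) (by have := Real.cosh_pos R; positivity), norm_sq_eq_cosh]
    have := (hS γ hγ).2
    gcongr
    rw [Real.cosh_le_cosh, abs_of_nonneg dist_nonneg]
    exact this.trans (le_abs_self R)
  have hcov : ∀ γ ∈ S, ∃ y ∈ htf.toFinset,
      dist (z.toSL2R⁻¹ * γ * z.toSL2R).1 y < ε / (2 * C) := by
    intro γ hγ
    have := ht (show (z.toSL2R⁻¹ * γ * z.toSL2R).1 ∈ Metric.closedBall 0 C by
      simpa using hn γ hγ)
    simpa using this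
  choose! φ hφt hφ using hcov
  refine Finset.card_le_card_of_injOn φ hφt ?_
  intro γ hγ γ' hγ' heq
  by_contra hne
  have h1 := hφ γ hγ
  have h2 := hφ γ' hγ'
  rw [← heq, dist_comm] at h2
  have h3 := (dist_triangle _ _ _).trans_lt (add_lt_add h1 h2)
  have h4 := hz (γ⁻¹ * γ') (Γ.mul_mem (Γ.inv_mem (hS γ hγ).1) (hS γ' hγ').1)
    (by rwa [Ne, inv_mul_eq_one])
  rw [deviation_eq_norm, sq_le_sq₀ hε.le (norm_nonneg _)] at h4
  have h5 : (z.toSL2R⁻¹ * (γ⁻¹ * γ') * z.toSL2R).1 - 1 =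
      ((z.toSL2R⁻¹ * γ * z.toSL2R)⁻¹).1 *
        ((z.toSL2R⁻¹ * γ' * z.toSL2R).1 - (z.toSL2R⁻¹ * γ * z.toSL2R).1) := by
    have e : z.toSL2R⁻¹ * (γ⁻¹ * γ') * z.toSL2R =
        (z.toSL2R⁻¹ * γ * z.toSL2R)⁻¹ * (z.toSL2R⁻¹ * γ' * z.toSL2R) := by group
    rw [mul_sub, SL2_val_inv_mul, e, Matrix.SpecialLinearGroup.coe_mul]
  rw [h5] at h4
  have h6 := h4.trans (norm_mul_le _ _)
  rw [norm_inv_SL2, ← dist_eq_norm, dist_comm] at h6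
  have h7 : ε / (2 * C) + ε / (2 * C) = ε / C := by field_simp; norm_num
  rw [h7, lt_div_iff₀ hC0] at h3
  have h8 := mul_le_mul_of_nonneg_right (hn γ hγ) (dist_nonneg (x := (z.toSL2R⁻¹ * γ * z.toSL2R).1)
    (y := (z.toSL2R⁻¹ * γ' * z.toSL2R).1))
  linarith [mul_comm C (dist (z.toSL2R⁻¹ * γ * z.toSL2R).1 (z.toSL2R⁻¹ * γ' * z.toSL2R).1)]

end Frobenius

/-! ### Centralizers -/

/-- A matrix that commutes with a non-central `A` is a polynomial in `A`. -/
lemma exists_eq_of_commute {A B : SL(2, ℝ)} (h1 : A ≠ 1) (h2 : A ≠ -1) (h : B * A = A * B) :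
    ∃ p q : ℝ, B.1 = p • 1 + q • A.1 := by
  have e : B.1 * A.1 = A.1 * B.1 := congrArg Subtype.val h
  have e00 := congrFun (congrFun e 0) 0
  have e01 := congrFun (congrFun e 0) 1
  have e10 := congrFun (congrFun e 1) 0
  simp only [Matrix.mul_apply, Fin.sum_univ_two] at e00 e01 e10
  by_cases hb : A.1 0 1 = 0
  · by_cases hc : A.1 1 0 = 0
    · have hne : A.1 0 0 - A.1 1 1 ≠ 0 := by
        intro h0
        have hd := SL2_det A
        simp only [hb, hc] at hd
        have : (A.1 0 0 - 1) * (A.1 0 0 + 1) = 0 := by linear_combination hd + A.1 0 0 * h0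
        rcases mul_eq_zero.1 this with h3 | h3
        · apply h1; ext i j; fin_cases i <;> fin_cases j <;> simp [hb, hc] <;> linarith
        · apply h2; ext i j; fin_cases i <;> fin_cases j <;> simp [hb, hc] <;> linarith
      refine ⟨B.1 0 0 - (B.1 0 0 - B.1 1 1) / (A.1 0 0 - A.1 1 1) * A.1 0 0,
        (B.1 0 0 - B.1 1 1) / (A.1 0 0 - A.1 1 1), ?_⟩
      simp only [hb, hc] at e01 e10
      have h01 : B.1 0 1 = 0 := by
        apply (mul_eq_zero.1 (show (A.1 0 0 - A.1 1 1) * B.1 0 1 = 0 by linarith)).resolve_left hne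
      have h10 : B.1 1 0 = 0 := by
        apply (mul_eq_zero.1 (show (A.1 0 0 - A.1 1 1) * B.1 1 0 = 0 by linarith)).resolve_left hne
      ext i j; fin_cases i <;> fin_cases j <;> simp [hb, hc, h01, h10]
      field_simp
      ring
    · refine ⟨B.1 0 0 - B.1 1 0 / A.1 1 0 * A.1 0 0, B.1 1 0 / A.1 1 0, ?_⟩
      ext i j; fin_cases i <;> fin_cases j <;> simp
      · field_simp; linear_combination e00
      · field_simp
      · field_simp; linear_combination e10
  · refine ⟨B.1 0 0 - B.1 0 1 / A.1 0 1 * A.1 0 0, B.1 0 1 / A.1 0 1, ?_⟩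
    ext i j; fin_cases i <;> fin_cases j <;> simp
    · field_simp
    · field_simp; linear_combination -e00
    · field_simp; linear_combination -e01

/-- Both elements are polynomials in `A`. -/
lemma commute_of_commute {A B C : SL(2, ℝ)} (h1 : A ≠ 1) (h2 : A ≠ -1) (hB : B * A = A * B)
    (hC : C * A = A * C) : B * C = C * B := by
  obtain ⟨p, q, h⟩ := exists_eq_of_commute h1 h2 hB
  obtain ⟨p', q', h'⟩ := exists_eq_of_commute h1 h2 hC
  apply Subtype.ext
  change B.1 * C.1 = C.1 * B.1
  rw [h, h']
  simp only [Matrix.mul_add, Matrix.add_mul, Matrix.smul_mul, Matrix.mul_smul, Matrix.one_mul,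
    Matrix.mul_one, smul_add, smul_smul, mul_comm]
  abel

/-- The polynomial `fixPoly` is linear in the matrix and vanishes on scalars. Thus in the
centralizer of `A` all displacement functions are multiples of that of `A`. -/
lemma displacement_of_eq {A B : SL(2, ℝ)} {p q : ℝ} (h : B.1 = p • 1 + q • A.1) (z : ℍ) :
    displacement B z = q ^ 2 * displacement A z := by
  have hq : fixPoly B z = q * fixPoly A z := by
    have h00 := congrFun (congrFun h 0) 0
    have h01 := congrFun (congrFun h 0) 1
    have h10 := congrFun (congrFun h 1) 0
    have h11 := congrFun (congrFun h 1) 1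
    simp at h00 h01 h10 h11
    simp only [fixPoly, h00, h01, h10, h11]
    push_cast
    ring
  rw [displacement_eq, displacement_eq, hq, map_mul, Complex.normSq_ofReal]
  ring

lemma eq_one_or_neg_one_of_scalar {B : SL(2, ℝ)} {p : ℝ} (h : B.1 = p • 1) : B = 1 ∨ B = -1 := by
  have hd := SL2_det B
  have h00 := congrFun (congrFun h 0) 0
  have h01 := congrFun (congrFun h 0) 1
  have h10 := congrFun (congrFun h 1) 0
  have h11 := congrFun (congrFun h 1) 1
  simp at h00 h01 h10 h11
  rw [h00, h01, h10, h11] at hd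
  have : (p - 1) * (p + 1) = 0 := by linear_combination hd
  rcases mul_eq_zero.1 this with h3 | h3
  · left; apply Subtype.ext; rw [h, show p = 1 by linarith]; simp
  · right; apply Subtype.ext; rw [h, show p = -1 by linarith]; simp

/-! ### The thick-thin decomposition -/

/-- The points at which the non-trivial elements of `Γ` are not close to the identity. -/
def thickPart (Γ : Subgroup SL(2, ℝ)) (ε : ℝ) : Set ℍ :=
  {z | ∀ γ ∈ Γ, γ ≠ 1 → ε ^ 2 ≤ deviation γ z}

attribute [local instance] Matrix.frobeniusNormedRing in
lemma dist_smul_le_of_deviation_le {A : SL(2, ℝ)} {z : ℍ} {R : ℝ} (h : deviation A z ≤ R) :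
    dist z (A • z) ≤ (√R + 3 / 2) ^ 2 := by
  have h1 : ‖(z.toSL2R⁻¹ * A * z.toSL2R).1 - 1‖ ≤ √R := by
    apply Real.le_sqrt_of_sq_le
    rwa [← deviation_eq_norm]
  have h2 : ‖(z.toSL2R⁻¹ * A * z.toSL2R).1‖ ≤ √R + 3 / 2 := by
    have := norm_add_le ((z.toSL2R⁻¹ * A * z.toSL2R).1 - 1) 1
    rw [sub_add_cancel] at this
    linarith [norm_one_frobenius]
  have h3 := norm_sq_eq_cosh A z
  have h4 : ‖(z.toSL2R⁻¹ * A * z.toSL2R).1‖ ^ 2 ≤ (√R + 3 / 2) ^ 2 := by gcongr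
  -- The distance `d` is controlled through `2 cosh d ≥ e ^ d ≥ 1 + d`.
  rw [Real.cosh_eq] at h3
  have := Real.add_one_le_exp (dist z (A • z))
  have := Real.exp_pos (-dist z (A • z))
  linarith

/-- A small deviation bounds the distance moved, so such an element carries some point of `K` into a
fixed thickening of `K`; proper discontinuity applies. -/
lemma finite_deviation_le {Γ : Subgroup SL(2, ℝ)} (hΓ : DiscreteTopology Γ) {K : Set ℍ}
    (hK : IsCompact K) (R : ℝ) : {γ | γ ∈ Γ ∧ ∃ z ∈ K, deviation γ z ≤ R}.Finite := by
  have hK' : IsCompact (Metric.cthickening ((√R + 3 / 2) ^ 2) K) := hK.cthickening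
  have := (ProperlyDiscontinuousSMul.finite_disjoint_inter_image (Γ := Γ) hK hK').image
    (Subtype.val : Γ → SL(2, ℝ))
  refine this.subset ?_
  rintro γ ⟨hγ, z, hz, h⟩
  refine ⟨⟨γ, hγ⟩, ⟨γ • z, ⟨z, hz, rfl⟩, ?_⟩, rfl⟩
  refine Metric.mem_cthickening_of_dist_le _ z _ _ hz ?_
  rw [dist_comm]
  exact dist_smul_le_of_deviation_le h

/-- The elements of a discrete group that move `z` by little commute with each other. -/
lemma commute_of_deviation_le {Γ : Subgroup SL(2, ℝ)} (hΓ : DiscreteTopology Γ) {A B : SL(2, ℝ)}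
    {z : ℍ} (hA : A ∈ Γ) (hB : B ∈ Γ) (hAz : deviation A z ≤ (1 / 16) ^ 2)
    (hBz : deviation B z ≤ (1 / 16) ^ 2) : A * B = B * A := by
  by_cases hA1 : A = 1
  · simp [hA1]
  have hfin := finite_deviation_le hΓ (isCompact_singleton (x := z)) ((1 / 16) ^ 2)
  have hfin' : {γ | γ ∈ Γ ∧ γ ≠ 1 ∧ deviation γ z ≤ (1 / 16) ^ 2}.Finite :=
    hfin.subset fun γ h => ⟨h.1, z, rfl, h.2.2⟩
  -- Choose a nontrivial `C` of least deviation. Its commutator with any small element deviates even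
  -- less, hence is trivial, so all small elements lie in the abelian centralizer of `C`.
  obtain ⟨C, ⟨hC, hC1, hCz⟩, hmin⟩ :=
    hfin'.exists_minimalFor (fun γ => deviation γ z) _ ⟨A, hA, hA1, hAz⟩
  have hC2 : C ≠ -1 := by
    rintro rfl
    rw [deviation_neg_one] at hCz
    norm_num at hCz
  have key : ∀ B ∈ Γ, deviation B z ≤ (1 / 16) ^ 2 → B * C = C * B := by
    intro B hB hBz
    have hlt := deviation_commutator_lt hC1 hCz hBz
    by_contra hne
    have hne1 : B * C * B⁻¹ * C⁻¹ ≠ 1 := by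
      intro h
      apply hne
      rw [mul_inv_eq_one, mul_inv_eq_iff_eq_mul] at h
      exact h
    have := hmin ⟨Γ.mul_mem (Γ.mul_mem (Γ.mul_mem hB hC) (Γ.inv_mem hB)) (Γ.inv_mem hC), hne1,
      hlt.le.trans hCz⟩ hlt.le
    exact absurd hlt (not_lt.2 this)
  exact commute_of_commute hC1 hC2 (key A hA hAz) (key B hB hBz)

/-- This provides the upper end for an intermediate value argument. At height `1` the real part of
the witness makes the real or imaginary part of `fixPoly` equal to `|L| + 1`; if `A` is a
translation up to sign, the point is instead lowered towards the real axis. -/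
lemma exists_le_displacement {A : SL(2, ℝ)} (h1 : A ≠ 1) (h2 : A ≠ -1) (L : ℝ) :
    ∃ z : ℍ, L ≤ displacement A z := by
  have hL : L ≤ (|L| + 1) ^ 2 := by nlinarith [le_abs_self L, abs_nonneg L]
  by_cases hc : A 1 0 = 0
  · by_cases hda : A 1 1 - A 0 0 = 0
    · have hb : A 0 1 ≠ 0 := by
        intro hb
        have : A.1 = A 0 0 • 1 := by
          ext i j; fin_cases i <;> fin_cases j <;> simp [hb, hc] <;> linarith
        rcases eq_one_or_neg_one_of_scalar this with h | h
        · exact h1 h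
        · exact h2 h
      have hy : 0 < |A 0 1| / (|L| + 1) := by positivity
      refine ⟨⟨⟨0, |A 0 1| / (|L| + 1)⟩, hy⟩, ?_⟩
      have hda' : ((A 1 1 : ℂ) - A 0 0) = 0 := by exact_mod_cast hda
      rw [displacement_eq, fixPoly, hc, hda']
      have hq : Complex.normSq (((0 : ℝ) : ℂ) *
          (((⟨⟨0, |A 0 1| / (|L| + 1)⟩, hy⟩ : ℍ) : ℂ)) ^ 2 +
          0 * (((⟨⟨0, |A 0 1| / (|L| + 1)⟩, hy⟩ : ℍ) : ℂ)) - A 0 1) = |A 0 1| ^ 2 := by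
        simp [sq]
      rw [hq]
      change L ≤ |A 0 1| ^ 2 / (|A 0 1| / (|L| + 1)) ^ 2
      have : |A 0 1| ≠ 0 := by positivity
      rw [div_pow, div_div_eq_mul_div, mul_div_cancel_left₀ _ (by positivity)]
      exact hL
    · refine ⟨⟨⟨(|L| + 1 + A 0 1) / (A 1 1 - A 0 0), 1⟩, one_pos⟩, hL.trans ?_⟩
      rw [displacement_eq, fixPoly, hc]
      change _ ≤ _ / 1 ^ 2
      rw [one_pow, div_one, Complex.normSq_apply]
      have : (((0 : ℝ) : ℂ) * (((⟨⟨(|L| + 1 + A 0 1) / (A 1 1 - A 0 0), 1⟩, one_pos⟩ : ℍ) : ℂ)) ^ 2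
          + ((A 1 1 : ℂ) - A 0 0) * (((⟨⟨(|L| + 1 + A 0 1) / (A 1 1 - A 0 0), 1⟩, one_pos⟩ : ℍ) : ℂ))
          - A 0 1).re = |L| + 1 := by
        simp
        field_simp
        ring
      rw [this]
      nlinarith [mul_self_nonneg (((0 : ℝ) : ℂ) *
          (((⟨⟨(|L| + 1 + A 0 1) / (A 1 1 - A 0 0), 1⟩, one_pos⟩ : ℍ) : ℂ)) ^ 2
          + ((A 1 1 : ℂ) - A 0 0) * (((⟨⟨(|L| + 1 + A 0 1) / (A 1 1 - A 0 0), 1⟩, one_pos⟩ : ℍ) : ℂ))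
          - A 0 1).im]
  · refine ⟨⟨⟨(|L| + 1 - (A 1 1 - A 0 0)) / (2 * A 1 0), 1⟩, one_pos⟩, hL.trans ?_⟩
    rw [displacement_eq, fixPoly]
    change _ ≤ _ / 1 ^ 2
    rw [one_pow, div_one, Complex.normSq_apply]
    set z : ℂ := ((⟨⟨(|L| + 1 - (A 1 1 - A 0 0)) / (2 * A 1 0), 1⟩, one_pos⟩ : ℍ) : ℂ) with hz
    have hre : z.re = (|L| + 1 - (A 1 1 - A 0 0)) / (2 * A 1 0) := rfl
    have him : z.im = 1 := rfl
    have : ((A 1 0 : ℂ) * z ^ 2 + ((A 1 1 : ℂ) - A 0 0) * z - A 0 1).im = |L| + 1 := by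
      simp [sq, hre, him]
      field_simp
      ring
    rw [this]
    nlinarith [mul_self_nonneg ((A 1 0 : ℂ) * z ^ 2 + ((A 1 1 : ℂ) - A 0 0) * z - A 0 1).re]

/-- From a point that is moved by little one reaches the thick part by increasing the displacement
of the elements that commute with each other. -/
lemma exists_mem_thickPart {Γ : Subgroup SL(2, ℝ)} (hΓ : DiscreteTopology Γ) {z : ℍ}
    (hz : z ∉ thickPart Γ (1 / 16)) :
    ∃ z' ∈ thickPart Γ (1 / 16), ∃ γ ∈ Γ, γ ≠ 1 ∧ γ ≠ -1 ∧ deviation γ z' = (1 / 16) ^ 2 ∧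
      deviation γ z ≤ (1 / 16) ^ 2 := by
  simp only [thickPart, mem_ofPred_eq, not_forall, not_le] at hz
  obtain ⟨γ, hγ, hγ1, hγz⟩ := hz
  have hneg : ∀ {δ : SL(2, ℝ)}, deviation δ z < (1 / 16) ^ 2 → δ ≠ -1 := by
    rintro δ h rfl
    rw [deviation_neg_one] at h
    norm_num at h
  have hγ2 := hneg hγz
  -- All elements of `S` commute with `γ`, so their deviations are nondecreasing affine functions of
  -- `displacement γ`.
  set S : Set SL(2, ℝ) := {δ | δ ∈ Γ ∧ δ * γ = γ * δ ∧ δ ≠ 1 ∧ deviation δ z < (1 / 16) ^ 2}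
  have hSfin : S.Finite :=
    (finite_deviation_le hΓ (isCompact_singleton (x := z)) ((1 / 16) ^ 2)).subset
      fun δ h => ⟨h.1, z, rfl, h.2.2.2.le⟩
  choose! p q hpq using fun (δ : SL(2, ℝ)) (h : δ * γ = γ * δ) =>
    exists_eq_of_commute hγ1 hγ2 h
  have hdev : ∀ δ : SL(2, ℝ), δ * γ = γ * δ → ∀ w, deviation δ w =
      q δ ^ 2 * displacement γ w + 2 * (2 - δ.1.trace) := by
    intro δ hδ w
    rw [deviation, displacement_of_eq (hpq δ hδ)]
  have hq : ∀ δ ∈ S, q δ ≠ 0 := by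
    rintro δ ⟨-, hc, h1, hd⟩ h0
    have := hpq δ hc
    rw [h0, zero_smul, add_zero] at this
    rcases eq_one_or_neg_one_of_scalar this with h | h
    · exact h1 h
    · exact hneg hd h
  -- The number `ℓ δ` is the value of `displacement γ` at which `δ` reaches the threshold; `δ₀` is
  -- the last element of `S` to reach it.
  set ℓ : SL(2, ℝ) → ℝ := fun δ => ((1 / 16) ^ 2 - 2 * (2 - δ.1.trace)) / q δ ^ 2
  obtain ⟨δ₀, hδ₀, hmax⟩ := hSfin.exists_maximalFor ℓ _ ⟨γ, hγ, rfl, hγ1, hγz⟩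
  have hℓ : ∀ δ ∈ S, q δ ^ 2 * ℓ δ + 2 * (2 - δ.1.trace) = (1 / 16) ^ 2 := by
    intro δ hδ
    have := hq δ hδ
    simp only [ℓ]
    field_simp
    ring
  have hle : displacement γ z ≤ ℓ δ₀ := by
    have h1 := hℓ δ₀ hδ₀
    have h2 := hδ₀.2.2.2
    rw [hdev δ₀ hδ₀.2.1] at h2
    have h3 : 0 < q δ₀ ^ 2 := by have := hq δ₀ hδ₀; positivity
    by_contra h
    nlinarith [not_le.1 h]
  obtain ⟨w, hw⟩ := exists_le_displacement hγ1 hγ2 (ℓ δ₀)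
  obtain ⟨z', hz'⟩ := mem_range_of_exists_le_of_exists_ge (continuous_displacement γ)
    ⟨z, hle⟩ ⟨w, hw⟩
  have hδ₀z' : deviation δ₀ z' = (1 / 16) ^ 2 := by
    rw [hdev δ₀ hδ₀.2.1, hz', hℓ δ₀ hδ₀]
  refine ⟨z', ?_, δ₀, hδ₀.1, hδ₀.2.2.1, hneg hδ₀.2.2.2, hδ₀z', hδ₀.2.2.2.le⟩
  intro δ hδ hδ1
  by_contra hlt
  -- An element still small at `z'` commutes with `δ₀`, hence with `γ`, so the monotonicity applies
  -- to it: either it lay in `S` and has passed the threshold by the choice of `δ₀`, or it was not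
  -- small at `z` and has not become smaller.
  have hcomm := commute_of_deviation_le hΓ hδ hδ₀.1 (not_le.1 hlt).le hδ₀z'.le
  have hcomm' : δ * γ = γ * δ :=
    commute_of_commute hδ₀.2.2.1 (hneg hδ₀.2.2.2) hcomm hδ₀.2.1.symm
  apply hlt
  by_cases hδS : deviation δ z < (1 / 16) ^ 2
  · have hmem : δ ∈ S := ⟨hδ, hcomm', hδ1, hδS⟩
    rw [hdev δ hcomm', hz', ← hℓ δ hmem]
    have : ℓ δ ≤ ℓ δ₀ := by
      rcases le_total (ℓ δ) (ℓ δ₀) with h | h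
      · exact h
      · exact hmax hmem h
    have := mul_le_mul_of_nonneg_left this (sq_nonneg (q δ))
    linarith
  · refine (not_lt.1 hδS).trans ?_
    rw [hdev δ hcomm', hdev δ hcomm', hz']
    have := mul_le_mul_of_nonneg_left hle (sq_nonneg (q δ))
    linarith

/-! ### The action of the transformation group -/

lemma exists_lift {Γ : Subgroup SL(2, ℝ)} (t : transformations Γ) :
    ∃ γ ∈ Γ, ∀ z : ℍ, t • z = γ • z := by
  obtain ⟨t, γ, hγ, rfl⟩ := t
  exact ⟨γ, hγ, fun z => rfl⟩

/-- A representative in `SL(2, ℝ)` of a transformation. -/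
def lift {Γ : Subgroup SL(2, ℝ)} (t : transformations Γ) : SL(2, ℝ) := (exists_lift t).choose

lemma lift_mem {Γ : Subgroup SL(2, ℝ)} (t : transformations Γ) : lift t ∈ Γ :=
  (exists_lift t).choose_spec.1

lemma smul_eq_lift_smul {Γ : Subgroup SL(2, ℝ)} (t : transformations Γ) (z : ℍ) :
    t • z = lift t • z :=
  (exists_lift t).choose_spec.2 z

/-- The transformation defined by an element of the group. -/
def toTransformation {Γ : Subgroup SL(2, ℝ)} (γ : SL(2, ℝ)) (hγ : γ ∈ Γ) : transformations Γ :=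
  ⟨MulAction.toPermHom SL(2, ℝ) ℍ γ, γ, hγ, rfl⟩

lemma toTransformation_smul {Γ : Subgroup SL(2, ℝ)} (γ : SL(2, ℝ)) (hγ : γ ∈ Γ) (z : ℍ) :
    toTransformation γ hγ • z = γ • z := rfl

lemma lift_injective {Γ : Subgroup SL(2, ℝ)} :
    Function.Injective (lift : transformations Γ → SL(2, ℝ)) := by
  intro s t h
  apply Subtype.ext
  apply Equiv.ext
  intro z
  have h1 := smul_eq_lift_smul s z
  have h2 := smul_eq_lift_smul t z
  rw [h, ← h2] at h1
  exact h1

lemma countable_of_discrete {Γ : Subgroup SL(2, ℝ)} (hΓ : DiscreteTopology Γ) : Countable Γ := by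
  have : SecondCountableTopology (Matrix (Fin 2) (Fin 2) ℝ) :=
    (inferInstance : SecondCountableTopology (Fin 2 → Fin 2 → ℝ))
  have : SecondCountableTopology SL(2, ℝ) :=
    Matrix.SpecialLinearGroup.isClosedEmbedding_val.isEmbedding.secondCountableTopology
  exact countable_of_Lindelof_of_discrete

lemma countable_transformations {Γ : Subgroup SL(2, ℝ)} (hΓ : DiscreteTopology Γ) :
    Countable (transformations Γ) := by
  have := countable_of_discrete hΓ
  exact Function.Injective.countable (f := fun t : transformations Γ => (⟨lift t, lift_mem t⟩ : Γ))
    fun s t h => lift_injective (congrArg Subtype.val h)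

instance smulInvariantMeasure_SL2 : SMulInvariantMeasure SL(2, ℝ) ℍ volume where
  measure_preimage_smul c _ hs :=
    measure_preimage_smul_of_nullMeasurableSet hs.nullMeasurableSet
      (Matrix.SpecialLinearGroup.mapGL ℝ c : GL (Fin 2) ℝ)

instance (Γ : Subgroup SL(2, ℝ)) : MeasurableConstSMul (transformations Γ) ℍ where
  measurable_const_smul t := by
    have : (fun z : ℍ => t • z) = fun z => lift t • z := funext (smul_eq_lift_smul t)
    change Measurable fun z : ℍ => t • z
    rw [this]
    exact (continuous_const_smul (lift t)).measurable

instance (Γ : Subgroup SL(2, ℝ)) : SMulInvariantMeasure (transformations Γ) ℍ volume where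
  measure_preimage_smul t s hs := by
    have : (fun z : ℍ => t • z) = fun z => lift t • z := funext (smul_eq_lift_smul t)
    rw [this]
    exact SMulInvariantMeasure.measure_preimage_smul (lift t) hs

/-- All fundamental domains have the same area, so the one granted by `FiniteVolume` controls every
other. -/
lemma volume_lt_top_of_finiteVolume {Γ : Subgroup SL(2, ℝ)} (hΓ : DiscreteTopology Γ)
    (hvol : FiniteVolume Γ) {F : Set ℍ} (hF : IsFundDomain Γ F) : volume F < ⊤ := by
  obtain ⟨F', hF', hlt⟩ := hvol
  have := countable_transformations hΓ
  rwa [IsFundamentalDomain.measure_eq (G := transformations Γ) hF hF']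

/-! ### Compactness of the thick part -/

lemma volume_ball_eq (p q : ℍ) (r : ℝ) : volume (Metric.ball p r) = volume (Metric.ball q r) := by
  obtain ⟨g, rfl⟩ := MulAction.exists_smul_eq SL(2, ℝ) p q
  rw [← Metric.smul_ball, measure_smul]

/-- Unfolding: the area of the union `U` of the disjoint unit balls is the integral over `F` of the
number of `g` with `z ∈ g • U`. Since distinct orbits are separated, the inverses of all such `g`
bring `z` near one and the same `p`, and their quotients move `p` by at most `2`. -/
lemma card_mul_volume_ball_le {Γ : Subgroup SL(2, ℝ)} (hΓ : DiscreteTopology Γ) {F : Set ℍ}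
    (hF : IsFundDomain Γ F) {M : ℕ} {P : Finset ℍ}
    (hM : ∀ p ∈ P, ∀ S : Finset SL(2, ℝ), (∀ γ ∈ S, γ ∈ Γ ∧ dist p (γ • p) ≤ 2) → S.card ≤ M)
    (hP : ∀ p ∈ P, ∀ q ∈ P, p ≠ q → ∀ γ ∈ Γ, 2 ≤ dist (γ • p) q) (o : ℍ) :
    P.card * volume (Metric.ball o 1) ≤ M * volume F := by
  have hc := countable_transformations hΓ
  set U : Set ℍ := ⋃ p ∈ P, Metric.ball p 1 with hU
  have hUm : MeasurableSet U := Finset.measurableSet_biUnion _ fun p _ => measurableSet_ball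
  have h1 : volume U = P.card * volume (Metric.ball o 1) := by
    rw [hU, measure_biUnion_finset]
    · rw [Finset.sum_congr rfl fun p _ => volume_ball_eq p o 1]
      simp
    · intro p hp q hq hpq
      apply Metric.ball_disjoint_ball
      have := hP p hp q hq hpq 1 Γ.one_mem
      rw [one_smul] at this
      linarith
    · exact fun p _ => measurableSet_ball
  rw [← h1, IsFundamentalDomain.measure_eq_tsum (G := transformations Γ) hF]
  have h2 : ∀ g : transformations Γ, volume (g • U ∩ F) =
      ∫⁻ z in F, (g • U).indicator 1 z := by
    intro g
    have hm : MeasurableSet (g • U) := hUm.const_smul g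
    rw [lintegral_indicator_one hm, Measure.restrict_apply hm]
  simp_rw [h2]
  rw [← lintegral_tsum fun g => (measurable_one.indicator (hUm.const_smul g)).aemeasurable]
  calc _ ≤ ∫⁻ z in F, (M : ENNReal) := by
        refine lintegral_mono fun z => ?_
        rw [ENNReal.tsum_eq_iSup_sum]
        refine iSup_le fun S => ?_
        classical
        simp only [indicator_apply, Pi.one_apply, Finset.sum_boole]
        norm_cast
        set S' := S.filter fun g => z ∈ g • U with hS'
        rcases S'.eq_empty_or_nonempty with h0 | ⟨g₀, hg₀⟩
        · simp [h0]
        have hmem : ∀ g ∈ S', ∃ p ∈ P, dist (g⁻¹ • z) p < 1 := by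
          intro g hg
          have := (Finset.mem_filter.1 hg).2
          rw [mem_smul_set_iff_inv_smul_mem] at this
          simpa [hU] using this
        obtain ⟨p, hp, hpz⟩ := hmem g₀ hg₀
        have hinj : Function.Injective fun g : transformations Γ => lift (g⁻¹ * g₀) := by
          intro g g' h
          have := lift_injective h
          simpa using this
        rw [← Finset.card_image_of_injective S' hinj]
        refine hM p hp _ fun γ hγ => ?_
        obtain ⟨g, hg, rfl⟩ := Finset.mem_image.1 hγ
        refine ⟨lift_mem _, ?_⟩
        obtain ⟨q, hq, hqz⟩ := hmem g hg
        have hlt : dist (lift (g⁻¹ * g₀) • p) q < 2 := by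
          have e : g⁻¹ • z = lift (g⁻¹ * g₀) • (g₀⁻¹ • z) := by
            rw [← smul_eq_lift_smul, smul_smul, mul_assoc, mul_inv_cancel, mul_one]
          have h3 : dist (lift (g⁻¹ * g₀) • p) (g⁻¹ • z) < 1 := by
            rw [e, dist_smul, dist_comm]; exact hpz
          linarith [dist_triangle (lift (g⁻¹ * g₀) • p) (g⁻¹ • z) q]
        have hpq : p = q := by
          by_contra hne
          exact absurd hlt (not_lt.2 (hP p hp q hq hne _ (lift_mem _)))
        rw [← hpq, dist_comm] at hlt
        exact hlt.le
    _ = M * volume F := by simp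

/-- The thick part is compact modulo `Γ`. -/
lemma exists_compact_thickPart {Γ : Subgroup SL(2, ℝ)} (hΓ : DiscreteTopology Γ)
    (hvol : FiniteVolume Γ) {ε : ℝ} (hε : 0 < ε) :
    ∃ K : Set ℍ, IsCompact K ∧ ∀ z ∈ thickPart Γ ε, ∃ γ ∈ Γ, γ • z ∈ K := by
  obtain ⟨M, hM⟩ := exists_card_le Γ hε 2
  obtain ⟨F, hF, hFlt⟩ := hvol
  have hv0 : volume (Metric.ball UpperHalfPlane.I 1) ≠ 0 := by
    rw [UpperHalfPlane.volume_eq_lintegral]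
    have hm : MeasurableSet ((↑) '' Metric.ball UpperHalfPlane.I 1 : Set ℂ) :=
      UpperHalfPlane.measurableEmbedding_coe.measurableSet_image.2 measurableSet_ball
    have ho : IsOpen ((↑) '' Metric.ball UpperHalfPlane.I 1 : Set ℂ) :=
      UpperHalfPlane.isOpenEmbedding_coe.isOpenMap _ Metric.isOpen_ball
    have hpos : 0 < volume ((↑) '' Metric.ball UpperHalfPlane.I 1 : Set ℂ) :=
      ho.measure_pos _ ((Metric.nonempty_ball.2 one_pos).image _)
    refine ((setLIntegral_pos_iff (by fun_prop)).2 ?_).ne'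
    refine hpos.trans_le (measure_mono ?_)
    rintro _ ⟨z, hz, rfl⟩
    refine ⟨?_, z, hz, rfl⟩
    simp [z.im_ne_zero]
  classical
  -- Finite sets in the thick part whose orbits are `2`-separated have bounded cardinality by the
  -- area count. For one of maximal cardinality, the translates of the closed balls of radius `2`
  -- cover the thick part.
  let Good (P : Finset ℍ) : Prop := (∀ p ∈ P, p ∈ thickPart Γ ε) ∧
    ∀ p ∈ P, ∀ q ∈ P, p ≠ q → ∀ γ ∈ Γ, 2 ≤ dist (γ • p) q
  have hb : ∃ n : ℕ, ∀ P, Good P → P.card ≤ n := by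
    have hfin : M * volume F / volume (Metric.ball UpperHalfPlane.I 1) < ⊤ :=
      ENNReal.div_lt_top (ENNReal.mul_ne_top (by simp) hFlt.ne) hv0
    obtain ⟨n, hn⟩ := ENNReal.exists_nat_gt hfin.ne
    refine ⟨n, fun P hP => ?_⟩
    have := card_mul_volume_ball_le hΓ hF (fun p hp => hM p (hP.1 p hp)) hP.2 UpperHalfPlane.I
    have h2 := (ENNReal.le_div_iff_mul_le (Or.inl hv0)
      (Or.inl (measure_ball_lt_top (μ := volume)).ne)).2 this
    exact_mod_cast (h2.trans hn.le)
  obtain ⟨n, hn⟩ := hb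
  obtain ⟨P, hP, hmax⟩ : ∃ P, Good P ∧ ∀ Q, Good Q → Q.card ≤ P.card := by
    obtain ⟨m, ⟨P, hP, hPm⟩, hm⟩ := Nat.findGreatest_spec (P := fun m => ∃ P, Good P ∧ P.card = m)
      (Nat.zero_le n) ⟨∅, ⟨by simp, by simp⟩, rfl⟩ |> fun h => (⟨_, h, fun Q hQ =>
        Nat.le_findGreatest (hn Q hQ) ⟨Q, hQ, rfl⟩⟩ : ∃ m, (∃ P, Good P ∧ P.card = m) ∧
          ∀ Q, Good Q → Q.card ≤ m)
    exact ⟨P, hP, fun Q hQ => hPm ▸ hm Q hQ⟩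
  refine ⟨⋃ p ∈ P, Metric.closedBall p 2,
    P.finite_toSet.isCompact_biUnion fun p _ => isCompact_closedBall p 2, fun z hz => ?_⟩
  by_contra hcon
  push Not at hcon
  have hfar : ∀ p ∈ P, ∀ γ ∈ Γ, 2 < dist (γ • z) p := by
    intro p hp γ hγ
    by_contra h
    apply hcon γ hγ
    simp only [mem_iUnion, Metric.mem_closedBall]
    exact ⟨p, hp, not_lt.1 h⟩
  have hzP : z ∉ P := by
    intro h
    have := hfar z h 1 Γ.one_mem
    norm_num at this
  have hgood : Good (insert z P) := by
    refine ⟨?_, ?_⟩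
    · intro p hp
      rcases Finset.mem_insert.1 hp with rfl | hp
      · exact hz
      · exact hP.1 p hp
    · intro p hp q hq hpq γ hγ
      rcases Finset.mem_insert.1 hp with rfl | h1 <;> rcases Finset.mem_insert.1 hq with rfl | h2
      · exact absurd rfl hpq
      · exact (hfar q h2 γ hγ).le
      · have := hfar p h1 γ⁻¹ (Γ.inv_mem hγ)
        rw [← dist_smul γ, smul_inv_smul, dist_comm] at this
        exact this.le
      · exact hP.2 p h1 q h2 hpq γ hγ
  have := hmax _ hgood
  rw [Finset.card_insert_of_notMem hzP] at this
  omega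

/-! ### Sublevel sets of the displacement function of a single transformation -/

lemma isCompact_box (R₁ R₂ : ℝ) {y₀ : ℝ} (hy₀ : 0 < y₀) (y₁ : ℝ) :
    IsCompact {z : ℍ | R₁ ≤ z.re ∧ z.re ≤ R₂ ∧ y₀ ≤ z.im ∧ z.im ≤ y₁} := by
  rw [UpperHalfPlane.isOpenEmbedding_coe.isEmbedding.isCompact_iff]
  have : ((↑) '' {z : ℍ | R₁ ≤ z.re ∧ z.re ≤ R₂ ∧ y₀ ≤ z.im ∧ z.im ≤ y₁} : Set ℂ) =
      Icc R₁ R₂ ×ℂ Icc y₀ y₁ := by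
    ext w
    simp only [Complex.mem_reProdIm, mem_Icc]
    constructor
    · rintro ⟨z, ⟨h1, h2, h3, h4⟩, rfl⟩
      exact ⟨⟨h1, h2⟩, h3, h4⟩
    · rintro ⟨⟨h1, h2⟩, h3, h4⟩
      exact ⟨⟨w, hy₀.trans_le h3⟩, ⟨h1, h2, h3, h4⟩, rfl⟩
  rw [this]
  exact isCompact_Icc.reProdIm isCompact_Icc

/-- With `u = 2 c x + (d - a)`, `v = 2 |c| y` and `D = 4 - tr ^ 2 > 0`, the bound on the
displacement becomes `u ^ 2 + v ^ 2 + D ≤ M v`, a disc that stays away from the real axis. -/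
lemma isCompact_sublevel_elliptic {A : SL(2, ℝ)} (h : A.1.trace ^ 2 < 4) (L : ℝ) :
    ∃ K : Set ℍ, IsCompact K ∧ ∀ z, displacement A z ≤ L → z ∈ K := by
  rw [Matrix.trace_fin_two] at h
  have hdet := SL2_det A
  set D : ℝ := 4 - (A 0 0 + A 1 1) ^ 2 with hD
  have hD0 : 0 < D := by linarith
  have hc : A 1 0 ≠ 0 := by
    intro hc
    rw [hc] at hdet
    nlinarith [sq_nonneg (A 0 0 - A 1 1)]
  set M : ℝ := 2 * √(|L| + D) with hM
  have hM0 : 0 < M := by have := abs_nonneg L; positivity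
  have hc0 : 0 < |A 1 0| := abs_pos.2 hc
  have hM2 : M ^ 2 = 4 * (|L| + D) := by
    rw [hM, mul_pow, Real.sq_sqrt (by positivity)]; norm_num
  refine ⟨_, isCompact_box ((-M - |A 1 1 - A 0 0|) / (2 * |A 1 0|))
    ((M + |A 1 1 - A 0 0|) / (2 * |A 1 0|)) (y₀ := D / (M * (2 * |A 1 0|))) (by positivity)
    (M / (2 * |A 1 0|)), fun z hz => ?_⟩
  have hzL := hz.trans (le_abs_self L)
  rw [displacement_eq, div_le_iff₀ (by have := z.im_pos; positivity)] at hzL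
  set u : ℝ := 2 * A 1 0 * z.re + (A 1 1 - A 0 0) with hu
  set v : ℝ := 2 * |A 1 0| * z.im with hv
  have hv0 : 0 < v := by have := z.im_pos; positivity
  have hv2 : v ^ 2 = 4 * A 1 0 ^ 2 * z.im ^ 2 := by rw [hv, mul_pow, mul_pow, sq_abs]; ring
  have h1 : 16 * A 1 0 ^ 2 * Complex.normSq (fixPoly A z) =
      (u ^ 2 + v ^ 2 + D) ^ 2 - 4 * v ^ 2 * D := by
    rw [hv2]
    simp [Complex.normSq_apply, fixPoly, sq, hu, hD]
    have e : A 0 1 * A 1 0 = A 0 0 * A 1 1 - 1 := by linarith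
    linear_combination (norm := skip) (0 : ℝ) * e
    -- As `c ≠ 0`, the determinant relation eliminates the upper right entry.
    have e2 : (A 0 1 : ℝ) = (A 0 0 * A 1 1 - 1) / A 1 0 := by rw [← e]; field_simp
    rw [e2]
    field_simp
    ring
  have h2 : (u ^ 2 + v ^ 2 + D) ^ 2 ≤ (M * v) ^ 2 := by
    have e : (M * v) ^ 2 = 4 * (|L| + D) * v ^ 2 := by rw [mul_pow M v, hM2]
    rw [e]
    have := mul_le_mul_of_nonneg_left hzL (by positivity : 0 ≤ 16 * A 1 0 ^ 2)
    nlinarith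
  have h3 : u ^ 2 + v ^ 2 + D ≤ M * v := by
    rwa [sq_le_sq₀ (by positivity) (by positivity)] at h2
  have hvM : v ≤ M := by
    by_contra hlt
    nlinarith [sq_nonneg u, not_le.1 hlt]
  have huM : |u| ≤ M := by
    apply abs_le_of_sq_le_sq _ hM0.le
    nlinarith [sq_nonneg v]
  have hx : |z.re| * (2 * |A 1 0|) ≤ M + |A 1 1 - A 0 0| := by
    have : |z.re| * (2 * |A 1 0|) = |u - (A 1 1 - A 0 0)| := by
      rw [hu, add_sub_cancel_right, abs_mul, abs_mul, abs_two]; ring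
    rw [this]
    exact (abs_sub _ _).trans (by linarith)
  have hx' := abs_le.1 ((le_div_iff₀ (by positivity)).2 hx)
  refine ⟨?_, hx'.2, ?_, ?_⟩
  · refine le_trans (le_of_eq ?_) hx'.1
    ring
  · rw [div_le_iff₀ (by positivity)]
    nlinarith [sq_nonneg u, sq_nonneg v]
  · rw [le_div_iff₀ (by positivity)]
    linarith

/-- Translation by `x`. -/
def translation (x : ℝ) : SL(2, ℝ) := ⟨!![1, x; 0, 1], by simp⟩

/-- Multiplication by `a ^ 2`. -/
def dilation (a : ℝ) (ha : a ≠ 0) : SL(2, ℝ) := ⟨!![a, 0; 0, a⁻¹], by simp [ha]⟩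

lemma translation_smul (x : ℝ) (z : ℍ) : translation x • z = x +ᵥ z := by
  apply UpperHalfPlane.ext
  rw [SL2_coe_smul]
  simp [translation, add_comm]

lemma dilation_smul (a : ℝ) (ha : a ≠ 0) (z : ℍ) :
    ((dilation a ha • z : ℍ) : ℂ) = (a : ℂ) ^ 2 * z := by
  rw [SL2_coe_smul]
  simp [dilation]
  have : (a : ℂ) ≠ 0 := by exact_mod_cast ha
  field_simp

lemma coe_conj (A σ : SL(2, ℝ)) :
    (σ⁻¹ * A * σ).1 = !![σ 1 1, -σ 0 1; -σ 1 0, σ 0 0] * A.1 * σ.1 := by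
  rw [Matrix.SpecialLinearGroup.coe_mul, Matrix.SpecialLinearGroup.coe_mul,
    Matrix.SpecialLinearGroup.coe_inv, Matrix.adjugate_fin_two]

lemma exists_conj_upperTriangular {A : SL(2, ℝ)} {lam : ℝ} (h : lam ^ 2 - A.1.trace * lam + 1 = 0) :
    ∃ σ : SL(2, ℝ), (σ⁻¹ * A * σ) 1 0 = 0 ∧ (σ⁻¹ * A * σ) 0 0 = lam := by
  have hdet := SL2_det A
  rw [Matrix.trace_fin_two] at h
  have h0 : (A.1 - lam • (1 : Matrix (Fin 2) (Fin 2) ℝ)).det = 0 := by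
    rw [Matrix.det_fin_two]
    simp
    linear_combination hdet + h
  obtain ⟨v, hv, hAv⟩ := Matrix.exists_mulVec_eq_zero_iff.2 h0
  have e0 := congrFun hAv 0
  have e1 := congrFun hAv 1
  simp [Matrix.mulVec, dotProduct, Fin.sum_univ_two] at e0 e1
  have hn : v 0 ^ 2 + v 1 ^ 2 ≠ 0 := by
    intro h
    apply hv
    have h1 : v 0 = 0 := by nlinarith [sq_nonneg (v 0), sq_nonneg (v 1)]
    have h2 : v 1 = 0 := by nlinarith [sq_nonneg (v 0), sq_nonneg (v 1)]
    ext i; fin_cases i <;> simp [h1, h2]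
  -- The first column is the eigenvector; the second is its rotation by a right angle, divided by
  -- the squared length to make the determinant `1`.
  obtain ⟨σ, hσ⟩ : ∃ σ : SL(2, ℝ), σ.1 =
      !![v 0, -v 1 / (v 0 ^ 2 + v 1 ^ 2); v 1, v 0 / (v 0 ^ 2 + v 1 ^ 2)] := by
    refine ⟨⟨_, ?_⟩, rfl⟩
    rw [Matrix.det_fin_two]
    simp
    field_simp
    ring
  refine ⟨σ, ?_, ?_⟩
  · rw [coe_conj, hσ]
    simp [Matrix.mul_apply, Fin.sum_univ_two, Matrix.vecMul, dotProduct]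
    linear_combination v 0 * e1 - v 1 * e0
  · rw [coe_conj, hσ]
    simp [Matrix.mul_apply, Fin.sum_univ_two, Matrix.vecMul, dotProduct]
    field_simp
    linear_combination v 0 * e0 + v 1 * e1

lemma displacement_conj' (A σ : SL(2, ℝ)) (z : ℍ) :
    displacement (σ⁻¹ * A * σ) (σ⁻¹ • z) = displacement A z := by
  have := displacement_conj A σ⁻¹ z
  rwa [inv_inv] at this

lemma coe_conj_translation (B : SL(2, ℝ)) (x : ℝ) : ((translation x)⁻¹ * B * translation x).1 =
    !![B 0 0 - x * B 1 0, (B 0 0 - x * B 1 0) * x + (B 0 1 - x * B 1 1);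
      B 1 0, B 1 0 * x + B 1 1] := by
  rw [coe_conj]
  ext i j
  fin_cases i <;> fin_cases j <;> simp [translation, Matrix.mul_apply, Fin.sum_univ_two,
    Matrix.vecMul, dotProduct] <;> ring

lemma exists_conj_dilation {A : SL(2, ℝ)} (h : 2 < A.1.trace) :
    ∃ (σ : SL(2, ℝ)) (lam : ℝ) (hl : lam ≠ 0), 1 < lam ∧ σ⁻¹ * A * σ = dilation lam hl := by
  set t := A.1.trace with ht
  set s := √(t ^ 2 - 4) with hs
  have hs2 : s ^ 2 = t ^ 2 - 4 := Real.sq_sqrt (by nlinarith)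
  have hs0 : 0 ≤ s := Real.sqrt_nonneg _
  have hl : 1 < (t + s) / 2 := by linarith
  obtain ⟨σ, h10, h00⟩ := exists_conj_upperTriangular (A := A) (lam := (t + s) / 2)
    (by rw [← ht]; linear_combination hs2 / 4)
  set lam := (t + s) / 2
  set B := σ⁻¹ * A * σ with hB
  have hdet := SL2_det B
  rw [h10, h00] at hdet
  have h11 : B 1 1 = lam⁻¹ := by
    refine eq_inv_of_mul_eq_one_right ?_; linarith
  have hlt : lam⁻¹ < 1 := inv_lt_one_of_one_lt₀ hl
  have hne : lam - lam⁻¹ ≠ 0 := by linarith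
  -- The translation parameter is the finite fixed point of `B`; moving it to `0` makes `B`
  -- diagonal.
  refine ⟨σ * translation (-B 0 1 / (lam - lam⁻¹)), lam, by positivity, hl, ?_⟩
  rw [mul_inv_rev]
  have : (translation (-B 0 1 / (lam - lam⁻¹)))⁻¹ * σ⁻¹ * A *
      (σ * translation (-B 0 1 / (lam - lam⁻¹))) = (translation (-B 0 1 / (lam - lam⁻¹)))⁻¹ * B *
      translation (-B 0 1 / (lam - lam⁻¹)) := by rw [hB]; group
  rw [this]
  apply Subtype.ext
  rw [coe_conj_translation, h10, h00, h11]
  ext i j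
  fin_cases i <;> fin_cases j <;> simp [dilation]
  have h3 : B 0 1 / (lam - lam⁻¹) * (lam - lam⁻¹) = B 0 1 := div_mul_cancel₀ _ hne
  rw [neg_div]
  linear_combination -h3

/-- In the coordinate `w` in which `A` is multiplication by `lam ^ 2`, the sublevel set is a sector
`|w| ≤ M Im w` around the axis, and the powers of `A` act on it cocompactly. -/
lemma exists_compact_hyperbolic {A : SL(2, ℝ)} (h : 2 < A.1.trace) (L : ℝ) :
    ∃ K : Set ℍ, IsCompact K ∧ ∀ z, displacement A z ≤ L → ∃ n : ℤ, A ^ n • z ∈ K := by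
  obtain ⟨σ, lam, hl0, hl, hσ⟩ := exists_conj_dilation h
  have hlt : lam⁻¹ < 1 := inv_lt_one_of_one_lt₀ hl
  set M : ℝ := √(|L|) / (lam - lam⁻¹) with hM
  have hM0 : 0 ≤ M := div_nonneg (Real.sqrt_nonneg _) (by linarith)
  refine ⟨σ • _, (isCompact_box (-lam ^ 2) (lam ^ 2) (y₀ := 1 / (M + 1)) (by positivity)
    (lam ^ 2)).smul σ, fun z hz => ?_⟩
  set w := σ⁻¹ • z with hw
  have hwn : 0 < ‖(w : ℂ)‖ := by
    rw [norm_pos_iff]; exact w.ne_zero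
  have hwM : ‖(w : ℂ)‖ ≤ M * w.im := by
    have h1 := hz.trans (le_abs_self L)
    rw [← displacement_conj' A σ, hσ, ← hw, displacement_eq, div_le_iff₀ (by
      have := w.im_pos; positivity)] at h1
    have h2 : fixPoly (dilation lam hl0) w = (((lam⁻¹ - lam : ℝ)) : ℂ) * w := by
      simp [fixPoly, dilation]
    rw [h2, map_mul, Complex.normSq_ofReal, Complex.normSq_eq_norm_sq] at h1
    have h3 : ((lam - lam⁻¹) * ‖(w : ℂ)‖) ^ 2 ≤ (√(|L|) * w.im) ^ 2 := by
      rw [mul_pow, mul_pow, Real.sq_sqrt (abs_nonneg _)]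
      linarith
    have hwi := w.im_pos
    rw [sq_le_sq₀ (mul_nonneg (by linarith) hwn.le) (by positivity)] at h3
    rw [hM, div_mul_eq_mul_div, le_div_iff₀ (by linarith)]
    linarith
  -- The power `n` is chosen so that dividing by `(lam ^ 2) ^ n` brings `|w|` into `[1, lam ^ 2)`.
  obtain ⟨n, hn1, hn2⟩ := exists_mem_Ico_zpow hwn (by nlinarith : 1 < lam ^ 2)
  refine ⟨-n, ?_⟩
  rw [mem_smul_set_iff_inv_smul_mem]
  have hpow : ∀ (n : ℤ) (w : ℍ), ((dilation lam hl0 ^ n • w : ℍ) : ℂ) = ((lam ^ 2) ^ n : ℝ) * w := by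
    have hnat : ∀ (n : ℕ) (w : ℍ),
        ((dilation lam hl0 ^ n • w : ℍ) : ℂ) = ((lam ^ 2) ^ n : ℝ) * w := by
      intro n
      induction n with
      | zero => intro w; simp
      | succ k ih =>
        intro w
        rw [pow_succ, mul_smul, ih, dilation_smul]
        push_cast
        ring
    intro n w
    cases n with
    | ofNat m => simpa using hnat m w
    | negSucc m =>
      have h1 := hnat (m + 1) ((dilation lam hl0 ^ (m + 1))⁻¹ • w)
      rw [smul_inv_smul] at h1
      rw [zpow_negSucc, zpow_negSucc, h1, ← mul_assoc, ← Complex.ofReal_mul, inv_mul_cancel₀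
        (by positivity)]
      simp
  have e : σ⁻¹ • A ^ (-n) • z = dilation lam hl0 ^ (-n) • w := by
    have hA : A = σ * dilation lam hl0 * σ⁻¹ := by rw [← hσ]; group
    rw [hw, smul_smul, smul_smul]
    congr 1
    nth_rw 1 [hA]
    rw [conj_zpow]
    group
  rw [e]
  set w' := dilation lam hl0 ^ (-n) • w with hw'
  have hcoe : (w' : ℂ) = ((lam ^ 2) ^ (-n) : ℝ) * w := hpow _ _
  have hl2 : 0 < (lam ^ 2) ^ n := by positivity
  have hnorm : ‖(w' : ℂ)‖ = ‖(w : ℂ)‖ / (lam ^ 2) ^ n := by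
    rw [hcoe, norm_mul, Complex.norm_real, Real.norm_of_nonneg (by positivity), zpow_neg]
    field_simp
  have him : w'.im = w.im / (lam ^ 2) ^ n := by
    rw [← UpperHalfPlane.coe_im, hcoe, Complex.im_ofReal_mul,
      zpow_neg]
    field_simp
    simp
  have hn1' : 1 ≤ ‖(w' : ℂ)‖ := by rwa [hnorm, one_le_div hl2]
  have hn2' : ‖(w' : ℂ)‖ ≤ lam ^ 2 := by
    rw [hnorm, div_le_iff₀ hl2]
    rw [zpow_add_one₀ (by positivity)] at hn2
    linarith
  have hre := abs_le.1 ((Complex.abs_re_le_norm (w' : ℂ)).trans hn2')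
  refine ⟨hre.1, hre.2, ?_, (le_abs_self _).trans ((Complex.abs_im_le_norm (w' : ℂ)).trans hn2')⟩
  rw [div_le_iff₀ (by positivity)]
  have : ‖(w' : ℂ)‖ ≤ M * w'.im := by
    rw [hnorm, him, ← mul_div_assoc]
    gcongr
  have := w'.im_pos
  nlinarith

/-! ### Cusps -/

/-- The translations in a conjugate of `Γ`. -/
def translationLengths (Γ : Subgroup SL(2, ℝ)) (σ : SL(2, ℝ)) : AddSubgroup ℝ where
  carrier := {τ | ∃ γ ∈ Γ, ∀ z : ℍ, (σ⁻¹ * γ * σ) • z = τ +ᵥ z}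
  zero_mem' := ⟨1, Γ.one_mem, fun z => by simp⟩
  add_mem' := by
    rintro a b ⟨γ, hγ, h⟩ ⟨δ, hδ, h'⟩
    refine ⟨γ * δ, Γ.mul_mem hγ hδ, fun z => ?_⟩
    rw [show σ⁻¹ * (γ * δ) * σ = (σ⁻¹ * γ * σ) * (σ⁻¹ * δ * σ) by group, mul_smul, h', h, vadd_vadd]
  neg_mem' := by
    rintro a ⟨γ, hγ, h⟩
    refine ⟨γ⁻¹, Γ.inv_mem hγ, fun z => ?_⟩
    rw [show σ⁻¹ * γ⁻¹ * σ = (σ⁻¹ * γ * σ)⁻¹ by group, inv_smul_eq_iff, h, vadd_vadd]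
    simp

/-- A translation of length at most `R` carries `i` into a fixed compact segment at height `1`, so
proper discontinuity leaves finitely many. -/
lemma finite_translationLengths {Γ : Subgroup SL(2, ℝ)} (hΓ : DiscreteTopology Γ) (σ : SL(2, ℝ))
    (R : ℝ) : {τ | τ ∈ translationLengths Γ σ ∧ |τ| ≤ R}.Finite := by
  have hK : IsCompact (σ • {z : ℍ | -R ≤ z.re ∧ z.re ≤ R ∧ 1 ≤ z.im ∧ z.im ≤ 1}) :=
    (isCompact_box (-R) R one_pos 1).smul σ
  have := (ProperlyDiscontinuousSMul.finite_disjoint_inter_image (Γ := Γ)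
    (isCompact_singleton (x := σ • UpperHalfPlane.I)) hK).image
    (fun γ : Γ => ((σ⁻¹ * γ.1 * σ) • UpperHalfPlane.I).re)
  refine this.subset ?_
  rintro τ ⟨⟨γ, hγ, h⟩, hτ⟩
  refine ⟨⟨γ, hγ⟩, ?_, by simp [h]⟩
  refine ⟨γ • σ • UpperHalfPlane.I, ⟨_, rfl, rfl⟩, ?_⟩
  rw [mem_smul_set_iff_inv_smul_mem, smul_smul, smul_smul, h]
  have := abs_le.1 hτ
  simp [this.1, this.2]

/-- A nonzero subgroup of `ℝ` with finitely many elements in each bounded interval is generated by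
its least positive element. -/
lemma exists_zmultiples {Γ : Subgroup SL(2, ℝ)} (hΓ : DiscreteTopology Γ) {σ : SL(2, ℝ)} {x : ℝ}
    (hx0 : x ≠ 0) (hx : x ∈ translationLengths Γ σ) :
    ∃ b, 0 < b ∧ b ∈ translationLengths Γ σ ∧
      ∀ τ ∈ translationLengths Γ σ, ∃ n : ℤ, τ = n * b := by
  have hx' : |x| ∈ translationLengths Γ σ := by
    rcases abs_choice x with h | h <;> rw [h]
    · exact hx
    · exact neg_mem hx
  have hfin : {τ | τ ∈ translationLengths Γ σ ∧ 0 < τ ∧ τ ≤ |x|}.Finite :=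
    (finite_translationLengths hΓ σ |x|).subset fun τ h => ⟨h.1, by
      rw [abs_of_pos h.2.1]; exact h.2.2⟩
  obtain ⟨b, ⟨hb, hb0, hbx⟩, hmin⟩ := hfin.exists_minimalFor id _ ⟨|x|, hx', abs_pos.2 hx0, le_rfl⟩
  have hleast : IsLeast {g | g ∈ translationLengths Γ σ ∧ 0 < g} b := by
    refine ⟨⟨hb, hb0⟩, fun g hg => ?_⟩
    rcases le_total g b with h | h
    · exact hmin ⟨hg.1, hg.2, h.trans hbx⟩ h
    · exact h
  refine ⟨b, hb0, hb, fun τ hτ => ?_⟩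
  rw [AddSubgroup.cyclic_of_min hleast, AddSubgroup.mem_closure_singleton] at hτ
  obtain ⟨n, hn⟩ := hτ
  exact ⟨n, by rw [← hn]; simp⟩

/-- An element fixing `i∞` acts by an affine map. -/
lemma coe_smul_of_upperTriangular {B : SL(2, ℝ)} (h : B 1 0 = 0) (z : ℍ) :
    ((B • z : ℍ) : ℂ) = (B 0 0 : ℂ) ^ 2 * z + B 0 0 * B 0 1 := by
  have hd := SL2_det B
  rw [h, mul_zero, sub_zero] at hd
  have hd' : (B 0 0 : ℂ) * B 1 1 = 1 := by exact_mod_cast hd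
  have h11 : (B 1 1 : ℂ) ≠ 0 := right_ne_zero_of_mul_eq_one hd'
  rw [SL2_coe_smul, h]
  simp only [Complex.ofReal_zero, zero_mul, zero_add]
  rw [div_eq_iff h11]
  linear_combination (-(B 0 0 : ℂ) * z - B 0 1) * hd'

/-- Conjugation by `γ` and its inverse scales the translation lattice by `a ^ 2` and `a ^ (-2)`.
Both are therefore integers with product `1`: no hyperbolic element of a discrete group shares a
fixed point with a parabolic one. -/
lemma sq_eq_one_of_fixes {Γ : Subgroup SL(2, ℝ)} (hΓ : DiscreteTopology Γ) {σ : SL(2, ℝ)} {x : ℝ}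
    (hx0 : x ≠ 0) (hx : x ∈ translationLengths Γ σ) {γ : SL(2, ℝ)} (hγ : γ ∈ Γ)
    (h : (σ⁻¹ * γ * σ) 1 0 = 0) : (σ⁻¹ * γ * σ) 0 0 ^ 2 = 1 := by
  obtain ⟨b, hb0, hb, hgen⟩ := exists_zmultiples hΓ hx0 hx
  set B := σ⁻¹ * γ * σ with hB
  set a := B 0 0 with ha
  have ha0 : a ≠ 0 := by
    intro h0
    have hd := SL2_det B
    rw [h, ← ha, h0] at hd
    simp at hd
  have hmul : a ^ 2 * b ∈ translationLengths Γ σ := by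
    obtain ⟨δ, hδ, hδb⟩ := hb
    refine ⟨γ * δ * γ⁻¹, Γ.mul_mem (Γ.mul_mem hγ hδ) (Γ.inv_mem hγ), fun z => ?_⟩
    rw [show σ⁻¹ * (γ * δ * γ⁻¹) * σ = B * (σ⁻¹ * δ * σ) * B⁻¹ by rw [hB]; group, mul_smul,
      mul_smul, hδb]
    conv_rhs => rw [← smul_inv_smul B z]
    generalize B⁻¹ • z = w
    apply UpperHalfPlane.ext
    rw [coe_smul_of_upperTriangular h, UpperHalfPlane.coe_vadd, UpperHalfPlane.coe_vadd,
      coe_smul_of_upperTriangular h]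
    push_cast
    ring
  have hmul' : (a ^ 2)⁻¹ * b ∈ translationLengths Γ σ := by
    obtain ⟨δ, hδ, hδb⟩ := hb
    refine ⟨γ⁻¹ * δ * γ, Γ.mul_mem (Γ.mul_mem (Γ.inv_mem hγ) hδ) hγ, fun z => ?_⟩
    rw [show σ⁻¹ * (γ⁻¹ * δ * γ) * σ = B⁻¹ * (σ⁻¹ * δ * σ) * B by rw [hB]; group, mul_smul,
      mul_smul, hδb, inv_smul_eq_iff]
    apply UpperHalfPlane.ext
    rw [coe_smul_of_upperTriangular h, UpperHalfPlane.coe_vadd, UpperHalfPlane.coe_vadd,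
      coe_smul_of_upperTriangular h]
    have : (a : ℂ) ≠ 0 := by exact_mod_cast ha0
    push_cast
    field_simp
    ring
  obtain ⟨m, hm⟩ := hgen _ hmul
  obtain ⟨n, hn⟩ := hgen _ hmul'
  have hm' : a ^ 2 = m := mul_right_cancel₀ hb0.ne' hm
  have hn' : (a ^ 2)⁻¹ = n := mul_right_cancel₀ hb0.ne' hn
  have hmn : (m : ℝ) * n = 1 := by rw [← hm', ← hn']; field_simp
  have hmn' : m * n = 1 := by exact_mod_cast hmn
  have hm0 : 0 ≤ m := by
    have : (0 : ℝ) ≤ m := by rw [← hm']; positivity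
    exact_mod_cast this
  have := Int.eq_one_or_neg_one_of_mul_eq_one hmn'
  have : m = 1 := by omega
  rw [hm', this]; simp

lemma inv_dilation_smul {c : ℝ} (hc : c ≠ 0) (z : ℍ) :
    (((dilation c hc)⁻¹ • z : ℍ) : ℂ) = ((c : ℂ) ^ 2)⁻¹ * z := by
  conv_rhs => rw [← smul_inv_smul (dilation c hc) z, dilation_smul]
  have : (c : ℂ) ≠ 0 := by exact_mod_cast hc
  field_simp

/-- Every parabolic element of a discrete group fixes a cusp. -/
lemma exists_isCuspUniformizer {Γ : Subgroup SL(2, ℝ)} (hΓ : DiscreteTopology Γ) {A : SL(2, ℝ)}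
    (hA : A ∈ Γ) (hA1 : A ≠ 1) (htr : A.1.trace = 2) :
    ∃ σ, IsCuspUniformizer Γ σ ∧ ∃ x : ℝ, x ≠ 0 ∧ σ⁻¹ * A * σ = translation x := by
  obtain ⟨σ, h10, h00⟩ := exists_conj_upperTriangular (A := A) (lam := 1) (by rw [htr]; norm_num)
  have h11 : (σ⁻¹ * A * σ) 1 1 = 1 := by
    have := SL2_det (σ⁻¹ * A * σ)
    rw [h10, h00] at this
    linarith
  obtain ⟨x, hx⟩ : ∃ x, (σ⁻¹ * A * σ) 0 1 = x := ⟨_, rfl⟩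
  have hAx : σ⁻¹ * A * σ = translation x := by
    apply Subtype.ext
    ext i j
    fin_cases i <;> fin_cases j <;> simp [translation, h10, h00, h11, hx]
  have hx0 : x ≠ 0 := by
    intro h0
    apply hA1
    have h1 : translation 0 = 1 := by
      apply Subtype.ext
      ext i j
      fin_cases i <;> fin_cases j <;> simp [translation]
    rw [h0, h1] at hAx
    have : A = σ * (σ⁻¹ * A * σ) * σ⁻¹ := by group
    rw [this, hAx]
    simp
  have hxmem : x ∈ translationLengths Γ σ := ⟨A, hA, fun z => by rw [hAx, translation_smul]⟩
  obtain ⟨b, hb0, hb, hgen⟩ := exists_zmultiples hΓ hx0 hxmem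
  obtain ⟨s, hs⟩ : ∃ s, s = b / (2 * Real.pi) := ⟨_, rfl⟩
  have hπ := Real.pi_pos
  have hs0 : 0 < s := by rw [hs]; positivity
  -- Conjugating by `z ↦ c ^ 2 z` divides translation lengths by `c ^ 2 = b / (2π)`, so the
  -- generator `b` becomes `2π`.
  obtain ⟨c, hc0, hc2⟩ : ∃ c, c ≠ 0 ∧ c ^ 2 = s :=
    ⟨√s, (Real.sqrt_pos.2 hs0).ne', Real.sq_sqrt hs0.le⟩
  have hcc : (c : ℂ) ≠ 0 := by exact_mod_cast hc0
  have hconj : ∀ γ, (σ * dilation c hc0)⁻¹ * γ * (σ * dilation c hc0) =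
      (dilation c hc0)⁻¹ * (σ⁻¹ * γ * σ) * dilation c hc0 := fun γ => by group
  have htrans : ∀ (γ : SL(2, ℝ)) (τ : ℝ), (∀ z : ℍ, (σ⁻¹ * γ * σ) • z = τ +ᵥ z) →
      ∀ z : ℍ, ((σ * dilation c hc0)⁻¹ * γ * (σ * dilation c hc0)) • z = (τ / s) +ᵥ z := by
    intro γ τ h z
    rw [hconj, mul_smul, mul_smul, h]
    apply UpperHalfPlane.ext
    rw [inv_dilation_smul, UpperHalfPlane.coe_vadd, UpperHalfPlane.coe_vadd, dilation_smul,
      ← hc2]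
    push_cast
    field_simp
  refine ⟨σ * dilation c hc0, ⟨?_, ?_⟩, x / s, div_ne_zero hx0 hs0.ne', ?_⟩
  · intro γ hγ h
    have h' : (σ⁻¹ * γ * σ) 1 0 = 0 := by
      rw [hconj] at h
      generalize σ⁻¹ * γ * σ = B at h ⊢
      rw [coe_conj] at h
      simpa [dilation, Matrix.mul_apply, Fin.sum_univ_two, Matrix.vecMul, dotProduct, hc0] using h
    have hsq := sq_eq_one_of_fixes hΓ hx0 hxmem hγ h'
    have hsq' : ((σ⁻¹ * γ * σ) 0 0 : ℂ) ^ 2 = 1 := by exact_mod_cast hsq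
    obtain ⟨τ, hτ⟩ : ∃ τ, τ = (σ⁻¹ * γ * σ) 0 0 * (σ⁻¹ * γ * σ) 0 1 := ⟨_, rfl⟩
    have hact : ∀ z : ℍ, (σ⁻¹ * γ * σ) • z = τ +ᵥ z := by
      intro z
      apply UpperHalfPlane.ext
      rw [coe_smul_of_upperTriangular h', hsq', UpperHalfPlane.coe_vadd, hτ]
      push_cast
      ring
    obtain ⟨n, hn⟩ := hgen τ ⟨γ, hγ, hact⟩
    refine ⟨n, fun z => ?_⟩
    rw [htrans γ τ hact, hn, hs]
    congr 1
    field_simp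
  · obtain ⟨γ, hγ, h⟩ := hb
    refine ⟨γ, hγ, fun z => ?_⟩
    rw [htrans γ b h, hs]
    congr 1
    field_simp
  · rw [hconj, hAx]
    apply Subtype.ext
    rw [coe_conj]
    ext i j
    fin_cases i <;> fin_cases j <;> simp [translation, dilation, Matrix.mul_apply,
      Fin.sum_univ_two, hc0]
    rw [← hc2]
    field_simp

/-- A sublevel set of the displacement of a parabolic element lies, modulo `Γ`, in the union of a
compact set and any horoball at its fixed point. -/
lemma exists_compact_parabolic {Γ : Subgroup SL(2, ℝ)} {σ : SL(2, ℝ)} (hσ : IsCuspUniformizer Γ σ)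
    {A : SL(2, ℝ)} {x : ℝ} (hx : x ≠ 0) (hA : σ⁻¹ * A * σ = translation x) (L Y : ℝ) :
    ∃ K : Set ℍ, IsCompact K ∧ ∀ z, displacement A z ≤ L → ∃ γ ∈ Γ,
      γ • z ∈ K ∨ Y ≤ (σ⁻¹ • γ • z).im := by
  have hx0 : 0 < |x| := abs_pos.2 hx
  -- The displacement of a translation by `x` is `x ^ 2 / y ^ 2`, so its sublevel set is contained
  -- in the horoball `y ≥ y₀`. Below height `Y` and modulo `2π` only a rectangle of it is left.
  set y₀ : ℝ := |x| / (√(|L|) + 1) with hy₀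
  refine ⟨_, (isCompact_box 0 (2 * Real.pi) (y₀ := y₀) (by positivity) Y).smul σ, fun z hz => ?_⟩
  set w := σ⁻¹ • z with hw
  have hwy : y₀ ≤ w.im := by
    have h1 := hz.trans (le_abs_self L)
    have hwi := w.im_pos
    rw [← displacement_conj' A σ, hA, ← hw, displacement_eq, div_le_iff₀ (by positivity)] at h1
    have h2 : fixPoly (translation x) w = ((-x : ℝ) : ℂ) := by
      simp [fixPoly, translation]
    rw [h2, Complex.normSq_ofReal] at h1
    have h3 : |x| ^ 2 ≤ (√(|L|) * w.im) ^ 2 := by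
      rw [mul_pow, Real.sq_sqrt (abs_nonneg _), sq_abs]
      linarith
    rw [sq_le_sq₀ hx0.le (by positivity)] at h3
    rw [hy₀, div_le_iff₀ (by positivity)]
    linarith
  by_cases hY : Y ≤ w.im
  · exact ⟨1, Γ.one_mem, Or.inr (by simpa using hY)⟩
  obtain ⟨γ, hγ, hact⟩ := hσ.2
  have hpow : ∀ n : ℤ, ∃ δ ∈ Γ, ∀ z : ℍ, (σ⁻¹ * δ * σ) • z = ((n * (2 * Real.pi) : ℝ)) +ᵥ z := by
    intro n
    have : (n * (2 * Real.pi) : ℝ) ∈ translationLengths Γ σ := by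
      rw [← zsmul_eq_mul]
      exact zsmul_mem (show _ ∈ translationLengths Γ σ from ⟨γ, hγ, hact⟩) n
    exact this
  have hp : (0 : ℝ) < 2 * Real.pi := by positivity
  obtain ⟨δ, hδ, hδact⟩ := hpow (-⌊w.re / (2 * Real.pi)⌋)
  refine ⟨δ, hδ, Or.inl ?_⟩
  rw [mem_smul_set_iff_inv_smul_mem]
  have e : σ⁻¹ • δ • z = (σ⁻¹ * δ * σ) • w := by
    rw [hw, smul_smul, smul_smul]
    congr 1
    group
  rw [e, hδact]
  have h1 := Int.floor_le (w.re / (2 * Real.pi))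
  have h2 := (Int.lt_floor_add_one (w.re / (2 * Real.pi))).le
  rw [le_div_iff₀ hp] at h1
  rw [div_le_iff₀ hp] at h2
  refine ⟨?_, ?_, ?_, ?_⟩
  · simp; linarith
  · simp; linarith
  · simpa using hwy
  · simpa using (not_le.1 hY).le

/-- **Siegel's theorem.**  A quotient of the upper half-plane of finite area is the union of a
compact set and finitely many cusp neighborhoods. -/
theorem exists_compact_union_cusps {Γ : Subgroup SL(2, ℝ)} (hΓ : DiscreteTopology Γ)
    (hvol : FiniteVolume Γ) :
    ∃ S : Set SL(2, ℝ), S.Finite ∧ (∀ σ ∈ S, IsCuspUniformizer Γ σ) ∧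
      ∀ Y : ℝ, ∃ K : Set ℍ, IsCompact K ∧ ∀ z : ℍ, ∃ γ ∈ Γ,
        γ • z ∈ K ∨ ∃ σ ∈ S, Y ≤ (σ⁻¹ • γ • z).im := by
  obtain ⟨K₀, hK₀, hthick⟩ := exists_compact_thickPart hΓ hvol (ε := 1 / 16) (by norm_num)
  -- Up to conjugation in `Γ`, the finitely many elements of `E` account for the whole thin part.
  set E := {γ | γ ∈ Γ ∧ ∃ z ∈ K₀, deviation γ z ≤ (1 / 16) ^ 2} with hE
  have hEfin : E.Finite := finite_deviation_le hΓ hK₀ _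
  choose! σ hσ x hx hσx using fun (A : SL(2, ℝ)) (h : A ∈ Γ ∧ A ≠ 1 ∧ A.1.trace = 2) =>
    exists_isCuspUniformizer hΓ h.1 h.2.1 h.2.2
  refine ⟨σ '' {γ ∈ E | γ ≠ 1 ∧ γ.1.trace = 2}, (hEfin.subset fun γ h => h.1).image σ, ?_, ?_⟩
  · rintro _ ⟨γ, ⟨hγ, h1, h2⟩, rfl⟩
    exact hσ γ ⟨hγ.1, h1, h2⟩
  intro Y
  set S := σ '' {γ ∈ E | γ ≠ 1 ∧ γ.1.trace = 2} with hS
  have hone : ∀ γ ∈ E, ∃ K : Set ℍ, IsCompact K ∧ (γ ≠ 1 → ∀ z, deviation γ z ≤ (1 / 16) ^ 2 →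
      ∃ δ ∈ Γ, δ • z ∈ K ∨ ∃ σ ∈ S, Y ≤ (σ⁻¹ • δ • z).im) := by
    rintro γ ⟨hγ, hex⟩
    by_cases hγ1 : γ = 1
    · exact ⟨∅, isCompact_empty, fun h => absurd hγ1 h⟩
    set L := (1 / 16 : ℝ) ^ 2 - 2 * (2 - γ.1.trace) with hL
    have hdisp : ∀ z, deviation γ z ≤ (1 / 16) ^ 2 → displacement γ z ≤ L := by
      intro z hz
      rw [deviation] at hz
      linarith
    -- A small deviation keeps the trace from falling much below `2`. Being positive, it decides by
    -- comparison with `2` whether the element is elliptic, parabolic or hyperbolic.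
    have htr : 0 < γ.1.trace := by
      obtain ⟨z, -, hz⟩ := hex
      have := displacement_nonneg γ z
      rw [deviation] at hz
      linarith
    rcases lt_trichotomy γ.1.trace 2 with h2 | h2 | h2
    · obtain ⟨K, hK, hKz⟩ := isCompact_sublevel_elliptic (A := γ) (by nlinarith) L
      exact ⟨K, hK, fun _ z hz => ⟨1, Γ.one_mem, Or.inl (by simpa using hKz z (hdisp z hz))⟩⟩
    · have hP : γ ∈ Γ ∧ γ ≠ 1 ∧ γ.1.trace = 2 := ⟨hγ, hγ1, h2⟩
      obtain ⟨K, hK, hKz⟩ := exists_compact_parabolic (hσ γ hP) (hx γ hP) (hσx γ hP) L Y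
      refine ⟨K, hK, fun _ z hz => ?_⟩
      obtain ⟨δ, hδ, h | h⟩ := hKz z (hdisp z hz)
      · exact ⟨δ, hδ, Or.inl h⟩
      · exact ⟨δ, hδ, Or.inr ⟨σ γ, ⟨γ, ⟨⟨hγ, hex⟩, hγ1, h2⟩, rfl⟩, h⟩⟩
    · obtain ⟨K, hK, hKz⟩ := exists_compact_hyperbolic h2 L
      refine ⟨K, hK, fun _ z hz => ?_⟩
      obtain ⟨n, hn⟩ := hKz z (hdisp z hz)
      exact ⟨γ ^ n, Γ.zpow_mem hγ n, Or.inl hn⟩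
  choose! K hK hKz using hone
  refine ⟨K₀ ∪ ⋃ γ ∈ E, K γ, hK₀.union (hEfin.isCompact_biUnion hK), fun z => ?_⟩
  by_cases hz : z ∈ thickPart Γ (1 / 16)
  · obtain ⟨γ, hγ, h⟩ := hthick z hz
    exact ⟨γ, hγ, Or.inl (Or.inl h)⟩
  -- The same `γ` is small at `z` and at the thick point `z'`. Once `δ` moves `z'` into `K₀`, the
  -- conjugate of `γ` by `δ` lies in `E`, and `δ • z` lies in one of its sublevel sets.
  obtain ⟨z', hz', γ, hγ, hγ1, -, hγz', hγz⟩ := exists_mem_thickPart hΓ hz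
  obtain ⟨δ, hδ, hδz'⟩ := hthick z' hz'
  have hmem : δ * γ * δ⁻¹ ∈ E :=
    ⟨Γ.mul_mem (Γ.mul_mem hδ hγ) (Γ.inv_mem hδ), δ • z', hδz', by
      rw [deviation_conj, hγz']⟩
  obtain ⟨γ', hγ', h⟩ := hKz _ hmem (by rwa [Ne, mul_inv_eq_one, mul_eq_left]) (δ • z)
    (by rwa [deviation_conj])
  refine ⟨γ' * δ, Γ.mul_mem hγ' hδ, ?_⟩
  rw [mul_smul]
  refine h.imp (fun h => Or.inr ?_) id
  simp only [mem_iUnion]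
  exact ⟨_, hmem, h⟩

/-! ### Real one-forms on the upper half-plane

The form `Re (b dz)` is represented by the complex-valued function `b`. -/

/-- The coefficient of `dx ∧ dy` in `d (Re (b dz))`. -/
def curl (b : ℂ → ℂ) (z : ℂ) : ℝ := -((fderiv ℝ b z 1).im + (fderiv ℝ b z Complex.I).re)

lemma curl_congr {b c : ℂ → ℂ} {z : ℂ} (h : b =ᶠ[𝓝 z] c) : curl b z = curl c z := by
  rw [curl, curl, h.fderiv_eq]

lemma realLinear_apply (L : ℂ →L[ℝ] ℂ) (w : ℂ) : L w = w.re * L 1 + w.im * L Complex.I := by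
  conv_lhs => rw [← Complex.re_add_im w, ← mul_one (w.re : ℂ), ← Complex.real_smul,
    ← Complex.real_smul, map_add, map_smul, map_smul]
  simp

/-- The curl of the pull-back by a holomorphic map. -/
lemma curl_comp {b : ℂ → ℂ} {m g : ℂ → ℂ} {z : ℂ} (hm : HasDerivAt m (g z) z)
    (hg : DifferentiableAt ℂ g z) (hb : DifferentiableAt ℝ b (m z)) :
    curl (fun w => b (m w) * g w) z = Complex.normSq (g z) * curl b (m z) := by
  have h1 : HasFDerivAt (fun w => b (m w))
      ((fderiv ℝ b (m z)).comp ((ContinuousLinearMap.toSpanSingleton ℂ (g z)).restrictScalars ℝ))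
      z := hb.hasFDerivAt.comp z (hm.hasFDerivAt.restrictScalars ℝ)
  have h2 : HasFDerivAt g
      ((ContinuousLinearMap.toSpanSingleton ℂ (deriv g z)).restrictScalars ℝ) z :=
    hg.hasDerivAt.hasFDerivAt.restrictScalars ℝ
  have h3 := h1.fun_mul h2
  rw [curl, curl, h3.fderiv]
  simp only [_root_.add_apply, _root_.smul_apply,
    ContinuousLinearMap.comp_apply, ContinuousLinearMap.coe_restrictScalars',
    ContinuousLinearMap.toSpanSingleton_apply, smul_eq_mul, one_mul]
  rw [realLinear_apply _ (g z), realLinear_apply _ (Complex.I * g z)]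
  simp [Complex.normSq_apply]
  ring

/-- Leibniz rule: the subtracted bracket is minus the coefficient of `dφ ∧ Re (b dz)`. -/
lemma curl_ofReal_mul {φ : ℂ → ℝ} {b : ℂ → ℂ} {z : ℂ} (hφ : DifferentiableAt ℝ φ z)
    (hb : DifferentiableAt ℝ b z) :
    curl (fun w => (φ w : ℂ) * b w) z = φ z * curl b z -
      (fderiv ℝ φ z 1 * (b z).im + fderiv ℝ φ z Complex.I * (b z).re) := by
  have h1 : HasFDerivAt (fun w => (φ w : ℂ)) (Complex.ofRealCLM.comp (fderiv ℝ φ z)) z :=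
    Complex.ofRealCLM.hasFDerivAt.comp z hφ.hasFDerivAt
  have h3 := h1.fun_mul hb.hasFDerivAt
  rw [curl, curl, h3.fderiv]
  simp
  ring

lemma curl_sum {ι : Type*} (s : Finset ι) {b : ι → ℂ → ℂ} {z : ℂ}
    (hb : ∀ i ∈ s, DifferentiableAt ℝ (b i) z) :
    curl (fun w => ∑ i ∈ s, b i w) z = ∑ i ∈ s, curl (b i) z := by
  simp only [curl, fderiv_fun_sum hb, _root_.sum_apply, Complex.im_sum,
    Complex.re_sum, Finset.sum_neg_distrib, Finset.sum_add_distrib]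

lemma continuousOn_curl {b : ℂ → ℂ} {U : Set ℂ} (hU : IsOpen U) (hb : ContDiffOn ℝ ∞ b U) :
    ContinuousOn (curl b) U := by
  have := hb.continuousOn_fderiv_of_isOpen hU (by simp)
  unfold curl
  exact ((Complex.continuous_im.comp_continuousOn (this.clm_apply continuousOn_const)).add
    (Complex.continuous_re.comp_continuousOn (this.clm_apply continuousOn_const))).neg

lemma continuous_curl {b : ℂ → ℂ} (hb : ContDiff ℝ ∞ b) : Continuous (curl b) := by
  rw [← continuousOn_univ]
  exact continuousOn_curl isOpen_univ hb.contDiffOn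

lemma hasCompactSupport_curl {b : ℂ → ℂ} (hc : HasCompactSupport b) :
    HasCompactSupport (curl b) := by
  refine (hc.fderiv ℝ).mono ?_
  intro z hz
  rw [Function.mem_support] at hz ⊢
  contrapose! hz
  simp [curl, hz]

/-- Integration by parts against the constant function `1`. -/
lemma integral_fderiv_apply_eq_zero {b : ℂ → ℂ} (hb : ContDiff ℝ ∞ b) (hc : HasCompactSupport b)
    (v : ℂ) : ∫ z, fderiv ℝ b z v = 0 := by
  have hcont : Continuous fun z => fderiv ℝ b z v :=
    (hb.continuous_fderiv (by simp)).clm_apply continuous_const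
  have hcs : HasCompactSupport fun z => fderiv ℝ b z v := (hc.fderiv ℝ).comp_left
    (g := fun L : ℂ →L[ℝ] ℂ => L v) (by simp)
  have := integral_mul_fderiv_eq_neg_fderiv_mul_of_integrable (μ := volume) (𝕜 := ℂ)
    (f := fun _ : ℂ => (1 : ℂ)) (g := b) (v := v) (by simp)
    (by simpa using hcont.integrable_of_hasCompactSupport hcs)
    (by simpa using hb.continuous.integrable_of_hasCompactSupport hc) (by simp)
    (fun x _ => hb.differentiable (by simp) x)
  simpa using this

lemma integral_curl_eq_zero {b : ℂ → ℂ} (hb : ContDiff ℝ ∞ b) (hc : HasCompactSupport b) :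
    ∫ z, curl b z = 0 := by
  have hI : ∀ v : ℂ, Integrable fun z => fderiv ℝ b z v := fun v =>
    ((hb.continuous_fderiv (by simp)).clm_apply
      continuous_const).integrable_of_hasCompactSupport ((hc.fderiv ℝ).comp_left
    (g := fun L : ℂ →L[ℝ] ℂ => L v) (by simp))
  simp only [curl]
  rw [integral_neg, integral_add]
  · have h1 := (Complex.imCLM.integral_comp_comm (hI 1))
    have h2 := (Complex.reCLM.integral_comp_comm (hI Complex.I))
    simp only [Complex.imCLM_apply, Complex.reCLM_apply] at h1 h2
    rw [h1, h2, integral_fderiv_apply_eq_zero hb hc, integral_fderiv_apply_eq_zero hb hc]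
    simp
  · exact (hI 1).im
  · exact (hI Complex.I).re

/-! ### The hyperbolic area -/

lemma isOpen_upper : IsOpen upper := isOpen_lt continuous_const Complex.continuous_im

lemma coe_mem_upper (z : ℍ) : (z : ℂ) ∈ upper := z.im_pos

lemma range_coe_eq_upper : Set.range ((↑) : ℍ → ℂ) = upper := by
  ext z
  exact ⟨fun ⟨w, hw⟩ => hw ▸ w.im_pos, fun hz => ⟨⟨z, hz⟩, rfl⟩⟩

lemma measurable_density : Measurable fun z : ℍ => (1 / NNReal.mk z.im z.im_pos.le) ^ 2 := by
  have : Measurable fun z : ℍ => NNReal.mk z.im z.im_pos.le :=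
    UpperHalfPlane.continuous_im.measurable.subtype_mk
  exact (measurable_const.div this).pow_const 2

lemma integral_upperHalfPlane (f : ℂ → ℝ) :
    ∫ z : ℍ, f z = ∫ z in upper, (1 / z.im ^ 2) * f z := by
  rw [UpperHalfPlane.volume_def]
  have := integral_withDensity_eq_integral_smul (μ := volume.comap UpperHalfPlane.coe)
    measurable_density (fun z : ℍ => f z)
  rw [this, ← range_coe_eq_upper, ← UpperHalfPlane.measurableEmbedding_coe.map_comap,
    UpperHalfPlane.measurableEmbedding_coe.integral_map]
  congr 1
  ext z
  simp [NNReal.smul_def]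

lemma integrable_upperHalfPlane_iff (f : ℂ → ℝ) :
    Integrable (fun z : ℍ => f z) ↔ IntegrableOn (fun z => (1 / z.im ^ 2) * f z) upper := by
  rw [UpperHalfPlane.volume_def,
    integrable_withDensity_iff_integrable_smul measurable_density, IntegrableOn,
    ← range_coe_eq_upper, ← UpperHalfPlane.measurableEmbedding_coe.map_comap,
    UpperHalfPlane.measurableEmbedding_coe.integrable_map_iff]
  refine integrable_congr (Filter.Eventually.of_forall fun z => ?_)
  simp [NNReal.smul_def]

/-- Stokes' theorem for forms of compact support in the upper half-plane. -/
lemma integral_im_sq_mul_curl {b : ℂ → ℂ} (hb : ContDiff ℝ ∞ b) (hc : HasCompactSupport b)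
    (hsupp : tsupport b ⊆ upper) :
    Integrable (fun z : ℍ => z.im ^ 2 * curl b z) ∧ ∫ z : ℍ, z.im ^ 2 * curl b z = 0 := by
  have hzero : ∀ z ∉ upper, curl b z = 0 := by
    intro z hz
    have h0 : b =ᶠ[𝓝 z] fun _ => 0 :=
      notMem_tsupport_iff_eventuallyEq.1 fun h => hz (hsupp h)
    rw [curl_congr h0]
    simp [curl]
  have heq : ∀ z ∈ upper, 1 / z.im ^ 2 * (z.im ^ 2 * curl b z) = curl b z := by
    intro z hz
    have : z.im ≠ 0 := ne_of_gt hz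
    field_simp
  have hint : Integrable (curl b) :=
    (continuous_curl hb).integrable_of_hasCompactSupport (hasCompactSupport_curl hc)
  constructor
  · refine (integrable_upperHalfPlane_iff fun z => z.im ^ 2 * curl b z).2 ?_
    exact hint.integrableOn.congr_fun (fun z hz => (heq z hz).symm) isOpen_upper.measurableSet
  · refine (integral_upperHalfPlane fun z => z.im ^ 2 * curl b z).trans ?_
    rw [setIntegral_congr_fun isOpen_upper.measurableSet heq,
      setIntegral_eq_integral_of_forall_compl_eq_zero fun z hz => hzero z hz,
      integral_curl_eq_zero hb hc]

/-! ### Möbius transformations in coordinates -/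

/-- The Möbius transformation of `A` on `ℂ`. -/
def mob (A : SL(2, ℝ)) (z : ℂ) : ℂ := ((A 0 0 : ℂ) * z + A 0 1) / ((A 1 0 : ℂ) * z + A 1 1)

/-- The derivative of `mob A`. -/
def mobDeriv (A : SL(2, ℝ)) (z : ℂ) : ℂ := 1 / ((A 1 0 : ℂ) * z + A 1 1) ^ 2

lemma mob_coe (A : SL(2, ℝ)) (z : ℍ) : mob A z = ((A • z : ℍ) : ℂ) := (SL2_coe_smul A z).symm

lemma mob_mem_upper (A : SL(2, ℝ)) {z : ℂ} (hz : z ∈ upper) : mob A z ∈ upper := by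
  have := mob_coe A ⟨z, hz⟩
  change mob A z = _ at this
  rw [this]
  exact coe_mem_upper _

lemma hasDerivAt_mob (A : SL(2, ℝ)) {z : ℂ} (hz : z ∈ upper) :
    HasDerivAt (mob A) (mobDeriv A z) z := by
  have hd := SL2_denom_ne_zero A (ne_of_gt hz : z.im ≠ 0)
  have h1 : HasDerivAt (fun z : ℂ => (A 0 0 : ℂ) * z + A 0 1) (A 0 0 : ℂ) z := by
    simpa using ((hasDerivAt_id z).const_mul (A 0 0 : ℂ)).add_const (A 0 1 : ℂ)
  have h2 : HasDerivAt (fun z : ℂ => (A 1 0 : ℂ) * z + A 1 1) (A 1 0 : ℂ) z := by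
    simpa using ((hasDerivAt_id z).const_mul (A 1 0 : ℂ)).add_const (A 1 1 : ℂ)
  have hdet : (A 0 0 : ℂ) * A 1 1 - A 0 1 * A 1 0 = 1 := by exact_mod_cast SL2_det A
  convert! h1.div h2 hd using 1
  rw [mobDeriv]
  congr 1
  linear_combination -hdet

lemma differentiableAt_mobDeriv (A : SL(2, ℝ)) {z : ℂ} (hz : z ∈ upper) :
    DifferentiableAt ℂ (mobDeriv A) z := by
  have hd := SL2_denom_ne_zero A (ne_of_gt hz : z.im ≠ 0)
  unfold mobDeriv
  refine DifferentiableAt.div (by fun_prop) (by fun_prop) (pow_ne_zero _ hd)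

lemma contDiffOn_mob (A : SL(2, ℝ)) : ContDiffOn ℝ ∞ (mob A) upper := by
  intro z hz
  have h1 : ContDiffAt ℝ ∞ (fun z : ℂ => (A 0 0 : ℂ) * z + A 0 1) z := by fun_prop
  have h2 : ContDiffAt ℝ ∞ (fun z : ℂ => (A 1 0 : ℂ) * z + A 1 1) z := by fun_prop
  have h3 := h1.mul (h2.inv (SL2_denom_ne_zero A (ne_of_gt hz : z.im ≠ 0)))
  refine (h3.congr_of_eventuallyEq (.of_forall fun w => ?_)).contDiffWithinAt
  exact div_eq_mul_inv _ _

lemma im_mob (A : SL(2, ℝ)) {z : ℂ} (hz : z ∈ upper) :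
    (mob A z).im = z.im * ‖mobDeriv A z‖ := by
  have h := SL2_im_smul A ⟨z, hz⟩
  rw [← UpperHalfPlane.coe_im, ← mob_coe] at h
  change (mob A z).im = z.im / _ at h
  rw [h, mobDeriv, norm_div, norm_pow, Complex.normSq_eq_norm_sq, norm_one]
  ring_nf

lemma mobDeriv_ne_zero (A : SL(2, ℝ)) {z : ℂ} (hz : z ∈ upper) : mobDeriv A z ≠ 0 :=
  one_div_ne_zero (pow_ne_zero _ (SL2_denom_ne_zero A (ne_of_gt hz : z.im ≠ 0)))

/-- The form `Re (b dz)` on the upper half-plane is invariant. -/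
def IsAutomorphic (Γ : Subgroup SL(2, ℝ)) (b : ℂ → ℂ) : Prop :=
  ∀ γ ∈ Γ, ∀ z ∈ upper, b (mob γ z) * mobDeriv γ z = b z

/-- The quantity `y ^ 2 curl b` is the density of `d Re (b dz)` with respect to hyperbolic area,
hence natural under isometries. -/
lemma im_sq_mul_curl_comp (A : SL(2, ℝ)) {b : ℂ → ℂ} {z : ℂ} (hz : z ∈ upper)
    (hb : DifferentiableAt ℝ b (mob A z)) :
    z.im ^ 2 * curl (fun w => b (mob A w) * mobDeriv A w) z =
      (mob A z).im ^ 2 * curl b (mob A z) := by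
  rw [curl_comp (hasDerivAt_mob A hz) (differentiableAt_mobDeriv A hz) hb, im_mob A hz,
    Complex.normSq_eq_norm_sq]
  ring

lemma norm_mul_im_comp (A : SL(2, ℝ)) (b : ℂ → ℂ) {z : ℂ} (hz : z ∈ upper) :
    ‖b (mob A z) * mobDeriv A z‖ * z.im = ‖b (mob A z)‖ * (mob A z).im := by
  rw [im_mob A hz, norm_mul]; ring

/-! ### Stokes' theorem on the quotient -/

lemma exists_bump {K : Set ℂ} (hK : IsCompact K) {U : Set ℂ} (hU : IsOpen U) (hKU : K ⊆ U) :
    ∃ g : ℂ → ℝ, ContDiff ℝ ∞ g ∧ (∀ z, 0 ≤ g z) ∧ (∀ z ∈ K, g z = 1) ∧ HasCompactSupport g ∧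
      tsupport g ⊆ U := by
  obtain ⟨L, hL, hKL, hLU⟩ := exists_compact_between hK hU hKU
  obtain ⟨g, hg, hr, h0, h1⟩ := exists_contMDiff_zero_iff_one_iff_of_isClosed (n := ⊤)
    (modelWithCornersSelf ℝ ℂ) (s := (interior L)ᶜ) (t := K) isOpen_interior.isClosed_compl
    hK.isClosed (disjoint_compl_left_iff_subset.2 hKL)
  have hsup : tsupport g ⊆ L := by
    refine closure_minimal ?_ hL.isClosed
    intro z hz
    by_contra h
    exact hz ((h0 z).1 fun hi => h (interior_subset hi))
  exact ⟨g, contMDiff_iff_contDiff.1 hg, fun z => (hr ⟨z, rfl⟩).1, fun z hz => (h1 z).1 hz,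
    hL.of_isClosed_subset (isClosed_tsupport g) hsup, hsup.trans hLU⟩

lemma mob_lift (Γ : Subgroup SL(2, ℝ)) (t : transformations Γ) (z : ℍ) :
    mob (lift t) z = ((t • z : ℍ) : ℂ) := by
  rw [mob_coe, smul_eq_lift_smul]

/-- The translates of a compactly supported function are locally finite. -/
lemma exists_finset_forall_eq_zero {Γ : Subgroup SL(2, ℝ)} (hΓ : DiscreteTopology Γ) {g : ℂ → ℝ}
    (hc : HasCompactSupport g) (hsupp : tsupport g ⊆ upper) {z₀ : ℂ} (hz₀ : z₀ ∈ upper) :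
    ∃ T : Finset (transformations Γ), ∀ᶠ z in 𝓝 z₀, ∀ t ∉ T, g (mob (lift t) z) = 0 := by
  obtain ⟨V, hV, hzV⟩ := exists_compact_mem_nhds (⟨z₀, hz₀⟩ : ℍ)
  have hL : IsCompact (((↑) : ℍ → ℂ) ⁻¹' tsupport g) :=
    UpperHalfPlane.isOpenEmbedding_coe.isEmbedding.isInducing.isCompact_preimage' hc
      (by rw [range_coe_eq_upper]; exact hsupp)
  have hfin := ProperlyDiscontinuousSMul.finite_disjoint_inter_image (Γ := Γ) hV hL
  have hinj : Function.Injective fun t : transformations Γ => (⟨lift t, lift_mem t⟩ : Γ) :=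
    fun s t h => lift_injective (congrArg Subtype.val h)
  have hfin' := hfin.preimage hinj.injOn
  refine ⟨hfin'.toFinset, ?_⟩
  have hmem : ((↑) : ℍ → ℂ) '' V ∈ 𝓝 z₀ :=
    UpperHalfPlane.isOpenEmbedding_coe.image_mem_nhds (x := ⟨z₀, hz₀⟩) |>.2 hzV
  filter_upwards [hmem]
  rintro _ ⟨w, hw, rfl⟩ t ht
  by_contra hne
  apply ht
  rw [Set.Finite.mem_toFinset]
  refine ⟨lift t • w, ⟨w, hw, rfl⟩, ?_⟩
  rw [mem_preimage, ← mob_coe]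
  exact subset_tsupport g hne

lemma contDiffAt_comp_mob {E : Type*} [NormedAddCommGroup E] [NormedSpace ℝ E] {g : ℂ → E}
    (A : SL(2, ℝ)) {z : ℂ} (hz : z ∈ upper) (hg : ContDiffAt ℝ ∞ g (mob A z)) :
    ContDiffAt ℝ ∞ (fun z => g (mob A z)) z :=
  hg.comp z ((contDiffOn_mob A).contDiffAt (isOpen_upper.mem_nhds hz))

lemma integrable_comp_smul {Γ : Subgroup SL(2, ℝ)} (t : transformations Γ) {f : ℍ → ℝ}
    (hf : Integrable f) : Integrable fun z : ℍ => f (t • z) :=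
  (measurePreserving_smul t (volume : Measure ℍ)).integrable_comp_of_integrable hf

/-- Stokes' theorem for an invariant form whose support is compact modulo `Γ`. -/
theorem integral_curl_of_compact_support {Γ : Subgroup SL(2, ℝ)} (hΓ : DiscreteTopology Γ)
    {F : Set ℍ} (hF : IsFundDomain Γ F) {b : ℂ → ℂ} (hb : ContDiffOn ℝ ∞ b upper)
    (hΓb : IsAutomorphic Γ b) {K : Set ℍ} (hK : IsCompact K)
    (hsupp : ∀ z : ℍ, b z ≠ 0 → ∃ γ ∈ Γ, γ • z ∈ K) :
    ∫ z : ℍ in F, z.im ^ 2 * curl b z = 0 := by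
  have hcount := countable_transformations hΓ
  have hK' : IsCompact (((↑) : ℍ → ℂ) '' K) := hK.image UpperHalfPlane.continuous_coe
  obtain ⟨g, hg, hg0, hg1, hgc, hgs⟩ := exists_bump hK' isOpen_upper
    (by rintro _ ⟨z, -, rfl⟩; exact coe_mem_upper z)
  set gt : transformations Γ → ℂ → ℝ := fun t z => g (mob (lift t) z) with hgt
  have hloc : ∀ z₀ ∈ upper, ∃ T : Finset (transformations Γ), ∀ᶠ z in 𝓝 z₀, ∀ t ∉ T, gt t z = 0 :=
    fun z₀ hz₀ => exists_finset_forall_eq_zero hΓ hgc hgs hz₀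
  have hgtsm : ∀ t, ∀ z ∈ upper, ContDiffAt ℝ ∞ (gt t) z := fun t z hz =>
    contDiffAt_comp_mob _ hz hg.contDiffAt
  -- The sum of the translates of the bump is invariant and at least `1` where `b ≠ 0`; dividing by
  -- it gives a partition of unity indexed by the group.
  set G : ℂ → ℝ := fun z => ∑' t, gt t z with hG
  have hGloc : ∀ (T : Finset (transformations Γ)) (z : ℂ), (∀ t ∉ T, gt t z = 0) →
      G z = ∑ t ∈ T, gt t z := fun T z h => tsum_eq_sum h
  have hGsm : ∀ z ∈ upper, ContDiffAt ℝ ∞ G z := by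
    intro z hz
    obtain ⟨T, hT⟩ := hloc z hz
    have : ContDiffAt ℝ ∞ (fun w => ∑ t ∈ T, gt t w) z :=
      ContDiffAt.sum fun t _ => hgtsm t z hz
    exact this.congr_of_eventuallyEq (hT.mono fun w hw => hGloc T w hw)
  have hGinv : ∀ γ ∈ Γ, ∀ z ∈ upper, G (mob γ z) = G z := by
    intro γ hγ z hz
    have hshift : ∀ t, gt t (mob γ z) = gt (Equiv.mulRight (toTransformation γ hγ) t) z := by
      intro t
      have h1 := mob_coe γ ⟨z, hz⟩
      change mob γ z = _ at h1
      have h2 := mob_lift Γ (t * toTransformation γ hγ) ⟨z, hz⟩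
      change mob _ z = _ at h2
      simp only [hgt, Equiv.coe_mulRight]
      rw [h1, h2, mob_lift, mul_smul, toTransformation_smul]
    simp only [hG, hshift]
    exact (Equiv.mulRight (toTransformation γ hγ)).tsum_eq fun t => gt t z
  have hbG : ∀ z ∈ upper, b z ≠ 0 → 1 ≤ G z := by
    intro z hz hbz
    obtain ⟨γ, hγ, hγz⟩ := hsupp ⟨z, hz⟩ hbz
    obtain ⟨T, hT⟩ := hloc z hz
    have hT := hT.self_of_nhds
    have h1 : gt (toTransformation γ hγ) z = 1 := by
      have h2 := mob_lift Γ (toTransformation γ hγ) ⟨z, hz⟩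
      change mob _ z = _ at h2
      simp only [hgt]
      rw [h2, toTransformation_smul]
      exact hg1 _ ⟨_, hγz, rfl⟩
    have hmem : toTransformation γ hγ ∈ T := by
      by_contra h
      rw [hT _ h] at h1
      norm_num at h1
    rw [hGloc T z hT, ← h1]
    exact Finset.single_le_sum (f := fun t => gt t z) (fun t _ => hg0 _) hmem
  set c : ℂ → ℂ := fun z => ((G z)⁻¹ : ℝ) * b z with hc
  have hcsm : ∀ z ∈ upper, ContDiffAt ℝ ∞ c z := by
    intro z hz
    have hbz := hb.contDiffAt (isOpen_upper.mem_nhds hz)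
    by_cases hGz : G z = 0
    -- Where `G` vanishes, `b` is zero nearby, so the default value `0⁻¹ = 0` does no harm.
    · have hlt : ∀ᶠ w in 𝓝 z, G w < 1 :=
        (hGsm z hz).continuousAt.eventually_lt continuousAt_const (by rw [hGz]; norm_num)
      refine (contDiffAt_const (c := (0 : ℂ))).congr_of_eventuallyEq ?_
      filter_upwards [hlt, isOpen_upper.mem_nhds hz] with w hw hwu
      have : b w = 0 := by
        by_contra h
        exact absurd (hbG w hwu h) (not_le.2 hw)
      simp [hc, this]
    · exact (Complex.ofRealCLM.contDiff.contDiffAt.comp z ((hGsm z hz).inv hGz)).mul hbz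
  have hGc : ∀ z ∈ upper, (G z : ℂ) * c z = b z := by
    intro z hz
    by_cases hbz : b z = 0
    · simp [hc, hbz]
    · have : (G z : ℂ) ≠ 0 := by
        have := hbG z hz hbz
        exact_mod_cast (by linarith : G z ≠ 0)
      simp only [hc]
      push_cast
      field_simp
  have hcaut : IsAutomorphic Γ c := by
    intro γ hγ z hz
    simp only [hc]
    rw [hGinv γ hγ z hz, mul_assoc, hΓb γ hγ z hz]
  -- The form `e` has compact support in the half-plane and its translates add up to `b`. Unfolding
  -- turns the integral for `b` over `F` into the integral for `e` over the half-plane, which is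
  -- zero.
  set e : ℂ → ℂ := fun z => (g z : ℂ) * c z with he
  have hesm : ContDiff ℝ ∞ e := by
    rw [contDiff_iff_contDiffAt]
    intro z
    by_cases hz : z ∈ upper
    · exact (Complex.ofRealCLM.contDiff.contDiffAt.comp z hg.contDiffAt).mul (hcsm z hz)
    · refine (contDiffAt_const (c := (0 : ℂ))).congr_of_eventuallyEq ?_
      have h0 : g =ᶠ[𝓝 z] 0 := notMem_tsupport_iff_eventuallyEq.1 fun h => hz (hgs h)
      filter_upwards [h0] with w hw
      simp [he, hw]
  have hesub : Function.support e ⊆ Function.support g := by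
    intro z hz
    rw [Function.mem_support] at hz ⊢
    contrapose! hz
    simp [he, hz]
  have hecs : HasCompactSupport e := hgc.mono hesub
  have hets : tsupport e ⊆ upper := (closure_mono hesub).trans hgs
  obtain ⟨hEint, hE0⟩ := integral_im_sq_mul_curl hesm hecs hets
  have hEt : ∀ (t : transformations Γ) (z : ℍ), (t • z).im ^ 2 * curl e (t • z : ℍ) =
      z.im ^ 2 * curl (fun w => (gt t w : ℂ) * c w) z := by
    intro t z
    have h1 := im_sq_mul_curl_comp (lift t) (b := e) (coe_mem_upper z)
      (hesm.differentiable (by simp) _)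
    rw [mob_lift] at h1
    rw [← UpperHalfPlane.coe_im, ← h1, UpperHalfPlane.coe_im]
    congr 1
    apply curl_congr
    filter_upwards [isOpen_upper.mem_nhds (coe_mem_upper z)] with w hw
    simp only [he, hgt]
    rw [mul_assoc, hcaut _ (lift_mem t) w hw]
  have hsum : ∀ z : ℍ, ∑' t : transformations Γ, (t • z).im ^ 2 * curl e (t • z : ℍ) =
      z.im ^ 2 * curl b z := by
    intro z
    simp_rw [hEt, tsum_mul_left]
    congr 1
    obtain ⟨T, hT⟩ := hloc z (coe_mem_upper z)
    have hz := coe_mem_upper z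
    rw [tsum_eq_sum (s := T), ← curl_sum]
    · apply curl_congr
      filter_upwards [hT, isOpen_upper.mem_nhds hz] with w hw hwu
      rw [← hGc w hwu, hGloc T w hw]
      push_cast
      rw [Finset.sum_mul]
    · intro t _
      exact (Complex.ofRealCLM.differentiableAt.comp _ ((hgtsm t z hz).differentiableAt
        (by simp))).mul ((hcsm z hz).differentiableAt (by simp))
    · intro t ht
      have : (fun w => (gt t w : ℂ) * c w) =ᶠ[𝓝 (z : ℂ)] fun _ => 0 := by
        filter_upwards [hT] with w hw
        simp [hw t ht]
      rw [curl_congr this]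
      simp [curl]
  have hintt : ∀ t : transformations Γ,
      Integrable (fun z : ℍ => (t • z).im ^ 2 * curl e (t • z : ℍ)) := fun t =>
    integrable_comp_smul t (f := fun z : ℍ => z.im ^ 2 * curl e z) hEint
  have hsm : Summable fun t : transformations Γ =>
      ∫ z in F, ‖(t • z).im ^ 2 * curl e (t • z : ℍ)‖ := by
    have h1 := hEint.norm.lintegral_lt_top
    rw [IsFundamentalDomain.lintegral_eq_tsum'' (G := transformations Γ) hF] at h1
    refine (ENNReal.summable_toReal h1.ne).congr fun t => ?_
    rw [integral_eq_lintegral_of_nonneg_ae (Filter.Eventually.of_forall fun _ => norm_nonneg _)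
      (hintt t).norm.aestronglyMeasurable.restrict]
  have h2 := hasSum_integral_of_summable_integral_norm (μ := volume.restrict F)
    (fun t : transformations Γ => (hintt t).restrict) hsm
  simp_rw [hsum] at h2
  rw [← h2.tsum_eq, ← hE0, IsFundamentalDomain.integral_eq_tsum'' (G := transformations Γ) hF _ hEint]

/-- A smooth cutoff that vanishes for `x ≤ 1` and equals `1` for `2 ≤ x`. -/
def cutoff (x : ℝ) : ℝ := Real.smoothTransition (x - 1)

lemma contDiff_cutoff : ContDiff ℝ ∞ cutoff :=
  Real.smoothTransition.contDiff.comp (contDiff_id.sub contDiff_const)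

lemma cutoff_eq_zero {x : ℝ} (hx : x ≤ 1) : cutoff x = 0 :=
  Real.smoothTransition.zero_of_nonpos (by linarith)

lemma cutoff_eq_one {x : ℝ} (hx : 2 ≤ x) : cutoff x = 1 :=
  Real.smoothTransition.one_of_one_le (by linarith)

lemma abs_cutoff_le (x : ℝ) : |cutoff x| ≤ 1 :=
  abs_le.2 ⟨by linarith [show 0 ≤ cutoff x from Real.smoothTransition.nonneg (x - 1)],
    Real.smoothTransition.le_one _⟩

/-- The bound is invariant under scaling of the argument, which makes the gradients of `cutoff (n
f)` bounded uniformly in `n`. -/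
lemma exists_abs_mul_deriv_cutoff_le : ∃ C, 0 ≤ C ∧ ∀ x, |x * deriv cutoff x| ≤ C := by
  have hcont : Continuous fun x : ℝ => |x * deriv cutoff x| :=
    (continuous_id.mul (contDiff_cutoff.continuous_deriv (by simp))).abs
  obtain ⟨C, hC⟩ := (isCompact_Icc (a := (0 : ℝ)) (b := 3)).bddAbove_image hcont.continuousOn
  refine ⟨max C 0, le_max_right _ _, fun x => ?_⟩
  by_cases hx : x ∈ Icc (0 : ℝ) 3
  · exact (hC ⟨x, hx, rfl⟩).trans (le_max_left _ _)
  · have h0 : deriv cutoff x = 0 := by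
      rw [mem_Icc, not_and_or, not_le, not_le] at hx
      rcases hx with hx | hx
      · have : cutoff =ᶠ[𝓝 x] fun _ => 0 := by
          filter_upwards [gt_mem_nhds hx] with y hy using cutoff_eq_zero (by linarith)
        rw [this.deriv_eq, deriv_const]
      · have : cutoff =ᶠ[𝓝 x] fun _ => 1 := by
          filter_upwards [lt_mem_nhds hx] with y hy using cutoff_eq_one (by linarith)
        rw [this.deriv_eq, deriv_const]
    simp [h0]

lemma continuous_curl_upperHalfPlane {b : ℂ → ℂ} (hb : ContDiffOn ℝ ∞ b upper) :
    Continuous fun z : ℍ => z.im ^ 2 * curl b z := by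
  have h1 : Continuous fun z : ℍ => curl b z :=
    (continuousOn_curl isOpen_upper hb).comp_continuous UpperHalfPlane.continuous_coe coe_mem_upper
  exact (UpperHalfPlane.continuous_im.pow 2).mul h1

/-- Stokes' theorem on a quotient of finite area, for an invariant form `Re (B dz)` that is bounded
and has bounded differential, given an exhaustion function `1 / f` with `log f` Lipschitz. -/
theorem integral_curl_eq_zero_of_bounded {Γ : Subgroup SL(2, ℝ)} (hΓ : DiscreteTopology Γ)
    {F : Set ℍ} (hF : IsFundDomain Γ F) (hvol : volume F < ⊤) {f : ℂ → ℝ} {B : ℂ → ℂ}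
    (hf : ContDiffOn ℝ ∞ f upper) (hfΓ : ∀ γ ∈ Γ, ∀ z ∈ upper, f (mob γ z) = f z)
    (hf0 : ∀ z ∈ upper, 0 < f z)
    (hcpt : ∀ ε > 0, ∃ K : Set ℍ, IsCompact K ∧ ∀ z : ℍ, ε ≤ f z → ∃ γ ∈ Γ, γ • z ∈ K)
    (hB : ContDiffOn ℝ ∞ B upper) (hBΓ : IsAutomorphic Γ B) {M : ℝ}
    (hfM : ∀ z ∈ upper, z.im * ‖fderiv ℝ f z‖ ≤ M * f z)
    (hBM : ∀ z ∈ upper, z.im * ‖B z‖ ≤ M)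
    (hcurl : ∀ z ∈ upper, |z.im ^ 2 * curl B z| ≤ M) :
    ∫ z : ℍ in F, z.im ^ 2 * curl B z = 0 := by
  obtain ⟨C, hC0, hC⟩ := exists_abs_mul_deriv_cutoff_le
  have hM0 : 0 ≤ M := (abs_nonneg _).trans (hcurl Complex.I (by simp [upper]))
  -- The function `χ n` vanishes where `f ≤ 1 / n` and equals `1` where `n f ≥ 2`, so it has compact
  -- support modulo `Γ` and tends to `1` pointwise.
  set χ : ℕ → ℂ → ℝ := fun n z => cutoff (n * f z) with hχ
  have hfat : ∀ z ∈ upper, ContDiffAt ℝ ∞ f z := fun z hz =>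
    hf.contDiffAt (isOpen_upper.mem_nhds hz)
  have hχat : ∀ n, ∀ z ∈ upper, ContDiffAt ℝ ∞ (χ n) z := fun n z hz =>
    contDiff_cutoff.contDiffAt.comp z (contDiffAt_const.mul (hfat z hz))
  have hBat : ∀ z ∈ upper, ContDiffAt ℝ ∞ B z := fun z hz =>
    hB.contDiffAt (isOpen_upper.mem_nhds hz)
  have hsm : ∀ n, ContDiffOn ℝ ∞ (fun z => (χ n z : ℂ) * B z) upper := fun n z hz =>
    ((Complex.ofRealCLM.contDiff.contDiffAt.comp z (hχat n z hz)).mul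
      (hBat z hz)).contDiffWithinAt
  have hzero : ∀ n, ∫ z : ℍ in F, z.im ^ 2 * curl (fun z => (χ n z : ℂ) * B z) z = 0 := by
    intro n
    rcases Nat.eq_zero_or_pos n with rfl | hn
    · have : ∀ z : ℍ, curl (fun z => (χ 0 z : ℂ) * B z) z = 0 := by
        intro z
        have : (fun z => (χ 0 z : ℂ) * B z) = fun _ => 0 := by
          funext z; simp [hχ, cutoff_eq_zero]
        rw [this]; simp [curl]
      simp [this]
    obtain ⟨K, hK, hKs⟩ := hcpt (1 / n) (by positivity)
    refine integral_curl_of_compact_support hΓ hF (hsm n) ?_ hK fun z hz => hKs z ?_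
    · intro γ hγ z hz
      simp only [hχ]
      rw [hfΓ γ hγ z hz, mul_assoc, hBΓ γ hγ z hz]
    · by_contra h
      apply hz
      have : (n : ℝ) * f z ≤ 1 := by
        rw [not_le, lt_div_iff₀ (by positivity)] at h
        linarith
      simp [hχ, cutoff_eq_zero this]
  -- As `y |df| ≤ M f`, the factor `n` is absorbed into `n f |cutoff' (n f)| ≤ C`.
  have hderiv : ∀ n, ∀ z ∈ upper, z.im * ‖fderiv ℝ (χ n) z‖ ≤ C * M := by
    intro n z hz
    have h1 : HasFDerivAt (fun z => (n : ℝ) * f z) ((n : ℝ) • fderiv ℝ f z) z :=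
      ((hfat z hz).differentiableAt (by simp)).hasFDerivAt.const_mul _
    have h2 : HasDerivAt cutoff (deriv cutoff (n * f z)) (n * f z) :=
      (contDiff_cutoff.differentiable (by simp) _).hasDerivAt
    have h3 : HasFDerivAt (χ n) (deriv cutoff (n * f z) • (n : ℝ) • fderiv ℝ f z) z :=
      HasDerivAt.comp_hasFDerivAt (h₂ := cutoff) (f := fun z => (n : ℝ) * f z) z h2 h1
    rw [h3.fderiv, norm_smul, norm_smul, Real.norm_eq_abs, Real.norm_natCast]
    have h4 := hC (n * f z)
    rw [abs_mul, abs_of_nonneg (mul_nonneg n.cast_nonneg (hf0 z hz).le)] at h4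
    calc z.im * (|deriv cutoff (n * f z)| * (n * ‖fderiv ℝ f z‖))
        = |deriv cutoff (n * f z)| * n * (z.im * ‖fderiv ℝ f z‖) := by ring
      _ ≤ |deriv cutoff (n * f z)| * n * (M * f z) := by
          exact mul_le_mul_of_nonneg_left (hfM z hz) (by positivity)
      _ = n * f z * |deriv cutoff (n * f z)| * M := by ring
      _ ≤ C * M := by gcongr
  have hbound : ∀ n, ∀ z : ℍ,
      ‖z.im ^ 2 * curl (fun z => (χ n z : ℂ) * B z) z‖ ≤ M + 2 * (C * M) * M := by
    intro n z
    have hz := coe_mem_upper z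
    have hzim : 0 < z.im := z.im_pos
    rw [curl_ofReal_mul ((hχat n _ hz).differentiableAt (by simp))
      ((hBat _ hz).differentiableAt (by simp)), Real.norm_eq_abs]
    have h1 := hcurl z hz
    have h2 := hderiv n z hz
    have h3 := hBM z hz
    rw [UpperHalfPlane.coe_im] at h1 h2 h3
    have h4 : |fderiv ℝ (χ n) z 1| ≤ ‖fderiv ℝ (χ n) z‖ := by
      simpa using (fderiv ℝ (χ n) z).le_opNorm 1
    have h5 : |fderiv ℝ (χ n) z Complex.I| ≤ ‖fderiv ℝ (χ n) z‖ := by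
      simpa using (fderiv ℝ (χ n) z).le_opNorm Complex.I
    have h6 : |χ n z * (z.im ^ 2 * curl B z)| ≤ M := by
      rw [abs_mul]
      calc _ ≤ 1 * M := mul_le_mul (abs_cutoff_le _) h1 (abs_nonneg _) zero_le_one
        _ = M := one_mul M
    have h7 : |fderiv ℝ (χ n) z 1 * (B z).im + fderiv ℝ (χ n) z Complex.I * (B z).re| ≤
        2 * (‖fderiv ℝ (χ n) z‖ * ‖B z‖) := by
      refine (abs_add_le _ _).trans ?_
      rw [abs_mul, abs_mul]
      have := mul_le_mul h4 (Complex.abs_im_le_norm (B z)) (abs_nonneg _) (norm_nonneg _)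
      have := mul_le_mul h5 (Complex.abs_re_le_norm (B z)) (abs_nonneg _) (norm_nonneg _)
      linarith
    have h8 : z.im ^ 2 * (2 * (‖fderiv ℝ (χ n) z‖ * ‖B z‖)) ≤ 2 * (C * M) * M := by
      calc _ = 2 * ((z.im * ‖fderiv ℝ (χ n) z‖) * (z.im * ‖B z‖)) := by ring
        _ ≤ 2 * ((C * M) * M) := by gcongr
        _ = _ := by ring
    rw [mul_sub]
    refine (abs_sub _ _).trans (add_le_add ?_ ?_)
    · rw [mul_left_comm]; exact h6
    · rw [abs_mul, abs_of_nonneg (by positivity)]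
      exact (mul_le_mul_of_nonneg_left h7 (by positivity)).trans h8
  have hlim : ∀ z : ℍ, Filter.Tendsto
      (fun n : ℕ => z.im ^ 2 * curl (fun z => (χ n z : ℂ) * B z) z) Filter.atTop
      (𝓝 (z.im ^ 2 * curl B z)) := by
    intro z
    have hz := coe_mem_upper z
    obtain ⟨N, hN⟩ := exists_nat_gt (2 / f z)
    refine tendsto_const_nhds.congr' ?_
    filter_upwards [Filter.eventually_ge_atTop N] with n hn
    congr 1
    apply curl_congr
    have h1 : 2 < (n : ℝ) * f z := by
      rw [div_lt_iff₀ (hf0 z hz)] at hN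
      have : (N : ℝ) ≤ n := by exact_mod_cast hn
      nlinarith [hf0 z hz]
    have h2 : ∀ᶠ w in 𝓝 (z : ℂ), 2 < (n : ℝ) * f w :=
      (continuousAt_const.mul (hfat z hz).continuousAt).eventually_const_lt h1
    filter_upwards [h2] with w hw
    simp [hχ, cutoff_eq_one hw.le]
  -- Finite area makes the uniform bound an integrable majorant.
  have : IsFiniteMeasure ((volume : Measure ℍ).restrict F) :=
    ⟨by rwa [Measure.restrict_apply_univ]⟩
  have h := tendsto_integral_of_dominated_convergence (μ := (volume : Measure ℍ).restrict F)
    (fun _ => M + 2 * (C * M) * M)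
    (fun n => (continuous_curl_upperHalfPlane (hsm n)).aestronglyMeasurable)
    (integrable_const _) (fun n => .of_forall (hbound n)) (.of_forall hlim)
  simp_rw [hzero] at h
  exact (tendsto_nhds_unique h tendsto_const_nhds)

/-! ### The transverse measure -/

lemma volume_ker_eq_zero (L : ℂ →ₗ[ℝ] ℝ) (hL : L ≠ 0) : volume {z : ℂ | L z = 0} = 0 := by
  have := Measure.addHaar_submodule (volume : Measure ℂ) (LinearMap.ker L)
    (fun h => hL (LinearMap.ker_eq_top.1 h))
  exact this

lemma ae_im_ne_zero : ∀ᵐ z : ℂ, z.im ≠ 0 := by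
  rw [ae_iff]
  simpa using volume_ker_eq_zero Complex.imLm (fun h => by
    simpa using LinearMap.congr_fun h Complex.I)

lemma ae_re_ne_zero : ∀ᵐ z : ℂ, z.re ≠ 0 := by
  rw [ae_iff]
  simpa using volume_ker_eq_zero Complex.reLm (fun h => by
    simpa using LinearMap.congr_fun h 1)

lemma det_restrictScalars_toSpanSingleton (c : ℂ) :
    ((ContinuousLinearMap.toSpanSingleton ℂ c).restrictScalars ℝ : ℂ →L[ℝ] ℂ).det = ‖c‖ ^ 2 := by
  rw [ContinuousLinearMap.det, ← LinearMap.det_toMatrix Complex.basisOneI, Matrix.det_fin_two]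
  simp [LinearMap.toMatrix_apply, ← Complex.normSq_eq_norm_sq, Complex.normSq_apply]

lemma image_sq_re_pos : (fun a : ℂ => a ^ 2) '' {a | 0 < a.re} = Complex.slitPlane := by
  ext q
  constructor
  · rintro ⟨a, ha, rfl⟩
    rw [Complex.mem_slitPlane_iff]
    simp only [sq, Complex.mul_re, Complex.mul_im]
    have ha : 0 < a.re := ha
    by_cases h : a.im = 0
    · left; rw [h]; nlinarith
    · right
      have := mul_ne_zero ha.ne' h
      contrapose! this
      linarith
  · intro hq
    refine ⟨q ^ (1 / 2 : ℂ), ?_, ?_⟩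
    · have hq0 := Complex.slitPlane_ne_zero hq
      have harg := Complex.mem_slitPlane_iff_arg.1 hq
      have h1 : ((1 / 2 : ℂ)) = ((1 / 2 : ℝ) : ℂ) := by push_cast; rfl
      rw [mem_ofPred_eq, h1, Complex.cpow_ofReal_re]
      have h2 := Complex.neg_pi_lt_arg q
      have h3 : q.arg < Real.pi := lt_of_le_of_ne (Complex.arg_le_pi q) harg.1
      refine mul_pos (Real.rpow_pos_of_pos (norm_pos_iff.2 hq0) _) (Real.cos_pos_of_mem_Ioo ?_)
      constructor <;> linarith
    · simp only
      rw [← Complex.cpow_nat_mul]; simp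

lemma injOn_sq_re_pos : InjOn (fun a : ℂ => a ^ 2) {a | 0 < a.re} := by
  intro a ha b hb hab
  have ha : 0 < a.re := ha
  have hb : 0 < b.re := hb
  rcases sq_eq_sq_iff_eq_or_eq_neg.1 hab with h | h
  · exact h
  · rw [h, Complex.neg_re] at ha
    linarith

/-- The transverse measure is the area of the flat plane under the squaring map. -/
theorem transverseMeasure_eq_map :
    transverseMeasure = (volume : Measure ℂ).map fun a => a ^ 2 := by
  refine Measure.ext_of_lintegral _ fun g hg => ?_
  have hsq : Measurable fun a : ℂ => a ^ 2 := by fun_prop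
  have hden : Measurable fun z : ℂ => ENNReal.ofReal (1 / (2 * ‖z‖)) := by fun_prop
  rw [transverseMeasure, lintegral_withDensity_eq_lintegral_mul _ hden hg, lintegral_map hg hsq]
  have hslit : (volume : Measure ℂ).restrict Complex.slitPlane = volume := by
    refine Measure.restrict_eq_self_of_ae_mem ?_
    filter_upwards [ae_im_ne_zero] with z hz using Complex.mem_slitPlane_iff.2 (Or.inr hz)
  have hUm : MeasurableSet {a : ℂ | 0 < a.re} :=
    (isOpen_lt continuous_const Complex.continuous_re).measurableSet
  -- The right half-plane maps bijectively onto the slit plane. The Jacobian `4 |a| ^ 2` times the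
  -- density `1 / (2 |a| ^ 2)` is `2`, which accounts for the two half-planes.
  have h1 := lintegral_image_eq_lintegral_abs_det_fderiv_mul (volume : Measure ℂ) hUm
    (f := fun a : ℂ => a ^ 2)
    (f' := fun a => (ContinuousLinearMap.toSpanSingleton ℂ (2 * a)).restrictScalars ℝ)
    (fun a _ => by
      have h : HasDerivAt (fun a : ℂ => a ^ 2) (2 * a) a := by simpa using hasDerivAt_pow 2 a
      exact (h.hasFDerivAt.restrictScalars ℝ).hasFDerivWithinAt)
    injOn_sq_re_pos (fun z : ℂ => ENNReal.ofReal (1 / (2 * ‖z‖)) * g z)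
  rw [image_sq_re_pos, hslit] at h1
  have h2 : ∫⁻ a in {a : ℂ | a.re < 0}, g (a ^ 2) = ∫⁻ a in {a : ℂ | 0 < a.re}, g (a ^ 2) := by
    have := (Measure.measurePreserving_neg (volume : Measure ℂ)).setLIntegral_comp_preimage hUm
      (f := fun a => g (a ^ 2)) (hg.comp hsq)
    rw [← this]
    simp [Set.preimage]
  have h3 : ∫⁻ a : ℂ, g (a ^ 2) = (∫⁻ a in {a : ℂ | 0 < a.re}, g (a ^ 2)) +
      ∫⁻ a in {a : ℂ | a.re < 0}, g (a ^ 2) := by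
    rw [← lintegral_add_compl _ hUm]
    refine congrArg₂ (· + ·) rfl (setLIntegral_congr ?_)
    filter_upwards [ae_re_ne_zero] with a ha
    exact propext (Iff.trans (not_lt (a := (0 : ℝ)) (b := a.re))
      ⟨fun h => lt_of_le_of_ne h ha, fun h => le_of_lt h⟩)
  simp only [Pi.mul_apply]
  rw [h1, h3, h2, ← two_mul, ← lintegral_const_mul _ (show Measurable fun a => g (a ^ 2) from hg.comp hsq)]
  refine setLIntegral_congr_fun hUm fun a ha => ?_
  have ha0 : ‖a‖ ≠ 0 := by
    rw [norm_ne_zero_iff]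
    rintro rfl
    simp at ha
  rw [← mul_assoc, det_restrictScalars_toSpanSingleton, ← ENNReal.ofReal_mul (by positivity)]
  congr 1
  rw [abs_of_nonneg (by positivity), norm_mul, norm_pow]
  rw [← ENNReal.ofReal_ofNat 2]
  congr 1
  simp
  field_simp

instance : SFinite transverseMeasure := by
  rw [transverseMeasure]; infer_instance

/-- The linear map `u + i v ↦ u + z v`. -/
def shear (z : ℂ) : ℂ →L[ℝ] ℂ := Complex.reCLM.smulRight (1 : ℂ) + Complex.imCLM.smulRight z

lemma shear_apply (z a : ℂ) : shear z a = a.re + z * a.im := by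
  simp [shear, mul_comm]

lemma det_shear (z : ℂ) : LinearMap.det (shear z : ℂ →ₗ[ℝ] ℂ) = z.im := by
  rw [← LinearMap.det_toMatrix Complex.basisOneI, Matrix.det_fin_two]
  simp [LinearMap.toMatrix_apply, shear_apply]

lemma Phi_sq' (z a : ℂ) : Phi z (a ^ 2) = (z, shear z a ^ 2) := by
  conv_lhs => rw [← Complex.re_add_im a, mul_comm _ Complex.I, Phi_sq]
  rw [shear_apply]

/-- The transverse measure in the fiber over `z`. -/
theorem map_Phi_transverseMeasure {z : ℂ} (hz : z ∈ upper) :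
    transverseMeasure.map (fun q => (Phi z q).2) =
      ENNReal.ofReal (1 / z.im) • transverseMeasure := by
  have hm : Measurable fun q => (Phi z q).2 := by
    unfold Phi; fun_prop
  have hsq : Measurable fun a : ℂ => a ^ 2 := by fun_prop
  have hz' : 0 < z.im := hz
  -- On square roots `Φ(z, ·)` is the linear map `shear z`, of determinant `Im z`.
  have hmap : (volume : Measure ℂ).map (shear z) = ENNReal.ofReal (1 / z.im) • volume := by
    have := Measure.map_linearMap_addHaar_eq_smul_addHaar (volume : Measure ℂ)
      (f := (shear z : ℂ →ₗ[ℝ] ℂ)) (by rw [det_shear]; exact hz'.ne')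
    rw [det_shear, abs_of_pos (inv_pos.2 hz'), inv_eq_one_div] at this
    exact this
  rw [transverseMeasure_eq_map, Measure.map_map hm hsq, ← Measure.map_smul, ← hmap,
    Measure.map_map hsq (shear z).continuous.measurable]
  congr 1
  funext a
  simp only [Function.comp_apply]
  rw [Phi_sq']

section

/-! ### Integrals over the fibers -/

lemma measurable_transverse_density :
    Measurable fun z : ℂ => ENNReal.ofReal (1 / (2 * ‖z‖)) := by fun_prop

lemma integral_transverseMeasure (G : ℂ → ℝ) :
    ∫ p, G p ∂transverseMeasure = ∫ p : ℂ, 1 / (2 * ‖p‖) * G p := by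
  rw [transverseMeasure, integral_withDensity_eq_integral_toReal_smul
    measurable_transverse_density (.of_forall fun _ => ENNReal.ofReal_lt_top)]
  refine integral_congr_ae (.of_forall fun p => ?_)
  simp only [smul_eq_mul]
  rw [ENNReal.toReal_ofReal (by positivity)]

lemma integrable_transverseMeasure_iff (G : ℂ → ℝ) :
    Integrable G transverseMeasure ↔ Integrable fun p : ℂ => 1 / (2 * ‖p‖) * G p := by
  rw [transverseMeasure, integrable_withDensity_iff_integrable_smul'
    measurable_transverse_density (.of_forall fun _ => ENNReal.ofReal_lt_top)]
  refine integrable_congr (.of_forall fun p => ?_)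
  simp only [smul_eq_mul]
  rw [ENNReal.toReal_ofReal (by positivity)]

lemma integrable_radial {g : ℝ → ℝ} (hg : IntegrableOn g (Ioi 0)) {c : ℝ} (hc : 0 < c) :
    Integrable (fun p : ℂ => g (‖p‖ * c)) transverseMeasure := by
  rw [integrable_transverseMeasure_iff]
  refine (integrable_fun_norm_addHaar (volume : Measure ℂ)
    (f := fun s => 1 / (2 * s) * g (s * c))).2 ?_
  have h1 : IntegrableOn (fun s => g (s * c)) (Ioi 0) :=
    (integrableOn_Ioi_comp_mul_right_iff g 0 hc).2 (by rwa [zero_mul])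
  refine IntegrableOn.congr_fun (f := fun s => 1 / 2 * g (s * c)) (h1.const_mul (1 / 2)) (fun s hs => ?_) measurableSet_Ioi
  have hs : s ≠ 0 := ne_of_gt hs
  simp [Complex.finrank_real_complex]
  field_simp

/-- In polar coordinates the density `1 / (2 s)` cancels the factor `s` of the area element, so
radial functions are integrated against `π ds`. -/
lemma integral_radial (g : ℝ → ℝ) {c : ℝ} (hc : 0 < c) :
    ∫ p : ℂ, g (‖p‖ * c) ∂transverseMeasure = Real.pi / c * ∫ s in Ioi 0, g s := by
  rw [integral_transverseMeasure]
  rw [integral_fun_norm_addHaar (volume : Measure ℂ) fun s => 1 / (2 * s) * g (s * c)]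
  have h1 : ∫ s in Ioi (0 : ℝ), s ^ (Module.finrank ℝ ℂ - 1) • (1 / (2 * s) * g (s * c)) =
      1 / 2 * (c⁻¹ * ∫ s in Ioi 0, g s) := by
    have h2 := integral_comp_mul_right_Ioi g 0 hc
    rw [zero_mul, smul_eq_mul] at h2
    rw [← h2, ← integral_const_mul]
    refine setIntegral_congr_fun measurableSet_Ioi fun s hs => ?_
    have hs : s ≠ 0 := ne_of_gt hs
    simp [Complex.finrank_real_complex]
    field_simp
  rw [h1, Complex.finrank_real_complex, Measure.real, Complex.volume_ball]
  simp
  field_simp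

lemma integral_odd {G : ℂ → ℝ} (hG : ∀ p, G (-p) = -G p) :
    ∫ p, G p ∂transverseMeasure = 0 := by
  rw [integral_transverseMeasure]
  have h := integral_neg_eq_self (fun p : ℂ => 1 / (2 * ‖p‖) * G p) volume
  simp only [norm_neg, hG, mul_neg, integral_neg] at h
  linarith

variable {ρ : ℝ → ℝ}

lemma integrable_bump (hρ : ContDiff ℝ ∞ ρ) (hc : HasCompactSupport ρ) : Integrable ρ :=
  hρ.continuous.integrable_of_hasCompactSupport hc

lemma integrable_deriv_mul (hρ : ContDiff ℝ ∞ ρ) (hc : HasCompactSupport ρ) :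
    Integrable fun r => deriv ρ r * r :=
  ((hρ.continuous_deriv (by simp)).mul continuous_id).integrable_of_hasCompactSupport
    (hc.deriv.mul_right)

/-- The boundary terms of the integration by parts vanish because of the factor `r` at `0` and the
compact support at infinity. -/
lemma integral_deriv_mul (hρ : ContDiff ℝ ∞ ρ) (hc : HasCompactSupport ρ) :
    ∫ r in Ioi 0, deriv ρ r * r = -∫ r in Ioi 0, ρ r := by
  have h := integral_Ioi_of_hasDerivAt_of_tendsto' (f := fun r => ρ r * r)
    (f' := fun r => deriv ρ r * r + ρ r) (a := 0) (m := 0) ?_ ?_ ?_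
  · rw [integral_add (integrable_deriv_mul hρ hc).integrableOn
      (integrable_bump hρ hc).integrableOn] at h
    linarith
  · intro x _
    have h1 : HasDerivAt ρ (deriv ρ x) x := (hρ.differentiable (by simp) x).hasDerivAt
    simpa using h1.fun_mul (hasDerivAt_id' x)
  · exact ((integrable_deriv_mul hρ hc).add (integrable_bump hρ hc)).integrableOn
  · have h1 : ρ =ᶠ[Filter.cocompact ℝ] 0 := by
      rw [← Filter.coclosedCompact_eq_cocompact]
      exact hasCompactSupport_iff_eventuallyEq.1 hc
    have h2 : ρ =ᶠ[Filter.atTop] 0 := h1.filter_mono atTop_le_cocompact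
    refine tendsto_const_nhds.congr' ?_
    filter_upwards [h2] with r hr
    simp [hr]

/-- The integrand on the fiber, at the vector `p`, in terms of `r = c ‖p‖`. -/
def fiberDensity (ρ : ℝ → ℝ) (c A C : ℝ) (k : ℂ) (p : ℂ) : ℝ :=
  deriv ρ (‖p‖ * c) * (‖p‖ * c) * (A + (k * (starRingEnd ℂ p / ‖p‖)).re) + ρ (‖p‖ * c) * C

lemma norm_phase_le (p : ℂ) : ‖starRingEnd ℂ p / (‖p‖ : ℂ)‖ ≤ 1 := by
  rw [norm_div, RCLike.norm_conj, Complex.norm_real, norm_norm]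
  exact div_self_le_one _

lemma abs_phase_le (k p : ℂ) : |(k * (starRingEnd ℂ p / ‖p‖)).re| ≤ ‖k‖ := by
  refine (Complex.abs_re_le_norm _).trans ?_
  rw [norm_mul]
  exact mul_le_of_le_one_right (norm_nonneg _) (norm_phase_le p)

/-- The phase term is odd under `p ↦ -p` and drops out, while `r ρ'` integrates to minus the
integral of `ρ`; this produces the difference `C - A`. -/
lemma integral_fiberDensity (hρ : ContDiff ℝ ∞ ρ) (hc : HasCompactSupport ρ) {c : ℝ} (h0 : 0 < c)
    (A C : ℝ) (k : ℂ) :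
    ∫ p, fiberDensity ρ c A C k p ∂transverseMeasure =
      Real.pi / c * (C - A) * ∫ r in Ioi 0, ρ r := by
  have h1 := integrable_radial (integrable_deriv_mul hρ hc).integrableOn h0
  have h2 := integrable_radial (integrable_bump hρ hc).integrableOn h0
  have h3 : Integrable (fun p : ℂ => deriv ρ (‖p‖ * c) * (‖p‖ * c) *
      (k * (starRingEnd ℂ p / ‖p‖)).re) transverseMeasure := by
    refine h1.mul_bdd (c := ‖k‖) ?_ (.of_forall fun p => abs_phase_le k p)
    exact Measurable.aestronglyMeasurable (by fun_prop)
  have h4 : ∫ p : ℂ, deriv ρ (‖p‖ * c) * (‖p‖ * c) * (k * (starRingEnd ℂ p / ‖p‖)).re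
      ∂transverseMeasure = 0 := by
    refine integral_odd fun p => ?_
    simp only [norm_neg, map_neg, neg_div, mul_neg, Complex.neg_re]
  have h5 : ∀ p : ℂ, fiberDensity ρ c A C k p = (deriv ρ (‖p‖ * c) * (‖p‖ * c) * A +
      deriv ρ (‖p‖ * c) * (‖p‖ * c) * (k * (starRingEnd ℂ p / ‖p‖)).re) + ρ (‖p‖ * c) * C :=
    fun p => by rw [fiberDensity]; ring
  simp_rw [h5]
  rw [integral_add ((h1.mul_const A).fun_add h3) (h2.mul_const C), integral_add (h1.mul_const A) h3,
    h4, integral_mul_const, integral_mul_const,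
    integral_radial (fun r => deriv ρ r * r) h0, integral_radial ρ h0, integral_deriv_mul hρ hc]
  ring

lemma abs_fiberDensity_le {c A C M : ℝ} {k : ℂ} (p : ℂ) (hA : |A| ≤ M)
    (hC : |C| ≤ M) (hk : ‖k‖ ≤ M) :
    |fiberDensity ρ c A C k p| ≤
      2 * M * |deriv ρ (‖p‖ * c) * (‖p‖ * c)| + M * |ρ (‖p‖ * c)| := by
  rw [fiberDensity]
  refine (abs_add_le _ _).trans (add_le_add ?_ ?_)
  · rw [abs_mul, mul_comm]
    refine mul_le_mul_of_nonneg_right ?_ (abs_nonneg _)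
    refine (abs_add_le _ _).trans ?_
    linarith [(abs_phase_le k p).trans hk]
  · rw [abs_mul, mul_comm]
    exact mul_le_mul_of_nonneg_right hC (abs_nonneg _)

lemma integral_comp_Phi {z : ℂ} (hz : z ∈ upper) {G : ℂ → ℝ} (hG : Measurable G) :
    ∫ q, G (Phi z q).2 ∂transverseMeasure = 1 / z.im * ∫ p, G p ∂transverseMeasure := by
  have hm : Measurable fun q => (Phi z q).2 := by
    unfold Phi; fun_prop
  have hz' : 0 < z.im := hz
  rw [← integral_map hm.aemeasurable (f := G) hG.aestronglyMeasurable,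
    map_Phi_transverseMeasure hz, integral_smul_measure, ENNReal.toReal_ofReal (by positivity),
    smul_eq_mul]

lemma integrable_comp_Phi {z : ℂ} (hz : z ∈ upper) {G : ℂ → ℝ} (hG : Measurable G)
    (hi : Integrable G transverseMeasure) :
    Integrable (fun q => G (Phi z q).2) transverseMeasure := by
  have hm : Measurable fun q => (Phi z q).2 := by
    unfold Phi; fun_prop
  refine (integrable_map_measure (g := G) hG.aestronglyMeasurable hm.aemeasurable).1 ?_
  rw [map_Phi_transverseMeasure hz]
  exact hi.smul_measure ENNReal.ofReal_ne_top

end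

/-! ### One-forms on the plane and their coefficients -/

/-- A linear form as an alternating form. -/
def oneForm (E : Type*) [NormedAddCommGroup E] [NormedSpace ℝ E] :
    (E →L[ℝ] ℝ) ≃ₗᵢ[ℝ] (E [⋀^Fin 1]→L[ℝ] ℝ) :=
  ContinuousAlternatingMap.ofSubsingletonLIE (0 : Fin 1)

lemma oneForm_apply {E : Type*} [NormedAddCommGroup E] [NormedSpace ℝ E] (L : E →L[ℝ] ℝ)
    (v : Fin 1 → E) : oneForm E L v = L (v 0) := rfl

/-- The form `Re (b dz)`. -/
def formOf (b : ℂ → ℂ) : Form ℂ 1 := fun z =>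
  oneForm ℂ
    ((b z).re • Complex.reCLM - (b z).im • Complex.imCLM)

/-- The function `b` with `α = Re (b dz)`. -/
def coeff (α : Form ℂ 1) (z : ℂ) : ℂ := α z ![1] - Complex.I * α z ![Complex.I]

lemma formOf_apply (b : ℂ → ℂ) (z : ℂ) (v : Fin 1 → ℂ) : formOf b z v = (b z * v 0).re := by
  simp [formOf, oneForm_apply, Complex.mul_re]

lemma ofSubsingleton_symm_apply (α : ℂ [⋀^Fin 1]→L[ℝ] ℝ) (v : Fin 1 → ℂ) :
    α v = (v 0).re * α ![1] + (v 0).im * α ![Complex.I] := by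
  obtain ⟨L, rfl⟩ := (oneForm ℂ).surjective α
  have : L (v 0) = (v 0).re * L 1 + (v 0).im * L Complex.I := by
    conv_lhs => rw [← Complex.re_add_im (v 0), ← mul_one ((v 0).re : ℂ), ← Complex.real_smul,
      ← Complex.real_smul, map_add, map_smul, map_smul]
    simp
  simpa [oneForm_apply] using this

lemma apply_eq_coeff (α : Form ℂ 1) (z : ℂ) (v : Fin 1 → ℂ) :
    α z v = (coeff α z * v 0).re := by
  rw [ofSubsingleton_symm_apply, coeff]
  simp
  ring

lemma contDiffOn_coeff {α : Form ℂ 1} {U : Set ℂ} (hα : ContDiffOn ℝ ∞ α U) :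
    ContDiffOn ℝ ∞ (coeff α) U := by
  have h : ∀ v : Fin 1 → ℂ, ContDiffOn ℝ ∞ (fun z => ((α z v : ℝ) : ℂ)) U := fun v =>
    (Complex.ofRealCLM ∘L ContinuousAlternatingMap.apply ℝ ℂ ℝ v).contDiff.comp_contDiffOn hα
  exact (h _).sub (contDiffOn_const.mul (h _))

lemma differentiableAt_formOf {b : ℂ → ℂ} {z : ℂ} (hb : DifferentiableAt ℝ b z) :
    DifferentiableAt ℝ (formOf b) z := by
  unfold formOf
  refine (oneForm ℂ).differentiable
    |>.differentiableAt.comp z ?_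
  have h1 : DifferentiableAt ℝ (fun z => (b z).re) z :=
    Complex.reCLM.differentiableAt.comp z hb
  have h2 : DifferentiableAt ℝ (fun z => (b z).im) z :=
    Complex.imCLM.differentiableAt.comp z hb
  exact (h1.smul_const _).sub (h2.smul_const _)

lemma extDeriv_formOf {b : ℂ → ℂ} {z : ℂ} (hb : DifferentiableAt ℝ b z) (y : ℝ) :
    extDeriv (formOf b) z ![(y : ℂ), y * Complex.I] = y ^ 2 * curl b z := by
  have hfd : ∀ c : ℂ, ∀ w, fderiv ℝ (fun z => (b z * c).re) z w = (fderiv ℝ b z w * c).re := by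
    intro c w
    have h1 : HasFDerivAt (fun z => (b z * c).re)
        (Complex.reCLM ∘L ((ContinuousLinearMap.mul ℝ ℂ).flip c ∘L fderiv ℝ b z)) z :=
      Complex.reCLM.hasFDerivAt.comp z
        (((ContinuousLinearMap.mul ℝ ℂ).flip c).hasFDerivAt.comp z hb.hasFDerivAt)
    rw [h1.fderiv]
    simp
    ring
  have hsm : ∀ c : ℂ, fderiv ℝ b z (y * c) = y * fderiv ℝ b z c := by
    intro c
    rw [← Complex.real_smul, map_smul, Complex.real_smul]
  have hy1 : fderiv ℝ b z (y : ℂ) = y * fderiv ℝ b z 1 := by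
    rw [← hsm, mul_one]
  rw [extDeriv_apply (differentiableAt_formOf hb)]
  simp only [formOf_apply, hfd]
  simp [Fin.removeNth, hsm, hy1, curl]
  ring

section

/-! ### The restriction of the Thom form to a leaf -/

/-- The point `(w, (u + w v)²)` of the leaf through `(u, v)`. -/
def leaf (u v : ℝ) (w : ℂ) : ℂ × ℂ := (w, ((u : ℂ) + w * v) ^ 2)

lemma hasFDerivAt_leaf (u v : ℝ) (w : ℂ) :
    HasFDerivAt (leaf u v) ((ContinuousLinearMap.id ℝ ℂ).prod
      ((ContinuousLinearMap.toSpanSingleton ℂ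
        (2 * ((u : ℂ) + w * v) * v)).restrictScalars ℝ)) w := by
  have h1 : HasDerivAt (fun w : ℂ => ((u : ℂ) + w * v) ^ 2) (2 * ((u : ℂ) + w * v) * v) w := by
    have h2 : HasDerivAt (fun w : ℂ => (u : ℂ) + w * v) (v : ℂ) w := by
      simpa using ((hasDerivAt_id' w).mul_const (v : ℂ)).const_add (u : ℂ)
    simpa using h2.fun_pow 2
  exact (hasFDerivAt_id w).prodMk (h1.hasFDerivAt.restrictScalars ℝ)

lemma contDiff_leaf (u v : ℝ) : ContDiff ℝ ∞ (leaf u v) := by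
  unfold leaf; fun_prop

lemma leaf_snd_base_ne_zero {u v : ℝ} (huv : u ≠ 0 ∨ v ≠ 0) {w : ℂ} (hw : w ∈ upper) :
    (u : ℂ) + w * v ≠ 0 := by
  intro h
  have h1 := congrArg Complex.im h
  have h2 := congrArg Complex.re h
  have hw' : w.im ≠ 0 := ne_of_gt hw
  simp [hw'] at h1
  simp [h1] at h2
  tauto

/-- The coefficient of the restriction of the angular form to a leaf. -/
def leafAngular (u v : ℝ) (b : ℂ → ℂ) (w : ℂ) : ℂ :=
  -(Complex.I * v / (Real.pi * ((u : ℂ) + w * v))) + b w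

lemma dθ_eq (p : ℂ × ℂ) : dθ p = oneForm (ℂ × ℂ)
    ((1 / (2 * Real.pi) / (p.2.re ^ 2 + p.2.im ^ 2)) •
      (p.2.re • (Complex.imCLM ∘L ContinuousLinearMap.snd ℝ ℂ ℂ) -
        p.2.im • (Complex.reCLM ∘L ContinuousLinearMap.snd ℝ ℂ ℂ))) := rfl

/-- In the fiber coordinate `t` the angular form is the real part of `-(i / 2π) dt / t`, so along
holomorphic maps it pulls back to a logarithmic derivative. -/
lemma dθ_apply {p : ℂ × ℂ} (hp : p.2 ≠ 0) (v : Fin 1 → ℂ × ℂ) :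
    dθ p v = (-(Complex.I / (2 * Real.pi)) * ((v 0).2 / p.2)).re := by
  have hn : p.2.re ^ 2 + p.2.im ^ 2 ≠ 0 := by
    have := Complex.normSq_pos.2 hp
    rw [Complex.normSq_apply] at this
    nlinarith
  have h1 : -(Complex.I / (2 * Real.pi)) * ((v 0).2 / p.2) =
      ((1 / (2 * Real.pi) / (p.2.re ^ 2 + p.2.im ^ 2) : ℝ) : ℂ) *
        (-Complex.I * ((v 0).2 * starRingEnd ℂ p.2)) := by
    have h2 : ((p.2.re ^ 2 + p.2.im ^ 2 : ℝ) : ℂ) = p.2 * starRingEnd ℂ p.2 := by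
      rw [Complex.mul_conj, Complex.normSq_apply]; push_cast; ring
    have h3 : starRingEnd ℂ p.2 ≠ 0 := (map_ne_zero _).2 hp
    rw [Complex.ofReal_div, h2]
    push_cast
    field_simp
  rw [h1, Complex.re_ofReal_mul, dθ_eq, oneForm_apply]
  simp
  ring_nf
  tauto

lemma differentiableAt_dθ {p : ℂ × ℂ} (hp : p.2 ≠ 0) : DifferentiableAt ℝ dθ p := by
  have hn : p.2.re ^ 2 + p.2.im ^ 2 ≠ 0 := by
    have := Complex.normSq_pos.2 hp
    rw [Complex.normSq_apply] at this
    nlinarith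
  have hre : DifferentiableAt ℝ (fun p : ℂ × ℂ => p.2.re) p :=
    (Complex.reCLM ∘L ContinuousLinearMap.snd ℝ ℂ ℂ).differentiableAt
  have him : DifferentiableAt ℝ (fun p : ℂ × ℂ => p.2.im) p :=
    (Complex.imCLM ∘L ContinuousLinearMap.snd ℝ ℂ ℂ).differentiableAt
  have h : dθ = fun p => oneForm (ℂ × ℂ)
    ((1 / (2 * Real.pi) / (p.2.re ^ 2 + p.2.im ^ 2)) •
      (p.2.re • (Complex.imCLM ∘L ContinuousLinearMap.snd ℝ ℂ ℂ) -
        p.2.im • (Complex.reCLM ∘L ContinuousLinearMap.snd ℝ ℂ ℂ))) := funext dθ_eq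
  rw [h]
  refine (oneForm (ℂ × ℂ)).differentiable.differentiableAt.comp p ?_
  refine DifferentiableAt.fun_smul ?_ ((hre.smul_const _).sub (him.smul_const _))
  have hsq : DifferentiableAt ℝ (fun p : ℂ × ℂ => p.2.re ^ 2 + p.2.im ^ 2) p :=
    (hre.fun_pow 2).fun_add (him.fun_pow 2)
  simp_rw [div_eq_mul_inv (1 / (2 * Real.pi))]
  exact (hsq.fun_inv hn).const_mul _

lemma pullback_fst_eq (η : Form ℂ 1) : pullback Prod.fst η = fun p : ℂ × ℂ =>
    ContinuousAlternatingMap.compContinuousLinearMapCLM (ContinuousLinearMap.fst ℝ ℂ ℂ)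
      (η p.1) := by
  funext p
  have : fderiv ℝ (Prod.fst : ℂ × ℂ → ℂ) p = ContinuousLinearMap.fst ℝ ℂ ℂ :=
    (ContinuousLinearMap.fst ℝ ℂ ℂ).fderiv
  rw [pullback, this]
  rfl

lemma differentiableAt_pullback_fst {η : Form ℂ 1} {p : ℂ × ℂ}
    (hη : DifferentiableAt ℝ η p.1) : DifferentiableAt ℝ (pullback Prod.fst η) p := by
  rw [pullback_fst_eq]
  exact (ContinuousLinearMap.differentiableAt _).comp p
    (hη.comp p (ContinuousLinearMap.fst ℝ ℂ ℂ).differentiableAt)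

lemma pullback_fst_apply (η : Form ℂ 1) (p : ℂ × ℂ) (v : Fin 1 → ℂ × ℂ) :
    pullback Prod.fst η p v = (coeff η p.1 * (v 0).1).re := by
  rw [pullback_fst_eq, ← apply_eq_coeff η p.1 fun i => (v i).1]
  rfl

/-- The restriction of an angular form to a leaf. -/
lemma comp_leaf_eq_formOf {ψ : Form (ℂ × ℂ) 1} {η : Form ℂ 1} {u v : ℝ} {w : ℂ}
    (hW : (u : ℂ) + w * v ≠ 0)
    (hψ : ψ (leaf u v w) = dθ (leaf u v w) + pullback Prod.fst η (leaf u v w)) (R : ℂ × ℂ → ℝ) :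
    (R (leaf u v w) • ψ (leaf u v w)).compContinuousLinearMap (fderiv ℝ (leaf u v) w) =
      formOf (fun w => (R (leaf u v w) : ℂ) * leafAngular u v (coeff η) w) w := by
  have hp : (leaf u v w).2 ≠ 0 := pow_ne_zero 2 hW
  ext x
  rw [(hasFDerivAt_leaf u v w).fderiv, formOf_apply, hψ]
  simp only [ContinuousAlternatingMap.compContinuousLinearMap_apply,
    ContinuousAlternatingMap.smul_apply, ContinuousAlternatingMap.add_apply,
    dθ_apply hp, pullback_fst_apply, smul_eq_mul, Function.comp_apply]
  rw [mul_assoc (R (leaf u v w) : ℂ), Complex.re_ofReal_mul, ← Complex.add_re]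
  congr 2
  simp only [leafAngular, leaf, ContinuousLinearMap.prod_apply, ContinuousLinearMap.coe_id', id_eq,
    ContinuousLinearMap.coe_restrictScalars', ContinuousLinearMap.toSpanSingleton_apply, smul_eq_mul]
  field_simp

variable {h : ℂ → ℝ} {ρ : ℝ → ℝ} {ψ : Form (ℂ × ℂ) 1} {η : Form ℂ 1}

lemma radius_leaf (h : ℂ → ℝ) (u v : ℝ) (w : ℂ) :
    radius h (leaf u v w) = Complex.normSq ((u : ℂ) + w * v) * √(h w) := by
  rw [radius, normSq, leaf, mul_comm, Real.sqrt_mul (by positivity), Real.sqrt_sq (norm_nonneg _),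
    norm_pow, Complex.normSq_eq_norm_sq]

lemma differentiableAt_radius {p : ℂ × ℂ} (hp : p.2 ≠ 0) (h0 : 0 < h p.1)
    (hh : DifferentiableAt ℝ h p.1) : DifferentiableAt ℝ (radius h) p := by
  unfold radius normSq
  refine DifferentiableAt.sqrt ?_ ?_
  · exact (hh.comp p (ContinuousLinearMap.fst ℝ ℂ ℂ).differentiableAt).fun_mul
      (((contDiff_norm_sq ℝ (n := 1)).differentiable (by simp)).differentiableAt.comp p
        (ContinuousLinearMap.snd ℝ ℂ ℂ).differentiableAt)
  · have := norm_pos_iff.2 hp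
    positivity

theorem leafDensity_eq_curl {Ψ : Form (ℂ × ℂ) 2} (hhsm : ContDiffOn ℝ ∞ h upper)
    (hhpos : ∀ z ∈ upper, 0 < h z) (hρ : ContDiff ℝ ∞ ρ) (hη : ContDiffOn ℝ ∞ η upper)
    (hψ : ∀ p : ℂ × ℂ, p.1 ∈ upper → p.2 ≠ 0 → ψ p = dθ p + pullback Prod.fst η p)
    (hΨ : IsThomForm h ρ ψ Ψ) (z : ℍ) {q : ℂ} (hq : q ≠ 0) :
    leafDensity Ψ (z, q) = z.im ^ 2 * curl (fun w =>
      (ρ (radius h (leaf (q ^ (1 / 2 : ℂ)).re (q ^ (1 / 2 : ℂ)).im w)) : ℂ) *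
        leafAngular (q ^ (1 / 2 : ℂ)).re (q ^ (1 / 2 : ℂ)).im (coeff η) w) z := by
  have hs : q ^ (1 / 2 : ℂ) ≠ 0 := by simp [Complex.cpow_eq_zero_iff, hq]
  have huv : (q ^ (1 / 2 : ℂ)).re ≠ 0 ∨ (q ^ (1 / 2 : ℂ)).im ≠ 0 := by
    by_contra! h
    exact hs (Complex.ext h.1 h.2)
  have hPhi : (fun w => Phi w q) = leaf (q ^ (1 / 2 : ℂ)).re (q ^ (1 / 2 : ℂ)).im := rfl
  have hPhi' : Phi z q = leaf (q ^ (1 / 2 : ℂ)).re (q ^ (1 / 2 : ℂ)).im z := rfl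
  rw [leafDensity, pullback]
  simp only [hPhi, hPhi']
  generalize (q ^ (1 / 2 : ℂ)).re = u at huv
  generalize (q ^ (1 / 2 : ℂ)).im = v at huv
  have hz := coe_mem_upper z
  have hW := fun w (hw : w ∈ upper) => leaf_snd_base_ne_zero huv hw
  have hp : (leaf u v z).2 ≠ 0 := pow_ne_zero 2 (hW z hz)
  rw [hΨ (leaf u v z) hz hp]
  have hηd : DifferentiableAt ℝ η z :=
    (hη.contDiffAt (isOpen_upper.mem_nhds hz)).differentiableAt (by simp)
  have hhd : DifferentiableAt ℝ h z :=
    (hhsm.contDiffAt (isOpen_upper.mem_nhds hz)).differentiableAt (by simp)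
  have hψd : DifferentiableAt ℝ ψ (leaf u v z) := by
    have h1 : DifferentiableAt ℝ (fun p => dθ p + pullback Prod.fst η p) (leaf u v z) :=
      (differentiableAt_dθ hp).fun_add (differentiableAt_pullback_fst hηd)
    refine h1.congr_of_eventuallyEq ?_
    filter_upwards [(isOpen_upper.preimage continuous_fst).mem_nhds hz,
      (isOpen_ne.preimage continuous_snd).mem_nhds hp] with p h2 h3 using hψ p h2 h3
  have hrd : DifferentiableAt ℝ (fun p => ρ (radius h p)) (leaf u v z) :=
    (hρ.differentiable (by simp)).differentiableAt.comp _
      (differentiableAt_radius hp (hhpos z hz) hhd)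
  have hω : DifferentiableAt ℝ (fun p => ρ (radius h p) • ψ p) (leaf u v z) := hrd.fun_smul hψd
  -- The exterior derivative commutes with restriction to the leaf, which reduces everything to a
  -- one-form in the variable `z`.
  rw [← extDeriv_pullback hω (contDiff_leaf u v).contDiffAt (r := ∞)
    (by simp; exact WithTop.coe_le_coe.2 (le_top : (2 : ℕ∞) ≤ ⊤))]
  have heq : (fun w => (ρ (radius h (leaf u v w)) • ψ (leaf u v w)).compContinuousLinearMap
      (fderiv ℝ (leaf u v) w)) =ᶠ[𝓝 (z : ℂ)]
      formOf (fun w => (ρ (radius h (leaf u v w)) : ℂ) * leafAngular u v (coeff η) w) := by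
    filter_upwards [isOpen_upper.mem_nhds hz] with w hw
    exact comp_leaf_eq_formOf (hW w hw) (hψ _ hw (pow_ne_zero 2 (hW w hw)))
      fun p => ρ (radius h p)
  rw [heq.extDeriv_eq]
  refine extDeriv_formOf ?_ z.im
  have h1 : DifferentiableAt ℝ (fun w => ((ρ (radius h (leaf u v w)) : ℝ) : ℂ)) z :=
    Complex.ofRealCLM.differentiableAt.comp _
      (hrd.comp (z : ℂ) (hasFDerivAt_leaf u v z).differentiableAt)
  refine h1.fun_mul ?_
  unfold leafAngular
  have h2 : DifferentiableAt ℝ (coeff η) z :=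
    ((contDiffOn_coeff hη).contDiffAt (isOpen_upper.mem_nhds hz)).differentiableAt (by simp)
  refine DifferentiableAt.fun_add (DifferentiableAt.fun_neg ?_) h2
  have h3 : DifferentiableAt ℝ (fun w : ℂ => Real.pi * ((u : ℂ) + w * v)) z := by fun_prop
  simp_rw [div_eq_mul_inv]
  exact (h3.fun_inv (mul_ne_zero (by exact_mod_cast Real.pi_ne_zero) (hW z hz))).const_mul _

end

/-! ### Radial and oscillating parts of the leafwise density -/

/-- The coefficient of `dφ`. -/
def gradCoeff (φ : ℂ → ℝ) (z : ℂ) : ℂ := fderiv ℝ φ z 1 - Complex.I * fderiv ℝ φ z Complex.I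

/-- The curl of the sum of a holomorphic function and `b`. -/
lemma curl_add_of_differentiableAt {g b : ℂ → ℂ} {z : ℂ} (hg : DifferentiableAt ℂ g z)
    (hb : DifferentiableAt ℝ b z) : curl (fun w => g w + b w) z = curl b z := by
  have h1 : HasFDerivAt g ((ContinuousLinearMap.toSpanSingleton ℂ (deriv g z)).restrictScalars ℝ)
      z := hg.hasDerivAt.hasFDerivAt.restrictScalars ℝ
  have h2 := h1.fun_add hb.hasFDerivAt
  rw [curl, curl, h2.fderiv]
  simp
  ring

lemma hasFDerivAt_normSq_leaf (u v : ℝ) (z : ℂ) :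
    HasFDerivAt (fun w : ℂ => Complex.normSq ((u : ℂ) + w * v))
      ((2 * v * (u + z.re * v)) • Complex.reCLM + (2 * v * (z.im * v)) • Complex.imCLM) z := by
  have h1 : (fun w : ℂ => Complex.normSq ((u : ℂ) + w * v)) =
      fun w => (u + w.re * v) * (u + w.re * v) + (w.im * v) * (w.im * v) := by
    funext w
    rw [Complex.normSq_apply]
    simp
  rw [h1]
  have hre : HasFDerivAt (fun w : ℂ => u + w.re * v) (v • Complex.reCLM) z :=
    (Complex.reCLM.hasFDerivAt.mul_const v).const_add u
  have him : HasFDerivAt (fun w : ℂ => w.im * v) (v • Complex.imCLM) z :=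
    Complex.imCLM.hasFDerivAt.mul_const v
  convert! (hre.fun_mul hre).fun_add (him.fun_mul him) using 1
  ext
  · simp; ring

/-- The coefficient, relative to a metric, of the angular form along the horizontal distribution of
the canonical foliation. -/
def connection (b : ℂ → ℂ) (z : ℂ) : ℂ := b z - 1 / (2 * Real.pi * z.im)

/-- The coefficient of `d log (1 / (y c))`. -/
def logGrad (c : ℂ → ℝ) (z : ℂ) : ℂ := Complex.I / z.im - gradCoeff c z / c z

/-- The part of the leafwise density that multiplies `r ρ'(r)` and is constant on fibers. -/
def radialCoeff (c : ℂ → ℝ) (b : ℂ → ℂ) (z : ℂ) : ℝ :=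
  1 / (2 * Real.pi) + z.im ^ 2 * (starRingEnd ℂ (logGrad c z) * connection b z).im

/-- The coefficient of the part of the leafwise density that oscillates on fibers. -/
def phaseCoeff (c : ℂ → ℝ) (b : ℂ → ℂ) (z : ℂ) : ℂ :=
  z.im * (starRingEnd ℂ (connection b z) -
    Complex.I * starRingEnd ℂ (logGrad c z) / (2 * Real.pi : ℝ))

lemma phaseCoeff_mul_re {c : ℂ → ℝ} {b : ℂ → ℂ} {z : ℂ} {W : ℂ} :
    (phaseCoeff c b z * (starRingEnd ℂ (W ^ 2) / (‖W ^ 2‖ : ℝ))).re =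
      z.im * (((connection b z).re - (logGrad c z).im / (2 * Real.pi)) * (W.re ^ 2 - W.im ^ 2) -
        ((connection b z).im + (logGrad c z).re / (2 * Real.pi)) * (2 * W.re * W.im)) /
        Complex.normSq W := by
  rw [norm_pow, ← Complex.normSq_eq_norm_sq, ← mul_div_assoc, Complex.div_ofReal_re]
  congr 1
  rw [phaseCoeff, mul_assoc, Complex.re_ofReal_mul]
  congr 1
  simp only [sq, map_mul, Complex.mul_re, Complex.mul_im, Complex.sub_re, Complex.sub_im,
    Complex.div_ofReal_re, Complex.div_ofReal_im, Complex.conj_re, Complex.conj_im, Complex.I_re,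
    Complex.I_im]
  ring

lemma connection_re (b : ℂ → ℂ) (z : ℂ) :
    (connection b z).re = (b z).re - 1 / (2 * Real.pi * z.im) := by
  have : (1 / (2 * Real.pi * z.im) : ℂ) = ((1 / (2 * Real.pi * z.im) : ℝ) : ℂ) := by push_cast; rfl
  rw [connection, this, Complex.sub_re, Complex.ofReal_re]

lemma connection_im (b : ℂ → ℂ) (z : ℂ) : (connection b z).im = (b z).im := by
  have : (1 / (2 * Real.pi * z.im) : ℂ) = ((1 / (2 * Real.pi * z.im) : ℝ) : ℂ) := by push_cast; rfl
  rw [connection, this, Complex.sub_im, Complex.ofReal_im, sub_zero]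

lemma logGrad_re (c : ℂ → ℝ) (z : ℂ) : (logGrad c z).re = -(fderiv ℝ c z 1 / c z) := by
  rw [logGrad, Complex.sub_re, Complex.div_ofReal_re, Complex.div_ofReal_re]
  simp [gradCoeff]

lemma logGrad_im (c : ℂ → ℝ) (z : ℂ) :
    (logGrad c z).im = 1 / z.im + fderiv ℝ c z Complex.I / c z := by
  rw [logGrad, Complex.sub_im, Complex.div_ofReal_im, Complex.div_ofReal_im]
  simp [gradCoeff, neg_div]

lemma leafAngular_re (u v : ℝ) (b : ℂ → ℂ) (z : ℂ) : (leafAngular u v b z).re =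
    -(v * ((u : ℂ) + z * v).im / (Real.pi * Complex.normSq ((u : ℂ) + z * v))) + (b z).re := by
  rw [leafAngular, Complex.add_re, Complex.neg_re, mul_comm (Real.pi : ℂ), ← div_div,
    Complex.div_ofReal_re, Complex.div_re]
  simp
  ring

lemma leafAngular_im (u v : ℝ) (b : ℂ → ℂ) (z : ℂ) : (leafAngular u v b z).im =
    -(v * ((u : ℂ) + z * v).re / (Real.pi * Complex.normSq ((u : ℂ) + z * v))) + (b z).im := by
  rw [leafAngular, Complex.add_im, Complex.neg_im, mul_comm (Real.pi : ℂ), ← div_div,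
    Complex.div_ofReal_im, Complex.div_im]
  simp
  ring

/-- The density of the Thom form on a leaf. -/
theorem im_sq_mul_curl_leaf {ρ : ℝ → ℝ} (hρ : ContDiff ℝ ∞ ρ) {c : ℂ → ℝ} {b : ℂ → ℂ} {z : ℂ}
    (hz : z ∈ upper) {u v : ℝ} (hW : (u : ℂ) + z * v ≠ 0) (hc0 : 0 < c z)
    (hc : DifferentiableAt ℝ c z) (hb : DifferentiableAt ℝ b z) :
    z.im ^ 2 * curl (fun w => (ρ (Complex.normSq ((u : ℂ) + w * v) * c w) : ℂ) *
      leafAngular u v b w) z =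
    fiberDensity ρ (c z) (radialCoeff c b z) (z.im ^ 2 * curl b z) (phaseCoeff c b z)
      (((u : ℂ) + z * v) ^ 2) := by
  have hy : z.im ≠ 0 := ne_of_gt hz
  have h1 : HasFDerivAt (fun w => ρ (Complex.normSq ((u : ℂ) + w * v) * c w)) _ z :=
    HasDerivAt.comp_hasFDerivAt (h₂ := ρ) (f := fun w => Complex.normSq ((u : ℂ) + w * v) * c w) z
      (hρ.differentiable (by simp) _).hasDerivAt
      ((hasFDerivAt_normSq_leaf u v z).fun_mul hc.hasFDerivAt)
  have h2 : DifferentiableAt ℂ (fun w : ℂ => -(Complex.I * v / (Real.pi * ((u : ℂ) + w * v)))) z :=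
    DifferentiableAt.fun_neg (DifferentiableAt.fun_div (by fun_prop) (by fun_prop)
      (mul_ne_zero (by exact_mod_cast Real.pi_ne_zero) hW))
  have h3 : DifferentiableAt ℝ (leafAngular u v b) z :=
    (h2.restrictScalars ℝ).fun_add hb
  have h4 : curl (leafAngular u v b) z = curl b z := curl_add_of_differentiableAt h2 hb
  have hn : Complex.normSq ((u : ℂ) + z * v) ≠ 0 := (Complex.normSq_pos.2 hW).ne'
  have hr : ‖((u : ℂ) + z * v) ^ 2‖ = Complex.normSq ((u : ℂ) + z * v) := by
    rw [norm_pow, Complex.normSq_eq_norm_sq]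
  -- The restricted angular form has coefficient `β + φ / (2πy)` and `d log r` has `-l + iφ / y`. In
  -- their wedge product the two phases cancel, as `|φ| = 1`, and leave the constant `1 / (2π)` of
  -- `radialCoeff`; the mixed terms form `phaseCoeff`.
  rw [curl_ofReal_mul h1.differentiableAt h3, h4, h1.fderiv, fiberDensity, hr, ← hr,
    phaseCoeff_mul_re, hr, leafAngular_re, leafAngular_im, radialCoeff]
  simp only [Complex.mul_im, Complex.conj_re, Complex.conj_im, connection_re, connection_im,
    logGrad_re, logGrad_im]
  have hre : ((u : ℂ) + z * v).re = u + z.re * v := by simp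
  have him : ((u : ℂ) + z * v).im = z.im * v := by simp
  have hnn := Complex.normSq_apply ((u : ℂ) + z * v)
  simp only [_root_.smul_apply, _root_.add_apply, Complex.reCLM_apply, Complex.imCLM_apply,
    Complex.one_re, Complex.one_im, Complex.I_re, Complex.I_im, smul_eq_mul]
  rw [hre, him] at *
  generalize Complex.normSq ((u : ℂ) + z * v) = n at *
  generalize u + z.re * v = a at *
  generalize fderiv ℝ c z 1 = cx
  generalize fderiv ℝ c z Complex.I = cy
  generalize deriv ρ (n * c z) = d
  generalize ρ (n * c z) = r
  generalize curl b z = e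
  generalize c z = c0 at *
  generalize (b z).re = br
  generalize (b z).im = bi
  generalize z.im = y at *
  have hpi := Real.pi_ne_zero
  generalize Real.pi = π at *
  have hc0' := hc0.ne'
  field_simp
  subst hnn
  ring

/-! ### Fubini on `ℍ × Q` -/

section

lemma measurable_Phi_snd_upperHalfPlane : Measurable fun x : ℍ × ℂ => (Phi x.1 x.2).2 := by
  have h : Measurable fun x : ℍ × ℂ => (x.1 : ℂ) :=
    UpperHalfPlane.continuous_coe.measurable.comp measurable_fst
  unfold Phi
  fun_prop

lemma measurable_fiberDensity {ρ : ℝ → ℝ} (hρ : ContDiff ℝ ∞ ρ) {c A C : ℍ → ℝ} {k : ℍ → ℂ}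
    (hc : Measurable c) (hA : Measurable A) (hC : Measurable C) (hk : Measurable k) :
    Measurable fun x : ℍ × ℂ => fiberDensity ρ (c x.1) (A x.1) (C x.1) (k x.1) x.2 := by
  have h1 : Measurable ρ := hρ.continuous.measurable
  have h2 : Measurable (deriv ρ) := measurable_deriv ρ
  unfold fiberDensity
  fun_prop

lemma measurable_fiberDensity_right {ρ : ℝ → ℝ} (hρ : ContDiff ℝ ∞ ρ) (c A C : ℝ) (k : ℂ) :
    Measurable (fiberDensity ρ c A C k) := by
  have h1 : Measurable ρ := hρ.continuous.measurable
  have h2 : Measurable (deriv ρ) := measurable_deriv ρ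
  unfold fiberDensity
  fun_prop

lemma ae_snd_ne_zero (ν : Measure ℍ) [SFinite ν] :
    ∀ᵐ x ∂ν.prod transverseMeasure, x.2 ≠ 0 := by
  have h1 : ∀ᵐ q : ℂ ∂transverseMeasure, q ≠ 0 := by
    refine (withDensity_absolutelyContinuous volume _).ae_le ?_
    exact ae_iff.2 (by simp)
  exact Measure.quasiMeasurePreserving_snd.ae h1

section Fubini

variable {ν : Measure ℍ} [IsFiniteMeasure ν] {P : ℍ → ℂ → ℂ} {c : ℍ → ℝ}

/-- The integral over the fiber at `z` is `π / (y c)` times that of `g`, which `hcM` bounds on a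
space of finite measure. -/
lemma integrable_prod_radial (hPm : Measurable fun x : ℍ × ℂ => P x.1 x.2)
    (hPi : ∀ (z : ℍ) (G : ℂ → ℝ), Measurable G → Integrable G transverseMeasure →
      Integrable (fun q => G (P z q)) transverseMeasure)
    (hPI : ∀ (z : ℍ) (G : ℂ → ℝ), Measurable G →
      ∫ q, G (P z q) ∂transverseMeasure = 1 / z.im * ∫ p, G p ∂transverseMeasure)
    (hc : Measurable c) (hc0 : ∀ z, 0 < c z) {M : ℝ} (hcM : ∀ z, 1 / (z.im * c z) ≤ M)
    {g : ℝ → ℝ} (hgm : Measurable g) (hgi : Integrable g) (hg0 : ∀ r, 0 ≤ g r) :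
    Integrable (fun x : ℍ × ℂ => g (‖P x.1 x.2‖ * c x.1)) (ν.prod transverseMeasure) := by
  have hNm : Measurable fun x : ℍ × ℂ => g (‖P x.1 x.2‖ * c x.1) :=
    hgm.comp (hPm.norm.mul (hc.comp measurable_fst))
  have hfib : ∀ z : ℍ, Measurable fun p : ℂ => g (‖p‖ * c z) := fun z =>
    hgm.comp (measurable_norm.mul_const _)
  have h1 : ∀ z : ℍ, ∫ q, ‖g (‖P z q‖ * c z)‖ ∂transverseMeasure =
      1 / (z.im * c z) * Real.pi * ∫ r in Ioi 0, g r := by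
    intro z
    have h2 : ∀ q, ‖g (‖P z q‖ * c z)‖ = g (‖P z q‖ * c z) := fun q =>
      Real.norm_of_nonneg (hg0 _)
    simp_rw [h2]
    rw [hPI z (fun p => g (‖p‖ * c z)) (hfib z), integral_radial g (hc0 z)]
    field_simp
  refine (integrable_prod_iff hNm.aestronglyMeasurable).2 ⟨.of_forall fun z => ?_, ?_⟩
  · exact hPi z (fun p => g (‖p‖ * c z)) (hfib z) (integrable_radial hgi.integrableOn (hc0 z))
  · simp_rw [h1]
    have hmeas : Measurable fun z : ℍ => 1 / (z.im * c z) * Real.pi * ∫ r in Ioi 0, g r := by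
      have := UpperHalfPlane.continuous_im.measurable
      fun_prop
    refine Integrable.of_bound hmeas.aestronglyMeasurable
      (M * Real.pi * ∫ r in Ioi 0, g r) (.of_forall fun z => ?_)
    have h3 : 0 ≤ ∫ r in Ioi 0, g r := integral_nonneg hg0
    have h4 : 0 ≤ 1 / (z.im * c z) :=
      one_div_nonneg.2 (mul_nonneg z.im_pos.le (hc0 z).le)
    rw [Real.norm_of_nonneg (mul_nonneg (mul_nonneg h4 Real.pi_pos.le) h3)]
    exact mul_le_mul_of_nonneg_right (mul_le_mul_of_nonneg_right (hcM z) Real.pi_pos.le) h3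

variable {ρ : ℝ → ℝ} {A C : ℍ → ℝ} {k : ℍ → ℂ}

/-- Fubini for a density on `ℍ × Q` of the form `fiberDensity`. -/
theorem integrable_and_integral_prod (hρ : ContDiff ℝ ∞ ρ) (hρc : HasCompactSupport ρ)
    (hPm : Measurable fun x : ℍ × ℂ => P x.1 x.2)
    (hPi : ∀ (z : ℍ) (G : ℂ → ℝ), Measurable G → Integrable G transverseMeasure →
      Integrable (fun q => G (P z q)) transverseMeasure)
    (hPI : ∀ (z : ℍ) (G : ℂ → ℝ), Measurable G →
      ∫ q, G (P z q) ∂transverseMeasure = 1 / z.im * ∫ p, G p ∂transverseMeasure)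
    (hc : Measurable c) (hA : Measurable A) (hC : Measurable C) (hk : Measurable k)
    (hc0 : ∀ z, 0 < c z) {M : ℝ} (hcM : ∀ z, 1 / (z.im * c z) ≤ M) (hAM : ∀ z, |A z| ≤ M)
    (hCM : ∀ z, |C z| ≤ M) (hkM : ∀ z, ‖k z‖ ≤ M) {D : ℍ × ℂ → ℝ}
    (hD : ∀ z : ℍ, ∀ q : ℂ, q ≠ 0 →
      D (z, q) = fiberDensity ρ (c z) (A z) (C z) (k z) (P z q)) :
    Integrable D (ν.prod transverseMeasure) ∧
      ∫ x, D x ∂ν.prod transverseMeasure =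
        Real.pi * (∫ r in Ioi 0, ρ r) * ∫ z, 1 / (z.im * c z) * (C z - A z) ∂ν := by
  have hGm := measurable_fiberDensity hρ hc hA hC hk
  have hEm : Measurable fun x : ℍ × ℂ =>
      fiberDensity ρ (c x.1) (A x.1) (C x.1) (k x.1) (P x.1 x.2) :=
    hGm.comp (measurable_fst.prodMk hPm)
  have hDE : D =ᵐ[ν.prod transverseMeasure] fun x : ℍ × ℂ =>
      fiberDensity ρ (c x.1) (A x.1) (C x.1) (k x.1) (P x.1 x.2) := by
    filter_upwards [ae_snd_ne_zero ν] with x hx using hD x.1 x.2 hx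
  have hM0 : 0 ≤ M := (abs_nonneg _).trans (hAM UpperHalfPlane.I)
  -- This radial majorant is the one in `abs_fiberDensity_le`.
  have hNi := integrable_prod_radial (ν := ν) hPm hPi hPI hc hc0 hcM
    (g := fun r => 2 * M * |deriv ρ r * r| + M * |ρ r|)
    (by
      have h1 : Measurable ρ := hρ.continuous.measurable
      have h2 : Measurable (deriv ρ) := measurable_deriv ρ
      exact ((h2.mul measurable_id).norm.const_mul (2 * M)).add (h1.norm.const_mul M))
    (((integrable_deriv_mul hρ hρc).abs.const_mul (2 * M)).add
      ((integrable_bump hρ hρc).abs.const_mul M)) (fun r => by positivity)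
  have hEi : Integrable (fun x : ℍ × ℂ =>
      fiberDensity ρ (c x.1) (A x.1) (C x.1) (k x.1) (P x.1 x.2)) (ν.prod transverseMeasure) :=
    hNi.mono' hEm.aestronglyMeasurable (.of_forall fun x =>
      abs_fiberDensity_le _ (hAM x.1) (hCM x.1) (hkM x.1))
  have hfib : ∀ z : ℍ,
      ∫ q, fiberDensity ρ (c z) (A z) (C z) (k z) (P z q) ∂transverseMeasure =
        Real.pi * (∫ r in Ioi 0, ρ r) * (1 / (z.im * c z) * (C z - A z)) := by
    intro z
    rw [hPI z (fiberDensity ρ (c z) (A z) (C z) (k z))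
      (measurable_fiberDensity_right hρ _ _ _ _), integral_fiberDensity hρ hρc (hc0 z)]
    have := (hc0 z).ne'
    field_simp
  refine ⟨hEi.congr hDE.symm, (integral_congr_ae hDE).trans ((integral_prod _ hEi).trans ?_)⟩
  rw [← integral_const_mul]
  exact integral_congr_ae (.of_forall hfib)

end Fubini

variable {h : ℂ → ℝ} {ρ : ℝ → ℝ} {ψ : Form (ℂ × ℂ) 1} {η : Form ℂ 1}

lemma contDiffOn_sqrt (hhsm : ContDiffOn ℝ ∞ h upper) (hhpos : ∀ z ∈ upper, 0 < h z) :
    ContDiffOn ℝ ∞ (fun z => √(h z)) upper :=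
  hhsm.sqrt fun z hz => (hhpos z hz).ne'

theorem leafDensity_eq_fiberDensity {Ψ : Form (ℂ × ℂ) 2} (hhsm : ContDiffOn ℝ ∞ h upper)
    (hhpos : ∀ z ∈ upper, 0 < h z) (hρ : ContDiff ℝ ∞ ρ) (hη : ContDiffOn ℝ ∞ η upper)
    (hψ : ∀ p : ℂ × ℂ, p.1 ∈ upper → p.2 ≠ 0 → ψ p = dθ p + pullback Prod.fst η p)
    (hΨ : IsThomForm h ρ ψ Ψ) (z : ℍ) {q : ℂ} (hq : q ≠ 0) :
    leafDensity Ψ (z, q) = fiberDensity ρ (√(h z)) (radialCoeff (fun z => √(h z)) (coeff η) z)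
      (z.im ^ 2 * curl (coeff η) z) (phaseCoeff (fun z => √(h z)) (coeff η) z) (Phi z q).2 := by
  have hz := coe_mem_upper z
  rw [leafDensity_eq_curl hhsm hhpos hρ hη hψ hΨ z hq]
  simp_rw [radius_leaf]
  have hs : q ^ (1 / 2 : ℂ) ≠ 0 := by simp [Complex.cpow_eq_zero_iff, hq]
  have huv : (q ^ (1 / 2 : ℂ)).re ≠ 0 ∨ (q ^ (1 / 2 : ℂ)).im ≠ 0 := by
    by_contra! h
    exact hs (Complex.ext h.1 h.2)
  exact im_sq_mul_curl_leaf hρ (c := fun z => √(h z)) hz (leaf_snd_base_ne_zero huv hz)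
    (Real.sqrt_pos.2 (hhpos z hz))
    (((contDiffOn_sqrt hhsm hhpos).contDiffAt (isOpen_upper.mem_nhds hz)).differentiableAt
      (by simp))
    (((contDiffOn_coeff hη).contDiffAt (isOpen_upper.mem_nhds hz)).differentiableAt (by simp))

end

section

/-! ### Transformation laws -/

lemma fderiv_apply_eq_gradCoeff (φ : ℂ → ℝ) (z v : ℂ) : fderiv ℝ φ z v = (gradCoeff φ z * v).re := by
  have h : fderiv ℝ φ z v = v.re * fderiv ℝ φ z 1 + v.im * fderiv ℝ φ z Complex.I := by
    conv_lhs => rw [← Complex.re_add_im v, ← mul_one (v.re : ℂ), ← Complex.real_smul,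
      ← Complex.real_smul, map_add, map_smul, map_smul]
    simp
  rw [h, gradCoeff]
  simp
  ring

lemma eq_of_forall_re_mul_eq {a b : ℂ} (h : ∀ s : ℂ, (a * s).re = (b * s).re) : a = b := by
  have h1 := h 1
  have h2 := h Complex.I
  simp only [mul_one, Complex.mul_re, Complex.I_re, Complex.I_im, mul_zero, zero_sub,
    neg_inj] at h1 h2
  exact Complex.ext h1 h2

lemma gradCoeff_congr {φ χ : ℂ → ℝ} {z : ℂ} (h : φ =ᶠ[𝓝 z] χ) : gradCoeff φ z = gradCoeff χ z := by
  rw [gradCoeff, gradCoeff, h.fderiv_eq]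

lemma gradCoeff_comp {φ : ℂ → ℝ} {m : ℂ → ℂ} {m' z : ℂ} (hm : HasDerivAt m m' z)
    (hφ : DifferentiableAt ℝ φ (m z)) :
    gradCoeff (fun w => φ (m w)) z = gradCoeff φ (m z) * m' := by
  refine eq_of_forall_re_mul_eq fun s => ?_
  rw [← fderiv_apply_eq_gradCoeff, mul_assoc, ← fderiv_apply_eq_gradCoeff]
  have h1 : HasFDerivAt (fun w => φ (m w)) ((fderiv ℝ φ (m z)).comp
      ((ContinuousLinearMap.toSpanSingleton ℂ m').restrictScalars ℝ)) z :=
    hφ.hasFDerivAt.comp z (hm.hasFDerivAt.restrictScalars ℝ)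
  rw [h1.fderiv]
  simp [mul_comm]

lemma norm_fderiv_le_gradCoeff (φ : ℂ → ℝ) (z : ℂ) : ‖fderiv ℝ φ z‖ ≤ ‖gradCoeff φ z‖ := by
  refine ContinuousLinearMap.opNorm_le_bound _ (norm_nonneg _) fun v => ?_
  rw [fderiv_apply_eq_gradCoeff, ← norm_mul]
  exact Complex.abs_re_le_norm _

/-- The reciprocal of the length, in the metric `h`, of a hyperbolic unit vector. -/
def invLength (h : ℂ → ℝ) (z : ℂ) : ℝ := 1 / (z.im * √(h z))

lemma invLength_pos {h : ℂ → ℝ} (hhpos : ∀ z ∈ upper, 0 < h z) {z : ℂ} (hz : z ∈ upper) :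
    0 < invLength h z :=
  one_div_pos.2 (mul_pos hz (Real.sqrt_pos.2 (hhpos z hz)))

lemma hasFDerivAt_one_div_im_mul {c : ℂ → ℝ} {z : ℂ} (hz : z ∈ upper) (hc0 : 0 < c z)
    (hc : DifferentiableAt ℝ c z) :
    HasFDerivAt (fun w : ℂ => 1 / (w.im * c w))
      (-((z.im * c z) ^ 2)⁻¹ • (z.im • fderiv ℝ c z + c z • Complex.imCLM)) z := by
  have h1 : HasFDerivAt (fun w : ℂ => w.im * c w) (z.im • fderiv ℝ c z + c z • Complex.imCLM) z :=
    Complex.imCLM.hasFDerivAt.fun_mul hc.hasFDerivAt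
  have h2 := HasDerivAt.comp_hasFDerivAt z
    (hasDerivAt_inv (mul_pos (show 0 < z.im from hz) hc0).ne') h1
  convert! h2 using 1
  funext w
  exact one_div _

/-- The logarithmic derivative of `1 / (y c)`. -/
lemma gradCoeff_one_div_im_mul {c : ℂ → ℝ} {z : ℂ} (hz : z ∈ upper) (hc0 : 0 < c z)
    (hc : DifferentiableAt ℝ c z) :
    gradCoeff (fun w : ℂ => 1 / (w.im * c w)) z = (1 / (z.im * c z) : ℝ) * logGrad c z := by
  have hy : (z.im : ℂ) ≠ 0 := by exact_mod_cast ne_of_gt (show 0 < z.im from hz)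
  have hc' : (c z : ℂ) ≠ 0 := by exact_mod_cast hc0.ne'
  rw [gradCoeff, (hasFDerivAt_one_div_im_mul hz hc0 hc).fderiv, logGrad, gradCoeff]
  simp
  field_simp
  ring

lemma hasDerivAt_mobDeriv (A : SL(2, ℝ)) {z : ℂ} (hz : z ∈ upper) :
    HasDerivAt (mobDeriv A) (mobDeriv A z * (-2 * A 1 0 / ((A 1 0 : ℂ) * z + A 1 1))) z := by
  have hd := SL2_denom_ne_zero A (ne_of_gt hz : z.im ≠ 0)
  have h1 : HasDerivAt (fun z : ℂ => (A 1 0 : ℂ) * z + A 1 1) (A 1 0 : ℂ) z := by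
    simpa using ((hasDerivAt_id' z).const_mul (A 1 0 : ℂ)).add_const (A 1 1 : ℂ)
  have h2 := (h1.fun_pow 2).fun_inv (pow_ne_zero 2 hd)
  convert! h2 using 1
  · funext w
    exact one_div _
  · rw [mobDeriv]
    simp
    field_simp

lemma tangentAct_eq (A : SL(2, ℝ)) (p : ℂ × ℂ) :
    tangentAct A p = (mob A p.1, p.2 * mobDeriv A p.1) := by
  rw [tangentAct, mob, mobDeriv, mul_one_div]

/-- Base directions at the single vector `(z, 1)` suffice to read off the coefficient of an angular
form. -/
lemma fderiv_tangentAct (A : SL(2, ℝ)) {z : ℂ} (hz : z ∈ upper) (s : ℂ) :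
    fderiv ℝ (tangentAct A) (z, 1) (s, 0) = (mobDeriv A z * s,
      mobDeriv A z * (-2 * A 1 0 / ((A 1 0 : ℂ) * z + A 1 1)) * s) := by
  have hfst : HasFDerivAt (Prod.fst : ℂ × ℂ → ℂ) (ContinuousLinearMap.fst ℝ ℂ ℂ) (z, 1) :=
    hasFDerivAt_fst
  have hsnd : HasFDerivAt (Prod.snd : ℂ × ℂ → ℂ) (ContinuousLinearMap.snd ℝ ℂ ℂ) (z, 1) :=
    hasFDerivAt_snd
  have h1 : HasFDerivAt (fun p : ℂ × ℂ => mob A p.1) _ (z, 1) :=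
    HasFDerivAt.comp (g := mob A) (z, (1 : ℂ))
      ((hasDerivAt_mob A hz).hasFDerivAt.restrictScalars ℝ) hfst
  have h2 : HasFDerivAt (fun p : ℂ × ℂ => mobDeriv A p.1) _ (z, 1) :=
    HasFDerivAt.comp (g := mobDeriv A) (z, (1 : ℂ))
      ((hasDerivAt_mobDeriv A hz).hasFDerivAt.restrictScalars ℝ) hfst
  have h3 := h1.prodMk (hsnd.fun_mul h2)
  have h4 : tangentAct A = fun p => (mob A p.1, p.2 * mobDeriv A p.1) := funext (tangentAct_eq A)
  rw [h4, h3.fderiv]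
  simp [mul_comm]

/-- The coefficient of the pull-back of an angular form by a Möbius transformation. -/
def connectionComp (A : SL(2, ℝ)) (b : ℂ → ℂ) (z : ℂ) : ℂ :=
  b (mob A z) * mobDeriv A z + Complex.I * A 1 0 / (Real.pi * ((A 1 0 : ℂ) * z + A 1 1))

lemma pullback_tangentAct_apply {ψ : Form (ℂ × ℂ) 1} {η : Form ℂ 1}
    (hψ : ∀ p : ℂ × ℂ, p.1 ∈ upper → p.2 ≠ 0 → ψ p = dθ p + pullback Prod.fst η p)
    (A : SL(2, ℝ)) {z : ℂ} (hz : z ∈ upper) (s : ℂ) :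
    pullback (tangentAct A) ψ (z, 1) (fun _ => (s, 0)) =
      (connectionComp A (coeff η) z * s).re := by
  have hd := SL2_denom_ne_zero A (ne_of_gt hz : z.im ≠ 0)
  have hD := mobDeriv_ne_zero A hz
  have h1 : tangentAct A (z, 1) = (mob A z, mobDeriv A z) := by
    rw [tangentAct_eq]; simp
  rw [pullback, ContinuousAlternatingMap.compContinuousLinearMap_apply, h1,
    hψ _ (mob_mem_upper A hz) hD, ContinuousAlternatingMap.add_apply, dθ_apply hD,
    pullback_fst_apply]
  simp only [Function.comp_apply]
  rw [fderiv_tangentAct A hz, ← Complex.add_re]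
  congr 1
  simp only [connectionComp]
  field_simp
  ring

/-- The inhomogeneous term of `connectionComp`, due to the angle by which `A'` turns vectors, is
exactly compensated by the change of `1 / (2πy)` under `A`. -/
lemma connection_mob (A : SL(2, ℝ)) (b : ℂ → ℂ) {z : ℂ} (hz : z ∈ upper) :
    connection b (mob A z) * mobDeriv A z = connection (connectionComp A b) z := by
  have hd := SL2_denom_ne_zero A (ne_of_gt hz : z.im ≠ 0)
  have hy : (z.im : ℂ) ≠ 0 := by exact_mod_cast ne_of_gt (show 0 < z.im from hz)
  -- Replacing the conjugate of `c z + d` by `c z + d - 2 i c y` makes the claim a rational identity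
  -- in `z` and `y`.
  have hnorm : ((‖mobDeriv A z‖ : ℝ) : ℂ) =
      1 / (((A 1 0 : ℂ) * z + A 1 1) * ((A 1 0 : ℂ) * z + A 1 1 - 2 * Complex.I * A 1 0 * z.im)) := by
    have h1 : starRingEnd ℂ ((A 1 0 : ℂ) * z + A 1 1) =
        (A 1 0 : ℂ) * z + A 1 1 - 2 * Complex.I * A 1 0 * z.im := by
      apply Complex.ext
      · simp
      · simp; ring
    rw [← h1, Complex.mul_conj, mobDeriv, norm_div, norm_pow, Complex.normSq_eq_norm_sq, norm_one]
    push_cast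
    rfl
  have hd' : (A 1 0 : ℂ) * z + A 1 1 - 2 * Complex.I * A 1 0 * z.im ≠ 0 := by
    intro h0
    rw [h0, mul_zero, div_zero, Complex.ofReal_eq_zero, norm_eq_zero] at hnorm
    exact mobDeriv_ne_zero A hz hnorm
  have hpi : (Real.pi : ℂ) ≠ 0 := by exact_mod_cast Real.pi_ne_zero
  rw [connection, connection, connectionComp, im_mob A hz, Complex.ofReal_mul, hnorm, mobDeriv]
  generalize b (mob A z) = B
  field_simp
  ring

lemma invLength_mob (A : SL(2, ℝ)) {h : ℂ → ℝ} {z : ℂ} (hz : z ∈ upper) {k : ℝ}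
    (hk : normSq h (tangentAct A (z, 1)) = k) : invLength h (mob A z) = 1 / (z.im * √k) := by
  rw [← hk, tangentAct_eq, normSq, one_mul, invLength, im_mob A hz, mul_comm (h _),
    Real.sqrt_mul (by positivity), Real.sqrt_sq (norm_nonneg _)]
  ring_nf

variable {Γ : Subgroup SL(2, ℝ)} {h : ℂ → ℝ} {ψ : Form (ℂ × ℂ) 1} {η : Form ℂ 1}

lemma invLength_invariant (hh : IsHermitianMetric Γ h) :
    ∀ γ ∈ Γ, ∀ z ∈ upper, invLength h (mob γ z) = invLength h z := by
  intro γ hγ z hz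
  rw [invLength_mob γ hz (hh.invariant γ hγ (z, 1) hz)]
  simp [invLength, normSq]

lemma isAutomorphic_connection (hψ : IsGlobalAngularForm Γ ψ)
    (hη : ∀ p : ℂ × ℂ, p.1 ∈ upper → p.2 ≠ 0 → ψ p = dθ p + pullback Prod.fst η p) :
    IsAutomorphic Γ (connection (coeff η)) := by
  intro γ hγ z hz
  rw [connection_mob γ _ hz]
  have h1 : connectionComp γ (coeff η) z = coeff η z := by
    refine eq_of_forall_re_mul_eq fun s => ?_
    rw [← pullback_tangentAct_apply hη γ hz, hψ.invariant γ hγ (z, 1) hz one_ne_zero,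
      hη _ hz one_ne_zero, ContinuousAlternatingMap.add_apply, dθ_apply one_ne_zero,
      pullback_fst_apply]
    simp
  rw [connection, connection, h1]

end

section

/-! ### Estimates near the cusps -/

/-- The filter of neighborhoods of `i∞`. -/
def atCusp : Filter ℂ := Filter.comap Complex.im Filter.atTop

lemma eventually_atCusp {P : ℂ → Prop} :
    (∀ᶠ z in atCusp, P z) ↔ ∃ Y : ℝ, ∀ z : ℂ, Y ≤ z.im → P z := by
  rw [atCusp, Filter.eventually_comap, Filter.eventually_atTop]
  exact ⟨fun ⟨Y, h⟩ => ⟨Y, fun z hz => h z.im hz z rfl⟩,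
    fun ⟨Y, h⟩ => ⟨Y, fun y hy z hz => h z (hz ▸ hy)⟩⟩

lemma eventually_eventually_atCusp {P : ℂ → Prop} (h : ∀ᶠ z in atCusp, P z) :
    ∀ᶠ z in atCusp, ∀ᶠ w in 𝓝 z, P w := by
  obtain ⟨Y, hY⟩ := eventually_atCusp.1 h
  refine eventually_atCusp.2 ⟨Y + 1, fun z hz => ?_⟩
  have : ∀ᶠ w : ℂ in 𝓝 z, Y < w.im :=
    Complex.continuous_im.continuousAt.eventually_const_lt (by linarith)
  exact this.mono fun w hw => hY w hw.le

lemma eventually_mem_upper : ∀ᶠ z in atCusp, z ∈ upper :=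
  eventually_atCusp.2 ⟨1, fun _ hz => lt_of_lt_of_le one_pos hz⟩

/-- The coordinate `w = e^{iz}` at a cusp. -/
def cuspMap (z : ℂ) : ℂ := Complex.exp (Complex.I * z)

lemma hasDerivAt_cuspMap (z : ℂ) : HasDerivAt cuspMap (Complex.I * cuspMap z) z := by
  have h1 : HasDerivAt (fun z : ℂ => Complex.I * z) Complex.I z := by
    simpa using (hasDerivAt_id' z).const_mul Complex.I
  convert! h1.cexp using 1
  rw [cuspMap, mul_comm]

lemma norm_cuspMap (z : ℂ) : ‖cuspMap z‖ = Real.exp (-z.im) := by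
  rw [cuspMap, Complex.norm_exp]; simp

lemma tendsto_cuspMap : Filter.Tendsto cuspMap atCusp (𝓝 0) := by
  rw [tendsto_zero_iff_norm_tendsto_zero]
  simp_rw [norm_cuspMap]
  exact Real.tendsto_exp_neg_atTop_nhds_zero.comp Filter.tendsto_comap

/-- Since `dw = i w dz`, this inequality makes a form that is smooth at `w = 0` bounded in the
hyperbolic metric. -/
lemma im_mul_norm_cuspMap_le (z : ℂ) : z.im * ‖cuspMap z‖ ≤ 1 := by
  rw [norm_cuspMap, Real.exp_neg, ← div_eq_mul_inv, div_le_one (Real.exp_pos _)]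
  linarith [Real.add_one_le_exp z.im]

lemma eventually_norm_comp_cuspMap_le {E : Type*} [NormedAddCommGroup E] {φ : ℂ → E}
    (hφ : ContinuousAt φ 0) : ∀ᶠ z in atCusp, ‖φ (cuspMap z)‖ ≤ ‖φ 0‖ + 1 :=
  ((hφ.tendsto.comp tendsto_cuspMap).norm.eventually_lt_const
    (lt_add_one ‖φ 0‖)).mono fun _ h => le_of_lt h

lemma cuspCoord_eq (p : ℂ × ℂ) : cuspCoord p = (cuspMap p.1, Complex.I * p.2) := rfl

lemma fderiv_cuspCoord (z s : ℂ) :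
    fderiv ℝ cuspCoord (z, 1) (s, 0) = (Complex.I * cuspMap z * s, 0) := by
  have hfst : HasFDerivAt (Prod.fst : ℂ × ℂ → ℂ) (ContinuousLinearMap.fst ℝ ℂ ℂ) (z, 1) :=
    hasFDerivAt_fst
  have hsnd : HasFDerivAt (Prod.snd : ℂ × ℂ → ℂ) (ContinuousLinearMap.snd ℝ ℂ ℂ) (z, 1) :=
    hasFDerivAt_snd
  have h1 : HasFDerivAt (fun p : ℂ × ℂ => cuspMap p.1) _ (z, 1) :=
    HasFDerivAt.comp (g := cuspMap) (z, (1 : ℂ))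
      ((hasDerivAt_cuspMap z).hasFDerivAt.restrictScalars ℝ) hfst
  have h3 := h1.prodMk (hsnd.const_mul Complex.I)
  have h4 : cuspCoord = fun p => (cuspMap p.1, Complex.I * p.2) := rfl
  rw [h4, h3.fderiv]
  simp [mul_comm]

/-- The fiber coordinate `s = i t` does not involve `z`, so `dθ` vanishes on base directions. This
is where the twist of `L` by the cusps matters. -/
lemma pullback_cuspCoord_apply {ψ : Form (ℂ × ℂ) 1} {η : Form ℂ 1} {z : ℂ}
    (hψ : ψ (cuspCoord (z, 1)) = dθ (cuspCoord (z, 1)) + pullback Prod.fst η (cuspCoord (z, 1)))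
    (s : ℂ) :
    pullback cuspCoord ψ (z, 1) (fun _ => (s, 0)) =
      (coeff η (cuspMap z) * (Complex.I * cuspMap z) * s).re := by
  have hne : (cuspCoord (z, 1)).2 ≠ 0 := by simp [cuspCoord]
  rw [pullback, ContinuousAlternatingMap.compContinuousLinearMap_apply, hψ,
    ContinuousAlternatingMap.add_apply, dθ_apply hne, pullback_fst_apply]
  simp only [Function.comp_apply]
  rw [fderiv_cuspCoord, cuspCoord_eq]
  simp only [zero_div, mul_zero, Complex.zero_re, zero_add]
  ring_nf

variable {Γ : Subgroup SL(2, ℝ)} {h : ℂ → ℝ} {ψ : Form (ℂ × ℂ) 1} {η : Form ℂ 1} {σ : SL(2, ℝ)}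

lemma eventually_connectionComp_cusp (hψ : IsGlobalAngularForm Γ ψ)
    (hη : ∀ p : ℂ × ℂ, p.1 ∈ upper → p.2 ≠ 0 → ψ p = dθ p + pullback Prod.fst η p)
    (hσ : IsCuspUniformizer Γ σ) :
    ∃ b : ℂ → ℂ, ContDiffAt ℝ ∞ b 0 ∧ ∀ᶠ z in atCusp,
      connectionComp σ (coeff η) z = b (cuspMap z) * (Complex.I * cuspMap z) := by
  obtain ⟨ε, hε, ψc, ⟨ηc, hηc, hψc⟩, hpull⟩ := hψ.cusp σ hσ
  have h0 : Metric.ball (0 : ℂ) ε ∈ 𝓝 0 := Metric.ball_mem_nhds 0 hε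
  refine ⟨coeff ηc, (contDiffOn_coeff hηc).contDiffAt h0, ?_⟩
  filter_upwards [tendsto_cuspMap h0, eventually_mem_upper] with z hz hzu
  refine eq_of_forall_re_mul_eq fun s => ?_
  rw [← pullback_tangentAct_apply hη σ hzu, hpull (z, 1) hzu one_ne_zero hz,
    pullback_cuspCoord_apply (hψc _ hz (by simp [cuspCoord]))]

lemma eventually_invLength_cusp (hh : IsHermitianMetric Γ h) (hσ : IsCuspUniformizer Γ σ) :
    ∃ c : ℂ → ℝ, ContDiffAt ℝ ∞ c 0 ∧ 0 < c 0 ∧ ∀ᶠ z in atCusp,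
      invLength h (mob σ z) = 1 / (z.im * c (cuspMap z)) := by
  obtain ⟨ε, hε, k, hk, hkpos, hpull⟩ := hh.cusp σ hσ
  have h0 : Metric.ball (0 : ℂ) ε ∈ 𝓝 0 := Metric.ball_mem_nhds 0 hε
  have hk0 := hkpos 0 (Metric.mem_ball_self hε)
  refine ⟨fun w => √(k w), (hk.contDiffAt h0).sqrt hk0.ne', Real.sqrt_pos.2 hk0, ?_⟩
  filter_upwards [tendsto_cuspMap h0, eventually_mem_upper] with z hz hzu
  refine invLength_mob σ hzu ((hpull (z, 1) hzu hz).trans ?_)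
  simp [normSq, cuspCoord, cuspMap]

/-- The metric is positive at `w = 0`, so the length `y c(w)` of a hyperbolic unit vector grows
without bound. -/
lemma tendsto_invLength_cusp (hh : IsHermitianMetric Γ h) (hσ : IsCuspUniformizer Γ σ) :
    Filter.Tendsto (fun z => invLength h (mob σ z)) atCusp (𝓝 0) := by
  obtain ⟨c, hc, hc0, heq⟩ := eventually_invLength_cusp hh hσ
  have h1 : Filter.Tendsto (fun z => (c (cuspMap z))) atCusp (𝓝 (c 0)) :=
    hc.continuousAt.tendsto.comp tendsto_cuspMap
  have h2 : Filter.Tendsto (fun z : ℂ => z.im) atCusp Filter.atTop := Filter.tendsto_comap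
  refine Filter.Tendsto.congr' (heq.mono fun z hz => hz.symm) ?_
  simp_rw [one_div]
  exact (h2.atTop_mul_pos hc0 h1).inv_tendsto_atTop

/-- The logarithmic derivative of the square root of the metric. -/
lemma logGrad_sqrt_eq (hhsm : ContDiffOn ℝ ∞ h upper) (hhpos : ∀ z ∈ upper, 0 < h z) {z : ℂ}
    (hz : z ∈ upper) :
    logGrad (fun z => √(h z)) z = gradCoeff (invLength h) z / invLength h z := by
  have h1 : gradCoeff (invLength h) z = (invLength h z : ℂ) * logGrad (fun z => √(h z)) z :=
    gradCoeff_one_div_im_mul (c := fun z => √(h z)) hz (Real.sqrt_pos.2 (hhpos z hz))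
    (((contDiffOn_sqrt hhsm hhpos).contDiffAt (isOpen_upper.mem_nhds hz)).differentiableAt
      (by simp))
  have h2 : (invLength h z : ℂ) ≠ 0 := by exact_mod_cast (invLength_pos hhpos hz).ne'
  rw [h1, mul_div_cancel_left₀ _ h2]

lemma contDiffOn_invLength (hhsm : ContDiffOn ℝ ∞ h upper) (hhpos : ∀ z ∈ upper, 0 < h z) :
    ContDiffOn ℝ ∞ (invLength h) upper := by
  unfold invLength
  simp_rw [one_div]
  exact (Complex.imCLM.contDiff.contDiffOn.mul (contDiffOn_sqrt hhsm hhpos)).inv fun z hz =>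
    (mul_pos (show 0 < z.im from hz) (Real.sqrt_pos.2 (hhpos z hz))).ne'

lemma differentiableAt_invLength (hhsm : ContDiffOn ℝ ∞ h upper) (hhpos : ∀ z ∈ upper, 0 < h z)
    {z : ℂ} (hz : z ∈ upper) : DifferentiableAt ℝ (invLength h) z :=
  ((contDiffOn_invLength hhsm hhpos).contDiffAt (isOpen_upper.mem_nhds hz)).differentiableAt
    (by simp)

lemma logGrad_mob (hhsm : ContDiffOn ℝ ∞ h upper) (hhpos : ∀ z ∈ upper, 0 < h z) (A : SL(2, ℝ))
    {z : ℂ} (hz : z ∈ upper) :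
    logGrad (fun z => √(h z)) (mob A z) * mobDeriv A z =
      gradCoeff (fun w => invLength h (mob A w)) z / invLength h (mob A z) := by
  rw [logGrad_sqrt_eq hhsm hhpos (mob_mem_upper A hz), gradCoeff_comp (hasDerivAt_mob A hz)
    (differentiableAt_invLength hhsm hhpos (mob_mem_upper A hz))]
  ring

lemma isAutomorphic_logGrad (hh : IsHermitianMetric Γ h) :
    IsAutomorphic Γ (logGrad fun z => √(h z)) := by
  intro γ hγ z hz
  rw [logGrad_mob hh.smooth hh.pos γ hz, logGrad_sqrt_eq hh.smooth hh.pos hz,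
    invLength_invariant hh γ hγ z hz]
  congr 1
  apply gradCoeff_congr
  filter_upwards [isOpen_upper.mem_nhds hz] with w hw using invLength_invariant hh γ hγ w hw

/-- At the cusp `d log f` has the coefficient `i / y` minus the pull-back of `d log c` from the
`w`-disc. The first contributes `1`, the second is damped by `y |w| ≤ 1`. -/
lemma eventually_logGrad_cusp_le (hh : IsHermitianMetric Γ h) (hσ : IsCuspUniformizer Γ σ) :
    ∃ C, ∀ᶠ z in atCusp,
      z.im * ‖logGrad (fun z => √(h z)) (mob σ z) * mobDeriv σ z‖ ≤ C := by
  obtain ⟨c, hc, hc0, heq⟩ := eventually_invLength_cusp hh hσ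
  have hcd : ∀ᶠ w in 𝓝 (0 : ℂ), DifferentiableAt ℝ c w := by
    filter_upwards [(hc.of_le (m := 1) (by exact_mod_cast le_top)).eventually (by simp)] with w hw
      using hw.differentiableAt (by simp)
  have hgc : ContinuousAt (fun w => gradCoeff c w / c w) 0 := by
    have h1 : ContinuousAt (fderiv ℝ c) 0 :=
      (hc.fderiv_right (m := 0) (by simp)).continuousAt
    have h2 : ∀ v, ContinuousAt (fun w => ((fderiv ℝ c w v : ℝ) : ℂ)) 0 := fun v =>
      Complex.continuous_ofReal.continuousAt.comp (h1.clm_apply continuousAt_const)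
    exact ((h2 _).sub (continuousAt_const.mul (h2 _))).div
      (Complex.continuous_ofReal.continuousAt.comp hc.continuousAt) (by exact_mod_cast hc0.ne')
  refine ⟨1 + (‖gradCoeff c 0 / c 0‖ + 1), ?_⟩
  filter_upwards [eventually_eventually_atCusp heq, eventually_mem_upper,
    tendsto_cuspMap.eventually hcd,
    tendsto_cuspMap.eventually (hc.continuousAt.eventually_const_lt hc0),
    eventually_norm_comp_cuspMap_le hgc] with z hz hzu hzd hzc hzb
  have hy : 0 < z.im := hzu
  have hcz : ((c (cuspMap z) : ℝ) : ℂ) ≠ 0 := by exact_mod_cast hzc.ne'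
  have hdiff : DifferentiableAt ℝ (fun w => c (cuspMap w)) z :=
    hzd.comp z ((hasDerivAt_cuspMap z).hasFDerivAt.restrictScalars ℝ).differentiableAt
  have hf : ((1 / (z.im * c (cuspMap z)) : ℝ) : ℂ) ≠ 0 := by
    exact_mod_cast (one_div_pos.2 (mul_pos hy hzc)).ne'
  rw [logGrad_mob hh.smooth hh.pos σ hzu, gradCoeff_congr hz, hz.self_of_nhds,
    gradCoeff_one_div_im_mul (c := fun w => c (cuspMap w)) hzu hzc hdiff,
    mul_div_cancel_left₀ _ hf, logGrad, gradCoeff_comp (hasDerivAt_cuspMap z) hzd]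
  refine (mul_le_mul_of_nonneg_left (norm_sub_le _ _) hy.le).trans ?_
  rw [mul_add]
  refine add_le_add ?_ ?_
  · rw [norm_div, Complex.norm_I, Complex.norm_real, Real.norm_of_nonneg hy.le,
      mul_one_div_cancel hy.ne']
  · rw [mul_div_right_comm, norm_mul, norm_mul, Complex.norm_I, one_mul]
    calc z.im * (‖gradCoeff c (cuspMap z) / c (cuspMap z)‖ * ‖cuspMap z‖)
        = (z.im * ‖cuspMap z‖) * ‖gradCoeff c (cuspMap z) / c (cuspMap z)‖ := by ring
      _ ≤ 1 * ‖gradCoeff c (cuspMap z) / c (cuspMap z)‖ :=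
          mul_le_mul_of_nonneg_right (im_mul_norm_cuspMap_le z) (norm_nonneg _)
      _ ≤ _ := by rw [one_mul]; exact hzb

lemma norm_one_div_two_pi_im {y : ℝ} (hy : 0 < y) :
    y * ‖(1 / (2 * Real.pi * y) : ℂ)‖ ≤ 1 := by
  have h1 : (1 / (2 * Real.pi * y) : ℂ) = ((1 / (2 * Real.pi * y) : ℝ) : ℂ) := by push_cast; rfl
  have hpi := Real.pi_gt_three
  rw [h1, Complex.norm_real, Real.norm_of_nonneg (by positivity)]
  have h2 : y * (1 / (2 * Real.pi * y)) = 1 / (2 * Real.pi) := by field_simp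
  rw [h2, div_le_one (by positivity)]
  linarith

lemma eventually_connection_cusp_le (hψ : IsGlobalAngularForm Γ ψ)
    (hη : ∀ p : ℂ × ℂ, p.1 ∈ upper → p.2 ≠ 0 → ψ p = dθ p + pullback Prod.fst η p)
    (hσ : IsCuspUniformizer Γ σ) :
    ∃ C, ∀ᶠ z in atCusp, z.im * ‖connection (coeff η) (mob σ z) * mobDeriv σ z‖ ≤ C := by
  obtain ⟨b, hb, heq⟩ := eventually_connectionComp_cusp hψ hη hσ
  refine ⟨(‖b 0‖ + 1) + 1, ?_⟩
  filter_upwards [heq, eventually_mem_upper, eventually_norm_comp_cuspMap_le hb.continuousAt]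
    with z hz hzu hzb
  have hy : 0 < z.im := hzu
  rw [connection_mob σ _ hzu, connection, hz]
  refine (mul_le_mul_of_nonneg_left (norm_sub_le _ _) hy.le).trans ?_
  rw [mul_add]
  refine add_le_add ?_ (norm_one_div_two_pi_im hy)
  rw [norm_mul, norm_mul, Complex.norm_I, one_mul]
  calc z.im * (‖b (cuspMap z)‖ * ‖cuspMap z‖) = (z.im * ‖cuspMap z‖) * ‖b (cuspMap z)‖ := by ring
    _ ≤ 1 * ‖b (cuspMap z)‖ :=
        mul_le_mul_of_nonneg_right (im_mul_norm_cuspMap_le z) (norm_nonneg _)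
    _ ≤ _ := by rw [one_mul]; exact hzb

lemma hasFDerivAt_one_div_two_pi_im {z : ℂ} (hz : z ∈ upper) :
    HasFDerivAt (fun w : ℂ => (1 / (2 * Real.pi * w.im) : ℂ))
      (Complex.ofRealCLM ∘L (-((2 * Real.pi * z.im) ^ 2)⁻¹ • (2 * Real.pi) • Complex.imCLM)) z := by
  have hy : 0 < z.im := hz
  have hpi := Real.pi_pos
  have h1 : HasFDerivAt (fun w : ℂ => 2 * Real.pi * w.im) ((2 * Real.pi) • Complex.imCLM) z :=
    Complex.imCLM.hasFDerivAt.const_mul _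
  have h2 := HasDerivAt.comp_hasFDerivAt z
    (hasDerivAt_inv (show 2 * Real.pi * z.im ≠ 0 by positivity)) h1
  have h3 := Complex.ofRealCLM.hasFDerivAt.comp z h2
  convert! h3 using 1
  funext w
  simp

/-- The hyperbolic correction `-1 / (2πy)` has constant curvature density `-1 / (2π)`. -/
lemma im_sq_mul_curl_connection {b : ℂ → ℂ} {z : ℂ} (hz : z ∈ upper)
    (hb : DifferentiableAt ℝ b z) :
    z.im ^ 2 * curl (connection b) z = z.im ^ 2 * curl b z - 1 / (2 * Real.pi) := by
  have hy : z.im ≠ 0 := ne_of_gt hz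
  have h1 := hb.hasFDerivAt.fun_sub (hasFDerivAt_one_div_two_pi_im hz)
  have h2 : connection b = fun w => b w - (1 / (2 * Real.pi * w.im) : ℂ) := rfl
  set L := Complex.ofRealCLM ∘L
    (-((2 * Real.pi * z.im) ^ 2)⁻¹ • (2 * Real.pi) • Complex.imCLM) with hL
  have h3 : L 1 = 0 := by simp [hL]
  have h4 : L Complex.I = ((-((2 * Real.pi * z.im) ^ 2)⁻¹ * (2 * Real.pi) : ℝ) : ℂ) := by
    simp [hL]
  rw [curl, curl, h2, h1.fderiv, _root_.sub_apply, _root_.sub_apply, h3, h4, sub_zero,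
    Complex.sub_re, Complex.ofReal_re]
  have hpi := Real.pi_ne_zero
  field_simp
  ring

lemma eventually_curl_connection_cusp_le (hψ : IsGlobalAngularForm Γ ψ)
    (hη : ∀ p : ℂ × ℂ, p.1 ∈ upper → p.2 ≠ 0 → ψ p = dθ p + pullback Prod.fst η p)
    (hσ : IsCuspUniformizer Γ σ) :
    ∃ C, ∀ᶠ z in atCusp,
      |z.im ^ 2 * curl (fun w => connection (coeff η) (mob σ w) * mobDeriv σ w) z| ≤ C := by
  obtain ⟨b, hb, heq⟩ := eventually_connectionComp_cusp hψ hη hσ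
  have hbd : ∀ᶠ w in 𝓝 (0 : ℂ), DifferentiableAt ℝ b w := by
    filter_upwards [(hb.of_le (m := 1) (by exact_mod_cast le_top)).eventually (by simp)] with w hw
      using hw.differentiableAt (by simp)
  have hcc : ContinuousAt (curl b) 0 := by
    have h1 : ContinuousAt (fderiv ℝ b) 0 :=
      (hb.fderiv_right (m := 0) (by simp)).continuousAt
    have h2 : ∀ v, ContinuousAt (fun w => fderiv ℝ b w v) 0 := fun v =>
      h1.clm_apply continuousAt_const
    exact ((Complex.continuous_im.continuousAt.comp (h2 1)).add
      (Complex.continuous_re.continuousAt.comp (h2 Complex.I))).neg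
  refine ⟨(‖curl b 0‖ + 1) + 1, ?_⟩
  filter_upwards [eventually_eventually_atCusp heq, eventually_mem_upper,
    tendsto_cuspMap.eventually hbd, eventually_norm_comp_cuspMap_le hcc] with z hz hzu hzd hzb
  have hy : 0 < z.im := hzu
  have h1 : (fun w => connection (coeff η) (mob σ w) * mobDeriv σ w) =ᶠ[𝓝 z]
      connection fun w => b (cuspMap w) * (Complex.I * cuspMap w) := by
    filter_upwards [hz, isOpen_upper.mem_nhds hzu] with w hw hwu
    rw [connection_mob σ _ hwu, connection, connection, hw]
  have h2 : DifferentiableAt ℂ (fun w => Complex.I * cuspMap w) z :=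
    (hasDerivAt_cuspMap z).differentiableAt.const_mul _
  have h3 : DifferentiableAt ℝ (fun w => b (cuspMap w)) z :=
    hzd.comp z ((hasDerivAt_cuspMap z).hasFDerivAt.restrictScalars ℝ).differentiableAt
  rw [curl_congr h1, im_sq_mul_curl_connection hzu (h3.fun_mul (h2.restrictScalars ℝ)),
    curl_comp (g := fun w => Complex.I * cuspMap w) (hasDerivAt_cuspMap z) h2 hzd]
  have hpi := Real.pi_gt_three
  refine (abs_sub _ _).trans (add_le_add ?_ ?_)
  · rw [Complex.normSq_eq_norm_sq, norm_mul, Complex.norm_I, one_mul, ← mul_assoc, ← mul_pow,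
      abs_mul, abs_of_nonneg (sq_nonneg _), ← Real.norm_eq_abs]
    have h4 : (z.im * ‖cuspMap z‖) ^ 2 ≤ 1 :=
      pow_le_one₀ (mul_nonneg hy.le (norm_nonneg _)) (im_mul_norm_cuspMap_le z)
    calc _ ≤ 1 * ‖curl b (cuspMap z)‖ := mul_le_mul_of_nonneg_right h4 (norm_nonneg _)
      _ ≤ _ := by rw [one_mul]; exact hzb
  · rw [abs_of_nonneg (by positivity), div_le_one (by positivity)]
    linarith

end

section

/-! ### Global bounds -/

variable {Γ : Subgroup SL(2, ℝ)}

/-- An invariant continuous function that is bounded near the cusps is bounded. -/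
lemma exists_bound (hΓ : DiscreteTopology Γ) (hvol : FiniteVolume Γ) {u : ℂ → ℝ}
    (hu : ContinuousOn u upper) (hinv : ∀ γ ∈ Γ, ∀ z ∈ upper, u (mob γ z) = u z)
    (hcusp : ∀ σ, IsCuspUniformizer Γ σ → ∃ C, ∀ᶠ z in atCusp, u (mob σ z) ≤ C) :
    ∃ M, ∀ z ∈ upper, u z ≤ M := by
  obtain ⟨S, hS, hSΓ, hK⟩ := exists_compact_union_cusps hΓ hvol
  have h1 : ∀ σ ∈ S, ∃ p : ℝ × ℝ, ∀ z : ℂ, p.2 ≤ z.im → u (mob σ z) ≤ p.1 := by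
    intro σ hσ
    obtain ⟨C, hC⟩ := hcusp σ (hSΓ σ hσ)
    obtain ⟨Y, hY⟩ := eventually_atCusp.1 hC
    exact ⟨(C, Y), hY⟩
  choose! p hp using h1
  obtain ⟨C, hC⟩ := (hS.image fun σ => (p σ).1).bddAbove
  obtain ⟨Y, hY⟩ := (hS.image fun σ => (p σ).2).bddAbove
  obtain ⟨K, hKc, hcov⟩ := hK Y
  obtain ⟨C', hC'⟩ := hKc.bddAbove_image
    (hu.comp_continuous UpperHalfPlane.continuous_coe coe_mem_upper).continuousOn
  refine ⟨max C C', fun z hz => ?_⟩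
  obtain ⟨γ, hγ, h⟩ := hcov ⟨z, hz⟩
  have h2 := mob_coe γ ⟨z, hz⟩
  change mob γ z = _ at h2
  rw [← hinv γ hγ z hz, h2]
  rcases h with h | ⟨σ, hσ, h⟩
  · exact (hC' ⟨_, h, rfl⟩).trans (le_max_right _ _)
  · have h3 : ((γ • (⟨z, hz⟩ : ℍ) : ℍ) : ℂ) =
        mob σ ((σ⁻¹ • γ • (⟨z, hz⟩ : ℍ) : ℍ) : ℂ) := by
      rw [mob_coe, smul_inv_smul]
    rw [h3]
    exact ((hp σ hσ _ ((hY ⟨σ, hσ, rfl⟩).trans h)).trans (hC ⟨σ, hσ, rfl⟩)).trans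
      (le_max_left _ _)

/-- A function that tends to zero at the cusps gives an exhaustion. -/
lemma exists_compact_of_tendsto_cusp (hΓ : DiscreteTopology Γ) (hvol : FiniteVolume Γ) {f : ℂ → ℝ}
    (hinv : ∀ γ ∈ Γ, ∀ z ∈ upper, f (mob γ z) = f z)
    (hcusp : ∀ σ, IsCuspUniformizer Γ σ → Filter.Tendsto (fun z => f (mob σ z)) atCusp (𝓝 0))
    {ε : ℝ} (hε : 0 < ε) :
    ∃ K : Set ℍ, IsCompact K ∧ ∀ z : ℍ, ε ≤ f z → ∃ γ ∈ Γ, γ • z ∈ K := by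
  obtain ⟨S, hS, hSΓ, hK⟩ := exists_compact_union_cusps hΓ hvol
  have h1 : ∀ σ ∈ S, ∃ Y : ℝ, ∀ z : ℂ, Y ≤ z.im → f (mob σ z) < ε := fun σ hσ =>
    eventually_atCusp.1 ((hcusp σ (hSΓ σ hσ)).eventually_lt_const hε)
  choose! p hp using h1
  obtain ⟨Y, hY⟩ := (hS.image p).bddAbove
  obtain ⟨K, hKc, hcov⟩ := hK Y
  refine ⟨K, hKc, fun z hz => ?_⟩
  obtain ⟨γ, hγ, h | ⟨σ, hσ, h⟩⟩ := hcov z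
  · exact ⟨γ, hγ, h⟩
  · exfalso
    have h3 := hp σ hσ _ ((hY ⟨σ, hσ, rfl⟩).trans h)
    rw [mob_coe, smul_inv_smul, ← mob_coe, hinv γ hγ z (coe_mem_upper z)] at h3
    exact absurd hz (not_le.2 h3)

/-- An invariant form that is bounded near the cusps is bounded. -/
lemma exists_bound_form (hΓ : DiscreteTopology Γ) (hvol : FiniteVolume Γ) {b : ℂ → ℂ}
    (hb : ContinuousOn b upper) (hbΓ : IsAutomorphic Γ b)
    (hcusp : ∀ σ, IsCuspUniformizer Γ σ →
      ∃ C, ∀ᶠ z in atCusp, z.im * ‖b (mob σ z) * mobDeriv σ z‖ ≤ C) :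
    ∃ M, ∀ z ∈ upper, z.im * ‖b z‖ ≤ M := by
  refine exists_bound hΓ hvol (Complex.continuous_im.continuousOn.mul hb.norm) ?_ ?_
  · intro γ hγ z hz
    rw [mul_comm, ← norm_mul_im_comp γ b hz, hbΓ γ hγ z hz, mul_comm]
  · intro σ hσ
    obtain ⟨C, hC⟩ := hcusp σ hσ
    refine ⟨C, ?_⟩
    filter_upwards [hC, eventually_mem_upper] with z hz hzu
    rwa [mul_comm, ← norm_mul_im_comp σ b hzu, mul_comm]

/-- An invariant form whose differential is bounded near the cusps has bounded differential. -/
lemma exists_bound_curl (hΓ : DiscreteTopology Γ) (hvol : FiniteVolume Γ) {b : ℂ → ℂ}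
    (hb : ContDiffOn ℝ ∞ b upper) (hbΓ : IsAutomorphic Γ b)
    (hcusp : ∀ σ, IsCuspUniformizer Γ σ →
      ∃ C, ∀ᶠ z in atCusp, |z.im ^ 2 * curl (fun w => b (mob σ w) * mobDeriv σ w) z| ≤ C) :
    ∃ M, ∀ z ∈ upper, |z.im ^ 2 * curl b z| ≤ M := by
  have hbd : ∀ z ∈ upper, DifferentiableAt ℝ b z := fun z hz =>
    (hb.contDiffAt (isOpen_upper.mem_nhds hz)).differentiableAt (by simp)
  refine exists_bound hΓ hvol
    ((Complex.continuous_im.continuousOn.pow 2).mul (continuousOn_curl isOpen_upper hb)).abs ?_ ?_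
  · intro γ hγ z hz
    rw [← im_sq_mul_curl_comp γ hz (hbd _ (mob_mem_upper γ hz))]
    congr 2
    apply curl_congr
    filter_upwards [isOpen_upper.mem_nhds hz] with w hw using hbΓ γ hγ w hw
  · intro σ hσ
    obtain ⟨C, hC⟩ := hcusp σ hσ
    refine ⟨C, ?_⟩
    filter_upwards [hC, eventually_mem_upper] with z hz hzu
    rwa [← im_sq_mul_curl_comp σ hzu (hbd _ (mob_mem_upper σ hzu))]

/-! ### Regularity of the coefficients -/

lemma contDiffOn_connection {b : ℂ → ℂ} (hb : ContDiffOn ℝ ∞ b upper) :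
    ContDiffOn ℝ ∞ (connection b) upper := by
  unfold connection
  simp_rw [one_div]
  refine hb.sub (ContDiffOn.inv (contDiffOn_const.mul
    (Complex.ofRealCLM ∘L Complex.imCLM).contDiff.contDiffOn) fun z hz => ?_)
  have : (z.im : ℂ) ≠ 0 := by exact_mod_cast ne_of_gt (show 0 < z.im from hz)
  simpa [Real.pi_ne_zero] using this

lemma continuousOn_gradCoeff {φ : ℂ → ℝ} (hφ : ContDiffOn ℝ ∞ φ upper) :
    ContinuousOn (gradCoeff φ) upper := by
  have h1 : ContinuousOn (fderiv ℝ φ) upper :=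
    hφ.continuousOn_fderiv_of_isOpen isOpen_upper (by simp)
  have h2 : ∀ v, ContinuousOn (fun w => ((fderiv ℝ φ w v : ℝ) : ℂ)) upper := fun v =>
    Complex.continuous_ofReal.comp_continuousOn (h1.clm_apply continuousOn_const)
  exact (h2 _).sub (continuousOn_const.mul (h2 _))

lemma continuousOn_logGrad {c : ℂ → ℝ} (hc : ContDiffOn ℝ ∞ c upper)
    (hc0 : ∀ z ∈ upper, 0 < c z) : ContinuousOn (logGrad c) upper := by
  refine (continuousOn_const.div
    (Complex.continuous_ofReal.comp Complex.continuous_im).continuousOn fun z hz => ?_).sub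
    ((continuousOn_gradCoeff hc).div (Complex.continuous_ofReal.comp_continuousOn hc.continuousOn)
      fun z hz => ?_)
  · exact Complex.ofReal_ne_zero.2 (ne_of_gt hz)
  · exact Complex.ofReal_ne_zero.2 (hc0 z hz).ne'

lemma measurable_of_continuousOn_upper {E : Type*} [TopologicalSpace E] [MeasurableSpace E]
    [BorelSpace E] {φ : ℂ → E} (hφ : ContinuousOn φ upper) : Measurable fun z : ℍ => φ z :=
  (hφ.comp_continuous UpperHalfPlane.continuous_coe coe_mem_upper).measurable

lemma continuousOn_radialCoeff {c : ℂ → ℝ} {b : ℂ → ℂ} (hl : ContinuousOn (logGrad c) upper)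
    (hβ : ContinuousOn (connection b) upper) : ContinuousOn (radialCoeff c b) upper :=
  continuousOn_const.add ((Complex.continuous_im.continuousOn.pow 2).mul
    (Complex.continuous_im.comp_continuousOn
      ((Complex.continuous_conj.comp_continuousOn hl).mul hβ)))

lemma continuousOn_phaseCoeff {c : ℂ → ℝ} {b : ℂ → ℂ} (hl : ContinuousOn (logGrad c) upper)
    (hβ : ContinuousOn (connection b) upper) : ContinuousOn (phaseCoeff c b) upper :=
  (Complex.continuous_ofReal.comp Complex.continuous_im).continuousOn.mul
    ((Complex.continuous_conj.comp_continuousOn hβ).sub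
      ((continuousOn_const.mul (Complex.continuous_conj.comp_continuousOn hl)).div_const _))

lemma one_div_two_pi_le_one : 1 / (2 * Real.pi) ≤ 1 := by
  rw [div_le_one (by positivity)]
  linarith [Real.pi_gt_three]

lemma abs_radialCoeff_le {c : ℂ → ℝ} {b : ℂ → ℂ} {z : ℂ} (hz : z ∈ upper) {M₁ M₂ : ℝ}
    (h1 : z.im * ‖connection b z‖ ≤ M₁) (h2 : z.im * ‖logGrad c z‖ ≤ M₂) :
    |radialCoeff c b z| ≤ 1 + M₂ * M₁ := by
  have hy : 0 < z.im := hz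
  rw [radialCoeff]
  refine (abs_add_le _ _).trans (add_le_add ?_ ?_)
  · rw [abs_of_nonneg (by positivity)]
    exact one_div_two_pi_le_one
  · rw [abs_mul, abs_of_nonneg (by positivity)]
    calc z.im ^ 2 * |(starRingEnd ℂ (logGrad c z) * connection b z).im|
        ≤ z.im ^ 2 * (‖logGrad c z‖ * ‖connection b z‖) := by
          refine mul_le_mul_of_nonneg_left ((Complex.abs_im_le_norm _).trans ?_) (by positivity)
          rw [norm_mul, RCLike.norm_conj]
      _ = (z.im * ‖logGrad c z‖) * (z.im * ‖connection b z‖) := by ring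
      _ ≤ M₂ * M₁ := mul_le_mul h2 h1 (by positivity) (le_trans (by positivity) h2)

lemma norm_phaseCoeff_le {c : ℂ → ℝ} {b : ℂ → ℂ} {z : ℂ} (hz : z ∈ upper) {M₁ M₂ : ℝ}
    (h1 : z.im * ‖connection b z‖ ≤ M₁) (h2 : z.im * ‖logGrad c z‖ ≤ M₂) :
    ‖phaseCoeff c b z‖ ≤ M₁ + M₂ := by
  have hy : 0 < z.im := hz
  rw [phaseCoeff, norm_mul, Complex.norm_real, Real.norm_of_nonneg hy.le]
  refine (mul_le_mul_of_nonneg_left (norm_sub_le _ _) hy.le).trans ?_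
  rw [mul_add, RCLike.norm_conj, norm_div, norm_mul, RCLike.norm_conj, Complex.norm_I, one_mul,
    Complex.norm_real, Real.norm_of_nonneg (by positivity)]
  refine add_le_add h1 (le_trans ?_ h2)
  refine mul_le_mul_of_nonneg_left (div_le_self (norm_nonneg _) ?_) hy.le
  linarith [Real.pi_gt_three]

/-! ### Bump functions -/

/-- Radii are nonnegative, so `ρ |r|` defines the same form `Ψ`; it is smooth on all of `ℝ` because
`ρ` is constant near `0`. -/
lemma IsBump.contDiff_comp_abs {ρ : ℝ → ℝ} (hρ : IsBump ρ) : ContDiff ℝ ∞ fun r => ρ |r| := by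
  rw [contDiff_iff_contDiffAt]
  intro r
  rcases lt_trichotomy r 0 with hr | rfl | hr
  · have h1 : ContDiffAt ℝ ∞ ρ (-r) := hρ.smooth.contDiffAt (Ici_mem_nhds (by linarith))
    refine (h1.comp r contDiff_neg.contDiffAt).congr_of_eventuallyEq ?_
    filter_upwards [gt_mem_nhds hr] with s hs
    simp [abs_of_neg hs]
  · obtain ⟨δ, hδ, h1⟩ := hρ.one_near_zero
    refine (contDiffAt_const (c := (1 : ℝ))).congr_of_eventuallyEq ?_
    filter_upwards [Metric.ball_mem_nhds (0 : ℝ) hδ] with s hs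
    exact h1 _ (abs_nonneg s) (by simpa using hs)
  · refine (hρ.smooth.contDiffAt (Ici_mem_nhds hr)).congr_of_eventuallyEq ?_
    filter_upwards [lt_mem_nhds hr] with s hs
    rw [abs_of_pos hs]

lemma IsBump.hasCompactSupport_comp_abs {ρ : ℝ → ℝ} (hρ : IsBump ρ) :
    HasCompactSupport fun r => ρ |r| := by
  obtain ⟨K, hK⟩ := hρ.compact_support
  refine HasCompactSupport.intro (isCompact_Icc (a := -K) (b := K)) fun r hr => ?_
  refine hK _ ?_
  by_contra! h
  exact hr ⟨(abs_lt.1 h).1.le, (abs_lt.1 h).2.le⟩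

lemma IsThomForm.comp_abs {h : ℂ → ℝ} {ρ : ℝ → ℝ} {ψ : Form (ℂ × ℂ) 1} {Ψ : Form (ℂ × ℂ) 2}
    (hΨ : IsThomForm h ρ ψ Ψ) : IsThomForm h (fun r => ρ |r|) ψ Ψ := by
  intro p hp hp0
  rw [hΨ p hp hp0]
  congr 1
  funext p'
  have h1 : 0 ≤ radius h p' := Real.sqrt_nonneg _
  simp only [abs_of_nonneg h1]

/-- The integral of the Thom form over the fiber is the differential of a bounded form. -/
lemma im_sq_mul_curl_invLength_mul {h : ℂ → ℝ} {b : ℂ → ℂ} (hhsm : ContDiffOn ℝ ∞ h upper)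
    (hhpos : ∀ z ∈ upper, 0 < h z) (hb : ContDiffOn ℝ ∞ b upper) {z : ℂ} (hz : z ∈ upper) :
    z.im ^ 2 * curl (fun w => (invLength h w : ℂ) * connection b w) z =
      invLength h z * (z.im ^ 2 * curl b z - radialCoeff (fun z => √(h z)) b z) := by
  have h1 := differentiableAt_invLength hhsm hhpos hz
  have hbd := (hb.contDiffAt (isOpen_upper.mem_nhds hz)).differentiableAt (by simp)
  have hβd := ((contDiffOn_connection hb).contDiffAt
    (isOpen_upper.mem_nhds hz)).differentiableAt (by simp)
  have h2 := im_sq_mul_curl_connection hz hbd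
  have h3 : gradCoeff (invLength h) z = (invLength h z : ℂ) * logGrad (fun z => √(h z)) z := by
    have : (invLength h z : ℂ) ≠ 0 := by exact_mod_cast (invLength_pos hhpos hz).ne'
    rw [logGrad_sqrt_eq hhsm hhpos hz]
    field_simp
  -- By the Leibniz rule, `f dβ` contributes `C - 1 / (2π)` and `df ∧ β`, with `df = f d log f`,
  -- contributes the rest of `-A`.
  rw [curl_ofReal_mul h1 hβd, fderiv_apply_eq_gradCoeff, fderiv_apply_eq_gradCoeff, h3, radialCoeff]
  simp only [Complex.mul_re, Complex.mul_im, Complex.conj_re, Complex.conj_im, Complex.ofReal_re,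
    Complex.ofReal_im, Complex.one_re, Complex.one_im, Complex.I_re, Complex.I_im]
  linear_combination invLength h z * h2

end

end CanonicalFoliation

end

/-! ### Assembly of the theorem -/

open CanonicalFoliation in
theorem theorem2p3 (Γ : Subgroup SL(2, ℝ)) (hΓ : DiscreteTopology Γ) (hvol : FiniteVolume Γ)
    (h : ℂ → ℝ) (hh : IsHermitianMetric Γ h)
    (ρ : ℝ → ℝ) (hρ : IsBump ρ)
    (ψ : Form (ℂ × ℂ) 1) (hψ : IsGlobalAngularForm Γ ψ)
    (Ψ : Form (ℂ × ℂ) 2) (hΨ : IsThomForm h ρ ψ Ψ) :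
    HasFoliationIntegral Γ Ψ 0 := by
  intro F hF
  have hFvol := volume_lt_top_of_finiteVolume hΓ hvol hF
  obtain ⟨η, hη, hψη⟩ := hψ.angular
  have hb := contDiffOn_coeff hη
  have hβ := contDiffOn_connection hb
  have hc := contDiffOn_sqrt hh.smooth hh.pos
  have hc0 : ∀ z ∈ upper, 0 < √(h z) := fun z hz => Real.sqrt_pos.2 (hh.pos z hz)
  have hl := continuousOn_logGrad hc hc0
  have hf := contDiffOn_invLength hh.smooth hh.pos
  have hf0 : ∀ z ∈ upper, 0 < invLength h z := fun z hz => invLength_pos hh.pos hz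
  have hβΓ := isAutomorphic_connection hψ hψη
  have hfΓ := invLength_invariant hh
  obtain ⟨M₁, hM₁⟩ := exists_bound_form hΓ hvol hβ.continuousOn hβΓ fun σ hσ =>
    eventually_connection_cusp_le hψ hψη hσ
  obtain ⟨M₂, hM₂⟩ := exists_bound_form hΓ hvol hl (isAutomorphic_logGrad hh) fun σ hσ =>
    eventually_logGrad_cusp_le hh hσ
  obtain ⟨M₃, hM₃⟩ := exists_bound_curl hΓ hvol hβ hβΓ fun σ hσ =>
    eventually_curl_connection_cusp_le hψ hψη hσ
  obtain ⟨M₄, hM₄⟩ := exists_bound hΓ hvol hf.continuousOn hfΓ fun σ hσ =>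
    ⟨1, (tendsto_invLength_cusp hh hσ).eventually_le_const zero_lt_one⟩
  have hI : Complex.I ∈ upper := by simp [upper]
  have hM₁0 : 0 ≤ M₁ := le_trans (by simp) (hM₁ _ hI)
  have hM₂0 : 0 ≤ M₂ := le_trans (by simp) (hM₂ _ hI)
  have hM₃0 : 0 ≤ M₃ := (abs_nonneg _).trans (hM₃ _ hI)
  have hM₄0 : 0 ≤ M₄ := (hf0 _ hI).le.trans (hM₄ _ hI)
  have hM₂₁ : 0 ≤ M₂ * M₁ := mul_nonneg hM₂0 hM₁0
  set M := 1 + M₂ * M₁ + M₁ + M₂ + M₃ + M₄ with hM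
  have hA : ∀ z ∈ upper, |radialCoeff (fun z => √(h z)) (coeff η) z| ≤ M := fun z hz =>
    (abs_radialCoeff_le hz (hM₁ z hz) (hM₂ z hz)).trans (by linarith)
  have hC : ∀ z ∈ upper, |z.im ^ 2 * curl (coeff η) z| ≤ M := by
    intro z hz
    have h1 := im_sq_mul_curl_connection hz
      ((hb.contDiffAt (isOpen_upper.mem_nhds hz)).differentiableAt (by simp))
    have h2 := hM₃ z hz
    have h3 := one_div_two_pi_le_one
    have h4 : 0 ≤ 1 / (2 * Real.pi) := by positivity
    rw [abs_le] at h2 ⊢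
    constructor <;> linarith
  have : IsFiniteMeasure ((volume : Measure UpperHalfPlane).restrict F) :=
    ⟨by rwa [Measure.restrict_apply_univ]⟩
  -- Absolute convergence, and the reduction to the integral over `F` of `f (C - A)`.
  have hmain := integrable_and_integral_prod (ν := volume.restrict F)
    (P := fun z q => (Phi z q).2) hρ.contDiff_comp_abs hρ.hasCompactSupport_comp_abs
    measurable_Phi_snd_upperHalfPlane
    (fun z G hG hGi => integrable_comp_Phi (coe_mem_upper z) hG hGi)
    (fun z G hG => integral_comp_Phi (coe_mem_upper z) hG)
    (measurable_of_continuousOn_upper hc.continuousOn)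
    (measurable_of_continuousOn_upper (continuousOn_radialCoeff hl hβ.continuousOn))
    (continuous_curl_upperHalfPlane hb).measurable
    (measurable_of_continuousOn_upper (continuousOn_phaseCoeff hl hβ.continuousOn))
    (fun z => hc0 z (coe_mem_upper z)) (M := M)
    (fun z => (hM₄ z (coe_mem_upper z)).trans (by linarith))
    (fun z => hA z (coe_mem_upper z)) (fun z => hC z (coe_mem_upper z))
    (fun z => (norm_phaseCoeff_le (coe_mem_upper z) (hM₁ z (coe_mem_upper z))
      (hM₂ z (coe_mem_upper z))).trans (by linarith))
    fun z q hq => leafDensity_eq_fiberDensity hh.smooth hh.pos hρ.contDiff_comp_abs hη hψη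
      hΨ.comp_abs z hq
  refine ⟨hmain.1, hmain.2.trans ?_⟩
  have hcurl : ∀ z ∈ upper, |z.im ^ 2 * curl (fun w => (invLength h w : ℂ) *
      connection (coeff η) w) z| ≤ M₄ * (M + M) := by
    intro z hz
    rw [im_sq_mul_curl_invLength_mul hh.smooth hh.pos hb hz, abs_mul, abs_of_pos (hf0 z hz)]
    exact mul_le_mul (hM₄ z hz) ((abs_sub _ _).trans (add_le_add (hC z hz) (hA z hz)))
      (abs_nonneg _) hM₄0
  -- The form `f Re (β dz)` is bounded with bounded differential, and `1 / f` is the exhaustion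
  -- needed for Stokes' theorem; the bound on `logGrad` makes `log f` Lipschitz.
  have hzero : ∫ z : UpperHalfPlane in F, z.im ^ 2 * curl (fun w => (invLength h w : ℂ) *
      connection (coeff η) w) z = 0 := by
    have hpos : 0 ≤ M₄ * (M + M) := (abs_nonneg _).trans (hcurl _ hI)
    have hpos' : 0 ≤ M₄ * M₁ := mul_nonneg hM₄0 hM₁0
    refine integral_curl_eq_zero_of_bounded hΓ hF hFvol hf hfΓ hf0
      (fun ε hε => exists_compact_of_tendsto_cusp hΓ hvol hfΓ
        (fun σ hσ => tendsto_invLength_cusp hh hσ) hε)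
      ((Complex.ofRealCLM.contDiff.comp_contDiffOn hf).mul hβ) ?_
      (M := M₂ + M₄ * M₁ + M₄ * (M + M)) ?_ ?_ ?_
    · intro γ hγ z hz
      beta_reduce
      rw [hfΓ γ hγ z hz, mul_assoc, hβΓ γ hγ z hz]
    · intro z hz
      have hy : 0 < z.im := hz
      have hne : (invLength h z : ℂ) ≠ 0 := by exact_mod_cast (hf0 z hz).ne'
      have h1 : gradCoeff (invLength h) z =
          (invLength h z : ℂ) * logGrad (fun z => √(h z)) z := by
        rw [logGrad_sqrt_eq hh.smooth hh.pos hz]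
        field_simp
      calc z.im * ‖fderiv ℝ (invLength h) z‖ ≤ z.im * ‖gradCoeff (invLength h) z‖ :=
            mul_le_mul_of_nonneg_left (norm_fderiv_le_gradCoeff _ _) hy.le
        _ = (z.im * ‖logGrad (fun z => √(h z)) z‖) * invLength h z := by
            rw [h1, norm_mul, Complex.norm_real, Real.norm_of_nonneg (hf0 z hz).le]
            ring
        _ ≤ _ := mul_le_mul_of_nonneg_right ((hM₂ z hz).trans (by linarith)) (hf0 z hz).le
    · intro z hz
      rw [norm_mul, Complex.norm_real, Real.norm_of_nonneg (hf0 z hz).le]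
      calc z.im * (invLength h z * ‖connection (coeff η) z‖)
          = invLength h z * (z.im * ‖connection (coeff η) z‖) := by ring
        _ ≤ M₄ * M₁ := mul_le_mul (hM₄ z hz) (hM₁ z hz)
            (mul_nonneg (le_of_lt hz) (norm_nonneg _)) hM₄0
        _ ≤ _ := by linarith
    · exact fun z hz => (hcurl z hz).trans (by linarith)
  have hfin : ∫ z : UpperHalfPlane in F, 1 / (z.im * √(h z)) * (z.im ^ 2 * curl (coeff η) z -
      radialCoeff (fun z => √(h z)) (coeff η) z) = 0 := by
    rw [← hzero]
    exact integral_congr_ae (.of_forall fun z =>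
      (im_sq_mul_curl_invLength_mul hh.smooth hh.pos hb (coe_mem_upper z)).symm)
  rw [hfin, mul_zero]
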